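/- Theorem 1. There is an absolute constant $A$ such that the following holds. Let $X_1,X_2,\dots$ be independent, identically distributed real random variables with $\mathbb{E}X_1=0$, $\mathbb{E}X_1^2=\sigma^2\in(0,\infty)$, $\sigma>0$, and $\mathbb{E}|X_1|^3<\infty$. Let $S_0=0$, $S_n=X_1+\dots+X_n$ for $n\ge 1$, and let $\tau=\inf\{n\ge 1: S_n\le 0\}$ be the first time at which the walk is non-positive. Then $\tau<\infty$ almost surely, $S_\tau$ is integrable with $\mathbb{E}S_\tau\ne 0$, and $\mathbb{P}(\tau>n)>0$ for every $n\ge 1$. Moreover, for every $n\ge 1$ and every $x\ge 0$, $$ \left|\mathbb{P}\left(\frac{S_n}{\sigma\sqrt{n}}\ge x\,\middle|\,\tau>n\right)-e^{-x^2/2}\right| \le A\,\frac{(\mathbb{E}|X_1|^3)^3}{\sigma^9\sqrt{n}}, $$ and, for every $n\ge 1$, $$ \left|\frac{\mathbb{P}(\tau>n)}{\sqrt{\frac{2}{\pi}}\;\frac{|\mathbb{E}S_\tau|}{\sigma}\,n^{-1/2}}-1\right| \le A\,\frac{(\mathbb{E}|X_1|^3)^3}{\sigma^9\sqrt{n}}.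 $$ -/

import Mathlib

open MeasureTheory ProbabilityTheory

noncomputable section

/-- The random walk `S n = X 0 + ⋯ + X (n - 1)` with `S 0 = 0`; the increments are indexed from
`0`, so that `X 0` plays the role of the first increment. -/
def walk {Ω : Type*} (X : ℕ → Ω → ℝ) (n : ℕ) (ω : Ω) : ℝ :=
  ∑ i ∈ Finset.range n, X i ω

/-- The first time `n ≥ 1` at which the walk is non-positive, with value `⊤` if there is none. -/
def exitTime {Ω : Type*} (X : ℕ → Ω → ℝ) : Ω → WithTop ℕ :=
  hittingAfter (walk X) (Set.Iic 0) 1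

/-- The position of the walk at the exit time (an arbitrary value of the walk where the exit time
is infinite). -/
def exitValue {Ω : Type*} (X : ℕ → Ω → ℝ) : Ω → ℝ :=
  stoppedValue (walk X) (exitTime X)

end

/-!
After scaling, `σ = 1`. Lindeberg's exchange of the increments by Gaussian ones, with a smoothing
that is removed by induction on `n`, gives the Berry–Esseen inequality for the free walk.

For the walk killed on leaving `(0, ∞)`, a concave test function, evaluated along the walk, bounds
the time spent in `[0, r]`, and hence the mean overshoot below `0`, by a constant times
`𝔼|X₁|³`. As conditioning on survival makes the walk stochastically larger, the walk surviving up
to time `n` is typically of order `√n`; its mean is known from the martingale property, so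
`ℙ(τ > n)` is at most of order `1 / √n`. Reversing time in the last part of an excursion turns this
into a bound of order `1 / n` for the probability that the walk exits at time `n`.

Since the walk exits close to `0`, the reflection principle holds up to an error of relative order
`1 / √n`, for any initial law on the half-line. It is applied to the second half of the walk: with
`h z s y` the probability that a Brownian motion started from `y` and killed at `0` is above `z` at
time `s ^ 2`, the tail `ℙ(S n ≥ z, τ > n)` is `𝔼[h z √(n - m) (S m); τ > m]` up to
`O(ℙ(τ > m) / √n) = O(1 / n)`, where `m = n / 2`. Over the first half, this quantity starts from
`h z √n 0 = 0` and changes only by Lindeberg errors and by the exits. An exit at `-y` contributes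
`2 y φ(z / √n) / √n` to first order, where `φ` is the standard normal density, so that
`ℙ(S n ≥ z, τ > n) = 2 φ(z / √n) |𝔼 S_τ| / √n + O(1 / n)`. The case `z = 0` is the asymptotics of
`ℙ(τ > n)`, and the quotient gives the conditional limit law.
-/

open Filter Set Topology

/-! ### Convolutions and the Kolmogorov distance -/

section Convolution

variable {M : Type*} [AddMonoid M] [MeasurableSpace M]

lemma conv_real_apply [MeasurableAdd₂ M] (ρ ν : Measure M) [IsFiniteMeasure ρ] [IsFiniteMeasure ν]
    {s : Set M} (hs : MeasurableSet s) :
    (ρ ∗ ν).real s = ∫ w, ν.real ((w + ·) ⁻¹' s) ∂ρ := by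
  rw [← integral_indicator_one hs, integral_conv ((integrable_const 1).indicator hs)]
  congr 1 with w
  rw [← integral_indicator_one (measurable_const_add w hs)]
  rfl

/-- The `n`-fold convolution power of a measure, the law of a random walk at time `n`. -/
noncomputable def convPow (μ : Measure M) : ℕ → Measure M
  | 0 => Measure.dirac 0
  | n + 1 => convPow μ n ∗ μ

instance convPow.instIsProbabilityMeasure [MeasurableAdd₂ M] (μ : Measure M)
    [IsProbabilityMeasure μ] (n : ℕ) : IsProbabilityMeasure (convPow μ n) := by
  induction n with
  | zero => exact Measure.dirac.isProbabilityMeasure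
  | succ n ih => unfold convPow; infer_instance

end Convolution

section RealMeasure

variable (ρ ν : Measure ℝ)

lemma conv_real_Iic [IsFiniteMeasure ρ] [IsFiniteMeasure ν] (z : ℝ) :
    (ρ ∗ ν).real (Iic z) = ∫ w, ν.real (Iic (z - w)) ∂ρ := by
  simp only [conv_real_apply ρ ν measurableSet_Iic, preimage_const_add_Iic]

lemma conv_real_Ici [IsFiniteMeasure ρ] [IsFiniteMeasure ν] (z : ℝ) :
    (ρ ∗ ν).real (Ici z) = ∫ w, ν.real (Ici (z - w)) ∂ρ := by
  simp only [conv_real_apply ρ ν measurableSet_Ici, preimage_const_add_Ici]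

lemma convPow_neg [IsProbabilityMeasure ρ] (n : ℕ) : convPow ρ.neg n = (convPow ρ n).neg := by
  induction n with
  | zero => simp [convPow, Measure.neg, Measure.map_dirac]
  | succ n ih =>
    rw [convPow, ih, convPow]
    exact (Measure.map_conv_addMonoidHom (negAddMonoidHom (α := ℝ)) measurable_neg).symm

lemma convPow_real_Ici [IsProbabilityMeasure ρ] (n : ℕ) (x : ℝ) :
    (convPow ρ n).real (Ici x) = (convPow ρ.neg n).real (Iic (-x)) := by
  simp [convPow_neg, measureReal_def, Measure.neg_apply]

lemma measurable_real_Iic [IsFiniteMeasure ρ] : Measurable fun x => ρ.real (Iic x) :=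
  Monotone.measurable fun _ _ h => measureReal_mono (Iic_subset_Iic.2 h)

lemma integrable_real_Iic_const_sub [IsFiniteMeasure ρ] [IsFiniteMeasure ν] (z : ℝ) :
    Integrable (fun y => ρ.real (Iic (z - y))) ν :=
  (integrable_const (ρ.real univ)).mono'
    ((measurable_real_Iic ρ).comp (measurable_const.sub measurable_id)).aestronglyMeasurable
    (.of_forall fun _ => by
      rw [Real.norm_of_nonneg measureReal_nonneg]; exact measureReal_mono (subset_univ _))

lemma integrable_real_Ici_const_sub [IsFiniteMeasure ρ] [IsFiniteMeasure ν] (z : ℝ) :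
    Integrable (fun y => ρ.real (Ici (z - y))) ν :=
  (integrable_const (ρ.real univ)).mono'
    (Monotone.measurable fun _ _ h =>
      measureReal_mono (Ici_subset_Ici.2 (sub_le_sub_left h z))).aestronglyMeasurable
    (.of_forall fun _ => by
      rw [Real.norm_of_nonneg measureReal_nonneg]; exact measureReal_mono (subset_univ _))

/-- The Kolmogorov distance of two laws on the line, the supremum distance of their distribution
functions. -/
noncomputable def kolmogorovDist : ℝ := ⨆ x, |ρ.real (Iic x) - ν.real (Iic x)|

variable {ρ ν}

lemma kolmogorovDist_nonneg : 0 ≤ kolmogorovDist ρ ν := Real.iSup_nonneg fun _ => abs_nonneg _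

lemma kolmogorovDist_le {D : ℝ} (hD : ∀ x, |ρ.real (Iic x) - ν.real (Iic x)| ≤ D) :
    kolmogorovDist ρ ν ≤ D :=
  ciSup_le hD

variable [IsProbabilityMeasure ρ] [IsProbabilityMeasure ν]

lemma abs_measureReal_sub_measureReal_le_one (s : Set ℝ) : |ρ.real s - ν.real s| ≤ 1 :=
  abs_sub_le_iff.2
    ⟨by linarith [measureReal_le_one (μ := ρ) (s := s), measureReal_nonneg (μ := ν) (s := s)],
      by linarith [measureReal_le_one (μ := ν) (s := s), measureReal_nonneg (μ := ρ) (s := s)]⟩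

lemma kolmogorovDist_le_one : kolmogorovDist ρ ν ≤ 1 :=
  kolmogorovDist_le fun _ => abs_measureReal_sub_measureReal_le_one _

lemma abs_real_Iic_sub_le_kolmogorovDist (x : ℝ) :
    |ρ.real (Iic x) - ν.real (Iic x)| ≤ kolmogorovDist ρ ν :=
  le_ciSup (f := fun x => |ρ.real (Iic x) - ν.real (Iic x)|)
    ⟨1, by rintro _ ⟨y, rfl⟩; exact abs_measureReal_sub_measureReal_le_one _⟩ x

end RealMeasure

/-! ### The standard normal law -/

/-- The standard normal density. -/
noncomputable def stdPdf (x : ℝ) : ℝ := (√(2 * Real.pi))⁻¹ * Real.exp (-x ^ 2 / 2)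

/-- The standard normal distribution function. -/
noncomputable def stdCdf (x : ℝ) : ℝ := (gaussianReal 0 1).real (Iic x)

/-- The second derivative of the standard normal density. -/
noncomputable def stdPdf₂ (x : ℝ) : ℝ := (x ^ 2 - 1) * stdPdf x

/-- The third derivative of the standard normal density. -/
noncomputable def stdPdf₃ (x : ℝ) : ℝ := (3 * x - x ^ 3) * stdPdf x

/-- The total variation of the second derivative of the standard normal density. -/
noncomputable def stdPdf₂Var : ℝ := ∫ t, |stdPdf₃ t|

lemma stdPdf₂Var_nonneg : 0 ≤ stdPdf₂Var := integral_nonneg fun _ => abs_nonneg _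

lemma gaussianPDFReal_zero_one : gaussianPDFReal 0 1 = stdPdf := by
  ext x; simp [gaussianPDFReal_def, stdPdf]

lemma stdPdf_nonneg (x : ℝ) : 0 ≤ stdPdf x := by unfold stdPdf; positivity

lemma inv_sqrt_two_pi_le_half : (√(2 * Real.pi))⁻¹ ≤ 1 / 2 := by
  rw [one_div]
  exact inv_anti₀ (by norm_num) (Real.le_sqrt_of_sq_le (by linarith [Real.pi_gt_three]))

lemma stdPdf_le_half (x : ℝ) : stdPdf x ≤ 1 / 2 := by
  refine (mul_le_of_le_one_right (by positivity) ?_).trans inv_sqrt_two_pi_le_half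
  exact Real.exp_le_one_iff.2 (by linarith [sq_nonneg x])

lemma stdPdf_le_one (x : ℝ) : stdPdf x ≤ 1 := (stdPdf_le_half x).trans (by norm_num)

lemma exp_neg_sq_div_two_le (x : ℝ) : Real.exp (-x ^ 2 / 2) ≤ (1 + x ^ 2 / 2)⁻¹ := by
  rw [show -x ^ 2 / 2 = -(x ^ 2 / 2) by ring, Real.exp_neg]
  exact inv_anti₀ (by positivity) (by linarith [Real.add_one_le_exp (x ^ 2 / 2)])

lemma abs_mul_stdPdf_le_one {a x : ℝ} (h : |a| ≤ 2 + x ^ 2) : |a * stdPdf x| ≤ 1 := by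
  rw [abs_mul, abs_of_nonneg (stdPdf_nonneg x)]
  have hpdf : stdPdf x ≤ 1 / 2 * (1 + x ^ 2 / 2)⁻¹ :=
    mul_le_mul inv_sqrt_two_pi_le_half (exp_neg_sq_div_two_le x) (Real.exp_pos _).le (by norm_num)
  calc |a| * stdPdf x ≤ (2 + x ^ 2) * (1 / 2 * (1 + x ^ 2 / 2)⁻¹) :=
        mul_le_mul h hpdf (stdPdf_nonneg x) (by positivity)
    _ = 1 := by field_simp

lemma abs_id_mul_stdPdf_le_one (x : ℝ) : |x * stdPdf x| ≤ 1 :=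
  abs_mul_stdPdf_le_one
    (abs_le.2 ⟨by nlinarith [sq_nonneg (x + 1)], by nlinarith [sq_nonneg (x - 1)]⟩)

lemma abs_stdPdf₂_le_one (x : ℝ) : |stdPdf₂ x| ≤ 1 :=
  abs_mul_stdPdf_le_one (abs_le.2 ⟨by nlinarith [sq_nonneg x], by linarith⟩)

lemma hasDerivAt_stdPdf (x : ℝ) : HasDerivAt stdPdf (-x * stdPdf x) x := by
  have h : HasDerivAt (fun x : ℝ => -x ^ 2 / 2) (-x) x :=
    (((hasDerivAt_pow 2 x).neg).div_const 2).congr_deriv (by norm_num; ring)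
  exact ((h.exp).const_mul (√(2 * Real.pi))⁻¹).congr_deriv (by unfold stdPdf; ring)

lemma hasDerivAt_neg_mul_stdPdf (x : ℝ) :
    HasDerivAt (fun x => -x * stdPdf x) (stdPdf₂ x) x :=
  (((hasDerivAt_id x).neg).mul (hasDerivAt_stdPdf x)).congr_deriv (by unfold stdPdf₂; simp; ring)

lemma hasDerivAt_stdPdf₂ (x : ℝ) : HasDerivAt stdPdf₂ (stdPdf₃ x) x :=
  ((((hasDerivAt_pow 2 x).sub_const 1)).mul (hasDerivAt_stdPdf x)).congr_deriv
    (by unfold stdPdf₃; simp; ring)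

lemma continuous_stdPdf : Continuous stdPdf := by unfold stdPdf; fun_prop

lemma integrable_pow_mul_stdPdf (k : ℕ) : Integrable fun x : ℝ => x ^ k * stdPdf x := by
  have hk : (-1 : ℝ) < k := by linarith [k.cast_nonneg (α := ℝ)]
  refine ((integrable_rpow_mul_exp_neg_mul_sq one_half_pos hk).const_mul
    (√(2 * Real.pi))⁻¹).congr (.of_forall fun x => ?_)
  simp only [stdPdf, Real.rpow_natCast]
  rw [show -x ^ 2 / 2 = -(1 / 2) * x ^ 2 by ring]; ring

lemma integrable_stdPdf : Integrable stdPdf := by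
  simpa using integrable_pow_mul_stdPdf 0

lemma integrable_stdPdf₂ : Integrable stdPdf₂ := by
  refine ((integrable_pow_mul_stdPdf 2).sub integrable_stdPdf).congr (.of_forall fun x => ?_)
  simp only [stdPdf₂, Pi.sub_apply]; ring

lemma integrable_stdPdf₃ : Integrable stdPdf₃ := by
  refine (((integrable_pow_mul_stdPdf 1).const_mul 3).sub (integrable_pow_mul_stdPdf 3)).congr
    (.of_forall fun x => ?_)
  simp only [stdPdf₃, Pi.sub_apply]; ring

lemma stdPdf₂_eq_integral_Iic (x : ℝ) : stdPdf₂ x = ∫ t in Iic x, stdPdf₃ t := by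
  have hlim : Tendsto stdPdf₂ atBot (𝓝 0) :=
    tendsto_zero_of_hasDerivAt_of_integrableOn_Iic (a := x) (fun y _ => hasDerivAt_stdPdf₂ y)
      integrable_stdPdf₃.integrableOn integrable_stdPdf₂.integrableOn
  rw [integral_Iic_of_hasDerivAt_of_tendsto' (fun y _ => hasDerivAt_stdPdf₂ y)
    integrable_stdPdf₃.integrableOn hlim, sub_zero]

lemma stdCdf_eq_integral_Iic (x : ℝ) : stdCdf x = ∫ t in Iic x, stdPdf t := by
  rw [stdCdf, measureReal_def, gaussianReal_apply_eq_integral 0 one_ne_zero,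
    gaussianPDFReal_zero_one, ENNReal.toReal_ofReal (integral_nonneg stdPdf_nonneg)]

lemma hasDerivAt_stdCdf (x : ℝ) : HasDerivAt stdCdf (stdPdf x) x := by
  have h : stdCdf = fun x => (∫ t in Iic (0 : ℝ), stdPdf t) + ∫ t in (0 : ℝ)..x, stdPdf t := by
    ext x
    rw [stdCdf_eq_integral_Iic, ← intervalIntegral.integral_Iic_sub_Iic
      integrable_stdPdf.integrableOn integrable_stdPdf.integrableOn]
    ring
  rw [h]
  exact (intervalIntegral.integral_hasDerivAt_right integrable_stdPdf.intervalIntegrable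
    (continuous_stdPdf.stronglyMeasurableAtFilter _ _) continuous_stdPdf.continuousAt).const_add _

lemma stdCdf_nonneg (x : ℝ) : 0 ≤ stdCdf x := measureReal_nonneg

lemma stdCdf_le_one (x : ℝ) : stdCdf x ≤ 1 := measureReal_le_one

lemma abs_stdCdf_sub_le (x y : ℝ) : |stdCdf x - stdCdf y| ≤ |x - y| := by
  have := Convex.norm_image_sub_le_of_norm_hasDerivWithin_le (s := univ) (x := y) (y := x)
    (C := 1) (fun x _ => (hasDerivAt_stdCdf x).hasDerivWithinAt)
    (fun x _ => by rw [Real.norm_of_nonneg (stdPdf_nonneg x)]; exact stdPdf_le_one x)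
    convex_univ trivial trivial
  simpa using this

lemma neg_gaussianReal_zero (v : NNReal) : (gaussianReal 0 v).neg = gaussianReal 0 v := by
  simpa [Measure.neg] using gaussianReal_map_neg (μ := 0) (v := v)

lemma integral_comp_neg_gaussianReal (v : NNReal) (f : ℝ → ℝ) :
    ∫ x, f (-x) ∂gaussianReal 0 v = ∫ x, f x ∂gaussianReal 0 v := by
  conv_rhs => rw [← neg_gaussianReal_zero]
  exact (integral_map_equiv (MeasurableEquiv.neg ℝ) f).symm

lemma stdCdf_neg (x : ℝ) : stdCdf (-x) = 1 - stdCdf x := by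
  have := nullSingletonClass_gaussianReal (μ := 0) (v := 1) one_ne_zero
  have hIci : stdCdf (-x) = (gaussianReal 0 1).real (Ici x) := by
    rw [stdCdf, ← neg_gaussianReal_zero, measureReal_def, Measure.neg_apply, neg_Iic, neg_neg,
      neg_gaussianReal_zero, measureReal_def]
  rw [hIci, ← measureReal_congr Ioi_ae_eq_Ici, ← compl_Iic,
    probReal_compl_eq_one_sub measurableSet_Iic, stdCdf]

lemma gaussianReal_real_Iic {v : NNReal} (hv : v ≠ 0) (x : ℝ) :
    (gaussianReal 0 v).real (Iic x) = stdCdf (x / √v) := by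
  have hv' : 0 < √(v : ℝ) := Real.sqrt_pos.2 (by positivity)
  have hmap : (gaussianReal 0 1).map (√(v : ℝ) * ·) = gaussianReal 0 v := by
    rw [gaussianReal_map_const_mul, mul_zero, mul_one]
    congr 1; ext; simp
  rw [← hmap, map_measureReal_apply (by fun_prop) measurableSet_Iic, stdCdf]
  congr 1 with y
  simp [le_div_iff₀ hv', mul_comm]

lemma integrable_abs_pow_gaussianReal (v : NNReal) (k : ℕ) :
    Integrable (fun x : ℝ => |x| ^ k) (gaussianReal 0 v) := by
  simpa using (memLp_id_gaussianReal' (μ := 0) (v := v) k (by simp)).integrable_norm_pow'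

lemma integral_sq_gaussianReal (v : NNReal) : ∫ x, x ^ 2 ∂gaussianReal 0 v = v := by
  have h := variance_fun_id_gaussianReal (μ := 0) (v := v)
  rw [variance_eq_integral (by fun_prop)] at h
  simpa [integral_id_gaussianReal] using h

/-! ### Standardised laws and Lindeberg's comparison -/

/-- Laws on the line with mean zero, unit variance and a finite third absolute moment. -/
class IsStdLaw (μ : Measure ℝ) : Prop extends IsProbabilityMeasure μ where
  integrable_cube : Integrable (fun x => |x| ^ 3) μ
  mean : ∫ x, x ∂μ = 0
  sq : ∫ x, x ^ 2 ∂μ = 1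

/-- The third absolute moment of a law, which governs all error terms. -/
noncomputable def thirdMoment (μ : Measure ℝ) : ℝ := ∫ x, |x| ^ 3 ∂μ

instance : IsStdLaw (gaussianReal 0 1) where
  integrable_cube := integrable_abs_pow_gaussianReal 1 3
  mean := integral_id_gaussianReal
  sq := by simpa using integral_sq_gaussianReal 1

namespace IsStdLaw

variable (μ : Measure ℝ) [IsStdLaw μ]

lemma integrable_sq : Integrable (fun x : ℝ => x ^ 2) μ := by
  refine ((integrable_const 1).add (integrable_cube (μ := μ))).mono' (by fun_prop)
    (.of_forall fun x => ?_)
  simp only [Pi.add_apply, norm_pow, Real.norm_eq_abs]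
  rcases le_total |x| 1 with h | h
  · nlinarith [abs_nonneg x, pow_nonneg (abs_nonneg x) 3]
  · nlinarith [abs_nonneg x, pow_nonneg (abs_nonneg x) 2]

lemma integrable_abs : Integrable (fun x : ℝ => |x|) μ := by
  refine ((integrable_const 1).add (integrable_sq μ)).mono' (by fun_prop)
    (.of_forall fun x => ?_)
  simp only [Pi.add_apply, Real.norm_eq_abs, abs_abs]
  rw [← sq_abs]
  nlinarith [sq_nonneg (|x| - 1)]

lemma integrable_id : Integrable (fun x : ℝ => x) μ :=
  (integrable_abs μ).mono' (by fun_prop) (.of_forall fun _ => le_rfl)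

lemma one_le_thirdMoment : 1 ≤ thirdMoment μ := by
  have hcube := integrable_cube (μ := μ)
  have h : ∫ x, 3 * x ^ 2 ∂μ ≤ ∫ x, 2 * |x| ^ 3 + 1 ∂μ := by
    refine integral_mono ((integrable_sq μ).const_mul 3)
      ((hcube.const_mul 2).add (integrable_const 1)) fun x => ?_
    simp only
    rw [← sq_abs]
    nlinarith [mul_nonneg (sq_nonneg (|x| - 1)) (by positivity : 0 ≤ 2 * |x| + 1)]
  rw [integral_const_mul, sq, integral_add (hcube.const_mul 2) (integrable_const 1),
    integral_const_mul] at h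
  simp only [integral_const, probReal_univ, smul_eq_mul] at h
  unfold thirdMoment
  linarith

end IsStdLaw

lemma integral_neg_measure (μ : Measure ℝ) (f : ℝ → ℝ) : ∫ x, f x ∂μ.neg = ∫ x, f (-x) ∂μ :=
  integral_map_equiv (MeasurableEquiv.neg ℝ) f

instance (μ : Measure ℝ) [IsStdLaw μ] : IsStdLaw μ.neg where
  toIsProbabilityMeasure := Measure.isProbabilityMeasure_map (by fun_prop)
  integrable_cube := (integrable_map_equiv (MeasurableEquiv.neg ℝ) _).2
    ((IsStdLaw.integrable_cube (μ := μ)).congr (.of_forall fun x => by simp))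
  mean := by rw [integral_neg_measure, integral_neg, IsStdLaw.mean, neg_zero]
  sq := by rw [integral_neg_measure]; simpa using IsStdLaw.sq (μ := μ)

lemma thirdMoment_neg (μ : Measure ℝ) : thirdMoment μ.neg = thirdMoment μ := by
  rw [thirdMoment, integral_neg_measure]; simp [thirdMoment]

section Taylor

variable {f f₁ f₂ f₃ : ℝ → ℝ} {B : ℝ}

lemma abs_sub_le_of_hasDerivAt_le {r x : ℝ} (h : ∀ y, HasDerivAt f (f₁ y) y)
    (hx : |x| ≤ r) (hB : ∀ y, |y| ≤ r → |f₁ y| ≤ B) : |f x - f 0| ≤ B * |x| := by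
  have hr : 0 ≤ r := (abs_nonneg x).trans hx
  have := (convex_Icc (-r) r).norm_image_sub_le_of_norm_hasDerivWithin_le (x := 0) (y := x) (C := B)
    (fun y _ => (h y).hasDerivWithinAt) (fun y hy => hB y (abs_le.2 hy))
    ⟨by linarith, hr⟩ (abs_le.1 hx)
  simpa using this

lemma abs_sub_taylor_one_le (h : ∀ y, HasDerivAt f (f₁ y) y)
    (h₁ : ∀ y, HasDerivAt f₁ (f₂ y) y) (hB : ∀ y, |f₂ y| ≤ B) (x : ℝ) :
    |f x - f 0 - f₁ 0 * x| ≤ B * x ^ 2 := by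
  have hB0 : 0 ≤ B := (abs_nonneg _).trans (hB 0)
  have hderiv : ∀ y, HasDerivAt (fun y => f y - f₁ 0 * y) (f₁ y - f₁ 0) y := fun y =>
    ((h y).sub ((hasDerivAt_id y).const_mul (f₁ 0))).congr_deriv (by simp)
  have := abs_sub_le_of_hasDerivAt_le (B := B * |x|) hderiv (le_refl |x|) fun y hy =>
    (abs_sub_le_of_hasDerivAt_le h₁ hy fun z _ => hB z).trans (by gcongr)
  rw [mul_assoc, ← sq, sq_abs] at this
  convert this using 2
  ring

lemma abs_sub_taylor_two_le (h : ∀ y, HasDerivAt f (f₁ y) y)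
    (h₁ : ∀ y, HasDerivAt f₁ (f₂ y) y) (h₂ : ∀ y, HasDerivAt f₂ (f₃ y) y)
    (hB : ∀ y, |f₃ y| ≤ B) (x : ℝ) :
    |f x - (f 0 + f₁ 0 * x + f₂ 0 / 2 * x ^ 2)| ≤ B * |x| ^ 3 := by
  have hB0 : 0 ≤ B := (abs_nonneg _).trans (hB 0)
  have hderiv : ∀ y, HasDerivAt (fun y => f y - (f₁ 0 * y + f₂ 0 / 2 * y ^ 2))
      (f₁ y - f₁ 0 - f₂ 0 * y) y := fun y => by
    refine ((h y).sub (((hasDerivAt_id y).const_mul (f₁ 0)).add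
      ((hasDerivAt_pow 2 y).const_mul (f₂ 0 / 2)))).congr_deriv ?_
    simp; ring
  have := abs_sub_le_of_hasDerivAt_le (B := B * |x| ^ 2) hderiv (le_refl |x|) fun y hy =>
    (abs_sub_taylor_one_le h₁ h₂ hB y).trans (by rw [← sq_abs y]; gcongr)
  rw [mul_assoc, ← pow_succ] at this
  convert this using 2
  ring

variable (μ ν : Measure ℝ) [IsStdLaw μ] [IsStdLaw ν]

lemma abs_integral_sub_taylor_two_le (h : ∀ y, HasDerivAt f (f₁ y) y)
    (h₁ : ∀ y, HasDerivAt f₁ (f₂ y) y) (h₂ : ∀ y, HasDerivAt f₂ (f₃ y) y)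
    (hB : ∀ y, |f₃ y| ≤ B) :
    |∫ x, f x ∂μ - (f 0 + f₂ 0 / 2)| ≤ B * thirdMoment μ := by
  have hf : Continuous f := continuous_iff_continuousAt.2 fun x => (h x).continuousAt
  set T : ℝ → ℝ := fun x => f 0 + f₁ 0 * x + f₂ 0 / 2 * x ^ 2
  have haffine : Integrable (fun x => f 0 + f₁ 0 * x) μ :=
    (integrable_const _).add ((IsStdLaw.integrable_id μ).const_mul _)
  have hquad : Integrable (fun x => f₂ 0 / 2 * x ^ 2) μ := (IsStdLaw.integrable_sq μ).const_mul _
  have hT : Integrable T μ := haffine.add hquad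
  have hTint : ∫ x, T x ∂μ = f 0 + f₂ 0 / 2 := by
    simp only [T]
    rw [integral_add haffine hquad, integral_add (integrable_const _)
      ((IsStdLaw.integrable_id μ).const_mul _), integral_const_mul, integral_const_mul,
      IsStdLaw.mean, IsStdLaw.sq]
    simp
  have hrem : ∀ x, ‖f x - T x‖ ≤ B * |x| ^ 3 := abs_sub_taylor_two_le h h₁ h₂ hB
  have hcube := (IsStdLaw.integrable_cube (μ := μ)).const_mul B
  have hf : Integrable f μ :=
    ((hcube.mono' (f := fun x => f x - T x) (by fun_prop) (.of_forall hrem)).add hT).congr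
      (.of_forall fun x => by simp)
  rw [← hTint, ← integral_sub hf hT, thirdMoment, ← integral_const_mul]
  exact norm_integral_le_of_norm_le hcube (.of_forall hrem)

lemma abs_integral_sub_integral_le_of_stdLaw (h : ∀ y, HasDerivAt f (f₁ y) y)
    (h₁ : ∀ y, HasDerivAt f₁ (f₂ y) y) (h₂ : ∀ y, HasDerivAt f₂ (f₃ y) y)
    (hB : ∀ y, |f₃ y| ≤ B) :
    |∫ x, f x ∂μ - ∫ x, f x ∂ν| ≤ B * (thirdMoment μ + thirdMoment ν) := by
  rw [mul_add]
  refine (abs_sub_le _ (f 0 + f₂ 0 / 2) _).trans (add_le_add ?_ ?_)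
  · exact abs_integral_sub_taylor_two_le μ h h₁ h₂ hB
  · rw [abs_sub_comm]
    exact abs_integral_sub_taylor_two_le ν h h₁ h₂ hB

end Taylor

/-! ### Gaussian smoothing -/

section Smoothing

variable (ρ : Measure ℝ) [IsFiniteMeasure ρ] {f f' : ℝ → ℝ} {A A' : ℝ}

lemma hasDerivAt_integral_comp_sub (h : ∀ y, HasDerivAt f (f' y) y) (hA : ∀ y, |f y| ≤ A)
    (hA' : ∀ y, |f' y| ≤ A') (a : ℝ) :
    HasDerivAt (fun a => ∫ w, f (a - w) ∂ρ) (∫ w, f' (a - w) ∂ρ) a := by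
  have hf : Continuous f := continuous_iff_continuousAt.2 fun x => (h x).continuousAt
  have hf' : Measurable f' := by
    rw [show f' = deriv f from funext fun x => (h x).deriv.symm]; exact measurable_deriv f
  refine (hasDerivAt_integral_of_dominated_loc_of_deriv_le (F := fun a w => f (a - w))
    (F' := fun a w => f' (a - w)) (bound := fun _ => A') univ_mem
    (.of_forall fun x => (by fun_prop)) ?_ ?_ (.of_forall fun w x _ => hA' _)
    (integrable_const _) (.of_forall fun w x _ => ?_)).2
  · exact (integrable_const A).mono' (by fun_prop) (.of_forall fun w => hA _)
  · exact (hf'.comp (measurable_const.sub measurable_id)).aestronglyMeasurable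
  · simpa using (h (x - w)).comp_sub_const x w

lemma integral_comp_sub_of_hasDerivAt {F F' : ℝ → ℝ} (h : ∀ y, HasDerivAt f (f' y) y)
    (hA : ∀ y, |f y| ≤ A) (hA' : ∀ y, |f' y| ≤ A') (hF : ∀ a, HasDerivAt F (F' a) a)
    (hint : ∀ a, ∫ w, f (a - w) ∂ρ = F a) (a : ℝ) : ∫ w, f' (a - w) ∂ρ = F' a :=
  ((funext hint : (fun a => ∫ w, f (a - w) ∂ρ) = F) ▸
    hasDerivAt_integral_comp_sub ρ h hA hA' a).unique (hF a)

end Smoothing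

/-- The normal distribution function with standard deviation `r`. -/
noncomputable def scaledCdf (r : ℝ) (y : ℝ) : ℝ := stdCdf (y / r)

/-- The first derivative of `scaledCdf r`. -/
noncomputable def scaledCdf₁ (r : ℝ) (y : ℝ) : ℝ := stdPdf (y / r) / r

/-- The second derivative of `scaledCdf r`. -/
noncomputable def scaledCdf₂ (r : ℝ) (y : ℝ) : ℝ := -(y / r) * stdPdf (y / r) / r ^ 2

/-- The third derivative of `scaledCdf r`. -/
noncomputable def scaledCdf₃ (r : ℝ) (y : ℝ) : ℝ := stdPdf₂ (y / r) / r ^ 3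

section ScaledCdf

lemma hasDerivAt_scaledCdf (r y : ℝ) : HasDerivAt (scaledCdf r) (scaledCdf₁ r y) y :=
  ((hasDerivAt_stdCdf (y / r)).comp y ((hasDerivAt_id y).div_const r)).congr_deriv
    (by simp [scaledCdf₁]; ring)

lemma abs_scaledCdf_le (r y : ℝ) : |scaledCdf r y| ≤ 1 := by
  rw [scaledCdf, abs_of_nonneg (stdCdf_nonneg _)]; exact stdCdf_le_one _

variable {r : ℝ} (hr : 0 < r)
include hr

lemma hasDerivAt_scaledCdf₁ (y : ℝ) : HasDerivAt (scaledCdf₁ r) (scaledCdf₂ r y) y := by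
  have := ((hasDerivAt_stdPdf (y / r)).comp y ((hasDerivAt_id y).div_const r)).div_const r
  exact this.congr_deriv (by simp only [scaledCdf₂]; field_simp)

lemma hasDerivAt_scaledCdf₂ (y : ℝ) : HasDerivAt (scaledCdf₂ r) (scaledCdf₃ r y) y := by
  have := ((hasDerivAt_neg_mul_stdPdf (y / r)).comp y
    ((hasDerivAt_id y).div_const r)).div_const (r ^ 2)
  exact this.congr_deriv (by simp only [scaledCdf₃]; field_simp)

lemma abs_scaledCdf₁_le (y : ℝ) : |scaledCdf₁ r y| ≤ 1 / r := by
  rw [scaledCdf₁, abs_div, abs_of_pos hr, abs_of_nonneg (stdPdf_nonneg _)]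
  gcongr; exact stdPdf_le_one _

lemma abs_scaledCdf₂_le (y : ℝ) : |scaledCdf₂ r y| ≤ 1 / r ^ 2 := by
  rw [scaledCdf₂, abs_div, abs_of_pos (a := r ^ 2) (by positivity), neg_mul, abs_neg]
  gcongr; exact abs_id_mul_stdPdf_le_one _

lemma abs_scaledCdf₃_le (y : ℝ) : |scaledCdf₃ r y| ≤ 1 / r ^ 3 := by
  rw [scaledCdf₃, abs_div, abs_of_pos (a := r ^ 3) (by positivity)]
  gcongr; exact abs_stdPdf₂_le_one _

lemma integral_scaledCdf₃_eq (ρ : Measure ℝ) [IsFiniteMeasure ρ] (a : ℝ) :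
    ∫ w, scaledCdf₃ r (a - w) ∂ρ = (∫ t, stdPdf₃ t * ρ.real (Iic (a - t * r))) / r ^ 3 := by
  set S : Set (ℝ × ℝ) := {p | p.2 ≤ (a - p.1) / r}
  have hS : MeasurableSet S := measurableSet_le (by fun_prop) (by fun_prop)
  have hfst : ∀ w, ∫ t, S.indicator (fun p => stdPdf₃ p.2) (w, t) = stdPdf₂ ((a - w) / r) :=
    fun w => by rw [stdPdf₂_eq_integral_Iic, ← integral_indicator measurableSet_Iic]; rfl
  have hsnd : ∀ t, ∫ w, S.indicator (fun p => stdPdf₃ p.2) (w, t) ∂ρ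
      = stdPdf₃ t * ρ.real (Iic (a - t * r)) := fun t => by
    have : (fun w => S.indicator (fun p => stdPdf₃ p.2) (w, t))
        = (Iic (a - t * r)).indicator fun _ => stdPdf₃ t := by
      ext w
      simp only [S, indicator, mem_ofPred_eq, mem_Iic, le_div_iff₀ hr, le_sub_comm]
    rw [this, integral_indicator_const _ measurableSet_Iic, smul_eq_mul, mul_comm]
  simp only [scaledCdf₃]
  rw [integral_div, ← integral_congr_ae (.of_forall hfst), ← integral_congr_ae (.of_forall hsnd)]
  exact congrArg (· / r ^ 3)
    (integral_integral_swap ((integrable_stdPdf₃.comp_snd ρ).indicator hS))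

lemma abs_integral_scaledCdf₃_sub_le (ρ ν : Measure ℝ) [IsProbabilityMeasure ρ]
    [IsProbabilityMeasure ν] (a : ℝ) :
    |∫ w, scaledCdf₃ r (a - w) ∂ρ - ∫ w, scaledCdf₃ r (a - w) ∂ν|
      ≤ kolmogorovDist ρ ν * stdPdf₂Var / r ^ 3 := by
  have hint : ∀ (ρ : Measure ℝ) [IsProbabilityMeasure ρ],
      Integrable fun t => stdPdf₃ t * ρ.real (Iic (a - t * r)) := fun ρ _ =>
    integrable_stdPdf₃.mul_bdd (c := 1)
      ((measurable_real_Iic ρ).comp (by fun_prop : Measurable fun t => a - t * r)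
        ).aestronglyMeasurable
      (.of_forall fun t => by rw [Real.norm_of_nonneg measureReal_nonneg]; exact measureReal_le_one)
  rw [integral_scaledCdf₃_eq hr, integral_scaledCdf₃_eq hr, ← sub_div, abs_div,
    abs_of_pos (a := r ^ 3) (by positivity), ← integral_sub (hint ρ) (hint ν)]
  gcongr
  rw [stdPdf₂Var, ← integral_const_mul]
  refine norm_integral_le_of_norm_le (G := ℝ) (integrable_stdPdf₃.abs.const_mul _)
    (.of_forall fun t => ?_)
  rw [← mul_sub, norm_mul, mul_comm, Real.norm_eq_abs, Real.norm_eq_abs]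
  gcongr
  exact abs_real_Iic_sub_le_kolmogorovDist _

lemma abs_integral_integral_scaledCdf_sub_le (μ ν ρ : Measure ℝ) [IsStdLaw μ] [IsStdLaw ν]
    [IsFiniteMeasure ρ] {B : ℝ} (hB : ∀ a, |∫ w, scaledCdf₃ r (a - w) ∂ρ| ≤ B) (z : ℝ) :
    |(∫ x, ∫ w, scaledCdf r (z - x - w) ∂ρ ∂μ) - ∫ x, ∫ w, scaledCdf r (z - x - w) ∂ρ ∂ν|
      ≤ B * (thirdMoment μ + thirdMoment ν) := by
  have h₁ := hasDerivAt_integral_comp_sub ρ (hasDerivAt_scaledCdf r) (abs_scaledCdf_le r)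
    (abs_scaledCdf₁_le hr)
  have h₂ := hasDerivAt_integral_comp_sub ρ (hasDerivAt_scaledCdf₁ hr) (abs_scaledCdf₁_le hr)
    (abs_scaledCdf₂_le hr)
  have h₃ := hasDerivAt_integral_comp_sub ρ (hasDerivAt_scaledCdf₂ hr) (abs_scaledCdf₂_le hr)
    (abs_scaledCdf₃_le hr)
  exact abs_integral_sub_integral_le_of_stdLaw μ ν
    (fun y => (h₁ (z - y)).comp_const_sub z y)
    (fun y => ((h₂ (z - y)).comp_const_sub z y).neg.congr_deriv (neg_neg _))
    (fun y => (h₃ (z - y)).comp_const_sub z y)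
    (fun y => by rw [abs_neg]; exact hB _)

end ScaledCdf

lemma conv_gaussianReal_real_Iic (ρ : Measure ℝ) [IsFiniteMeasure ρ] {v : NNReal} (hv : v ≠ 0)
    (z : ℝ) : (ρ ∗ gaussianReal 0 v).real (Iic z) = ∫ w, scaledCdf (√v) (z - w) ∂ρ := by
  simp only [conv_real_Iic, gaussianReal_real_Iic hv, scaledCdf]

lemma integral_scaledCdf_gaussianReal {v : NNReal} (hv : v ≠ 0) (w : NNReal) (a : ℝ) :
    ∫ y, scaledCdf (√v) (a - y) ∂gaussianReal 0 w = scaledCdf (√(v + w)) a := by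
  rw [← conv_gaussianReal_real_Iic _ hv, gaussianReal_conv_gaussianReal, add_zero,
    gaussianReal_real_Iic (by positivity), scaledCdf, add_comm w, NNReal.coe_add]

lemma integral_scaledCdf₃_gaussianReal {v : NNReal} (hv : v ≠ 0) (w : NNReal) (a : ℝ) :
    ∫ y, scaledCdf₃ (√v) (a - y) ∂gaussianReal 0 w = scaledCdf₃ (√(v + w)) a := by
  have hr : 0 < √(v : ℝ) := Real.sqrt_pos.2 (by positivity)
  have hq : 0 < √((v : ℝ) + w) := Real.sqrt_pos.2 (by positivity)
  have h₁ := integral_comp_sub_of_hasDerivAt _ (hasDerivAt_scaledCdf _) (abs_scaledCdf_le _)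
    (abs_scaledCdf₁_le hr) (hasDerivAt_scaledCdf _) (integral_scaledCdf_gaussianReal hv w)
  have h₂ := integral_comp_sub_of_hasDerivAt _ (hasDerivAt_scaledCdf₁ hr) (abs_scaledCdf₁_le hr)
    (abs_scaledCdf₂_le hr) (hasDerivAt_scaledCdf₁ hq) h₁
  exact integral_comp_sub_of_hasDerivAt _ (hasDerivAt_scaledCdf₂ hr) (abs_scaledCdf₂_le hr)
    (abs_scaledCdf₃_le hr) (hasDerivAt_scaledCdf₂ hq) h₂ a

section Unsmoothing

lemma le_integral_comp_sub_of_near {γ : Measure ℝ} [IsProbabilityMeasure γ] {g : ℝ → ℝ}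
    {A D h z : ℝ} (hg : Measurable g) (hD : ∀ t, |g t| ≤ D)
    (hA : ∀ y, |y| < h → A ≤ g (z - y)) :
    A - (A + D) * γ.real {y | h ≤ |y|} ≤ ∫ y, g (z - y) ∂γ := by
  have hS : MeasurableSet {y : ℝ | h ≤ |y|} := measurableSet_le (by fun_prop) (by fun_prop)
  have hind : Integrable ({y : ℝ | h ≤ |y|}.indicator fun _ => A + D) γ :=
    (integrable_const _).indicator hS
  have hgi : Integrable (fun y => g (z - y)) γ :=
    (integrable_const D).mono'
      (hg.comp (measurable_const.sub measurable_id)).aestronglyMeasurable (.of_forall fun y => hD _)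
  calc A - (A + D) * γ.real {y | h ≤ |y|}
      = ∫ y, (A - {y : ℝ | h ≤ |y|}.indicator (fun _ => A + D) y) ∂γ := by
        rw [integral_sub (integrable_const _) hind, integral_indicator_const _ hS]
        simp [mul_comm]
    _ ≤ ∫ y, g (z - y) ∂γ := by
        refine integral_mono ((integrable_const _).sub hind) hgi fun y => ?_
        by_cases hy : y ∈ {y : ℝ | h ≤ |y|}
        · simp only [indicator_of_mem hy]
          linarith [neg_le_of_abs_le (hD (z - y))]
        · simp only [indicator_of_notMem hy, sub_zero]
          exact hA y (not_le.1 hy)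

lemma gaussianReal_real_two_sqrt_le_abs_le {v : NNReal} (hv : v ≠ 0) :
    (gaussianReal 0 v).real {y | 2 * √v ≤ |y|} ≤ 1 / 4 := by
  have hv' : 0 < (v : ℝ) := by positivity
  have h := meas_ge_le_variance_div_sq (μ := gaussianReal 0 v) (X := id) (c := 2 * √v)
    (memLp_id_gaussianReal 2) (by positivity)
  simp only [id_eq, integral_id_gaussianReal, variance_id_gaussianReal, sub_zero] at h
  refine (ENNReal.toReal_mono ENNReal.ofReal_ne_top h).trans_eq ?_
  rw [ENNReal.toReal_ofReal (by positivity), mul_pow, Real.sq_sqrt hv'.le]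
  field_simp; norm_num

lemma le_of_integral_comp_sub_gaussianReal_le {g : ℝ → ℝ} {v : NNReal} {D δ η : ℝ} (hv : v ≠ 0)
    (hg : Measurable g) (hD : ∀ t, |g t| ≤ D) (hδ : 0 ≤ δ)
    (hint : ∀ z, ∫ y, g (z - y) ∂gaussianReal 0 v ≤ δ)
    (hη : ∀ s t, s ≤ t → t ≤ s + 4 * √v → g s ≤ g t + η) (x : ℝ) :
    g x ≤ 4 / 3 * δ + D / 3 + η := by
  by_contra! hcon
  have hD0 : 0 ≤ D := (abs_nonneg _).trans (hD 0)
  have hnear : ∀ y, |y| < 2 * √v → g x - η ≤ g (x + 2 * √v - y) := fun y hy => by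
    obtain ⟨hy₁, hy₂⟩ := abs_lt.1 hy
    linarith [hη x (x + 2 * √v - y) (by linarith) (by linarith)]
  have hlow := (le_integral_comp_sub_of_near hg hD hnear).trans (hint _)
  have htail : (g x - η + D) * (gaussianReal 0 v).real {y | 2 * √v ≤ |y|}
      ≤ (g x - η + D) * (1 / 4) :=
    mul_le_mul_of_nonneg_left (gaussianReal_real_two_sqrt_le_abs_le hv) (by linarith)
  linarith

lemma gaussianReal_real_Iic_le_add {w : NNReal} (hw : w ≠ 0) {s t : ℝ} (hst : s ≤ t) :
    (gaussianReal 0 w).real (Iic t) ≤ (gaussianReal 0 w).real (Iic s) + (t - s) / √w := by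
  have hw' : 0 < √(w : ℝ) := Real.sqrt_pos.2 (by positivity)
  rw [gaussianReal_real_Iic hw, gaussianReal_real_Iic hw]
  have h := le_of_abs_le (abs_stdCdf_sub_le (t / √w) (s / √w))
  rw [← sub_div, abs_of_nonneg (div_nonneg (sub_nonneg.2 hst) hw'.le)] at h
  linarith

lemma abs_integral_real_Iic_sub_le_kolmogorovDist_conv (ρ ν γ : Measure ℝ)
    [IsProbabilityMeasure ρ] [IsProbabilityMeasure ν] [IsProbabilityMeasure γ] (z : ℝ) :
    |∫ y, (ρ.real (Iic (z - y)) - ν.real (Iic (z - y))) ∂γ|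
      ≤ kolmogorovDist (ρ ∗ γ) (ν ∗ γ) := by
  rw [integral_sub (integrable_real_Iic_const_sub _ _ _) (integrable_real_Iic_const_sub _ _ _),
    ← conv_real_Iic, ← conv_real_Iic, Measure.conv_comm γ, Measure.conv_comm γ]
  exact abs_real_Iic_sub_le_kolmogorovDist z

lemma kolmogorovDist_le_of_conv_gaussianReal (ρ : Measure ℝ) [IsProbabilityMeasure ρ]
    {v w : NNReal} (hv : v ≠ 0) (hw : w ≠ 0) :
    kolmogorovDist ρ (gaussianReal 0 w)
      ≤ 2 * kolmogorovDist (ρ ∗ gaussianReal 0 v) (gaussianReal 0 w ∗ gaussianReal 0 v)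
        + 6 * √v / √w := by
  set δ := kolmogorovDist (ρ ∗ gaussianReal 0 v) (gaussianReal 0 w ∗ gaussianReal 0 v)
  set D := kolmogorovDist ρ (gaussianReal 0 w)
  set Δ : ℝ → ℝ := fun x => ρ.real (Iic x) - (gaussianReal 0 w).real (Iic x) with hΔ
  have hmeas : Measurable Δ := (measurable_real_Iic ρ).sub (measurable_real_Iic _)
  have hD : ∀ x, |Δ x| ≤ D := abs_real_Iic_sub_le_kolmogorovDist
  have hδ : ∀ z, |∫ y, Δ (z - y) ∂gaussianReal 0 v| ≤ δ :=
    abs_integral_real_Iic_sub_le_kolmogorovDist_conv ρ _ _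
  have hdrop : ∀ s t, s ≤ t → t ≤ s + 4 * √v → Δ s ≤ Δ t + 4 * √v / √w := fun s t hst hts => by
    have hmono := measureReal_mono (μ := ρ) (Iic_subset_Iic.2 hst)
    have hlip := gaussianReal_real_Iic_le_add hw hst
    have hgap : (t - s) / √w ≤ 4 * √v / √w := by gcongr; linarith
    simp only [hΔ]; linarith
  have hupper : ∀ x, Δ x ≤ 4 / 3 * δ + D / 3 + 4 * √v / √w :=
    le_of_integral_comp_sub_gaussianReal_le hv hmeas hD kolmogorovDist_nonneg
      (fun z => le_of_abs_le (hδ z)) hdrop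
  have hlower : ∀ x, -Δ (-x) ≤ 4 / 3 * δ + D / 3 + 4 * √v / √w := by
    refine le_of_integral_comp_sub_gaussianReal_le (g := fun t => -Δ (-t)) hv
      (hmeas.comp measurable_neg).neg (fun t => by rw [abs_neg]; exact hD _) kolmogorovDist_nonneg
      (fun z => ?_) fun s t hst hts => by linarith [hdrop (-t) (-s) (by linarith) (by linarith)]
    rw [← integral_comp_neg_gaussianReal, integral_neg]
    refine (neg_le_of_neg_le (neg_le_of_abs_le (hδ (-z)))).trans' (le_of_eq ?_)
    congr 2 with y; ring_nf
  have hself : D ≤ 4 / 3 * δ + D / 3 + 4 * √v / √w := kolmogorovDist_le fun x =>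
    abs_le.2 ⟨by linarith [neg_neg x ▸ hlower (-x)], hupper x⟩
  linarith [show 6 * √v / √w = 3 / 2 * (4 * √(v : ℝ) / √w) by ring]

end Unsmoothing

/-! ### The Berry–Esseen inequality -/

lemma inv_sqrt_cube_le_sub {a : ℝ} (ha : 1 ≤ a) : 1 / √a ^ 3 ≤ 6 / √a - 6 / √(a + 1) := by
  set x := √a
  set y := √(a + 1)
  have : 1 ≤ x := Real.one_le_sqrt.2 ha
  have hxy : x ≤ y := Real.sqrt_le_sqrt (by linarith)
  have hxsq : x ^ 2 = a := Real.sq_sqrt (by linarith)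
  have hysq : y ^ 2 = a + 1 := Real.sq_sqrt (by linarith)
  have hconj : (y - x) * (x + y) = 1 := by linear_combination hysq - hxsq
  have hbound : y * (x + y) ≤ 6 * x ^ 2 := by nlinarith
  have hgap : y ≤ 6 * x ^ 2 * (y - x) := by
    calc y = y * (x + y) * (y - x) := by linear_combination (-y) * hconj
      _ ≤ _ := by gcongr
  rw [div_sub_div _ _ (by positivity) (by positivity), div_le_div_iff₀ (by positivity)
    (by positivity)]
  calc 1 * (x * y) = x * y := by ring
    _ ≤ x * (6 * x ^ 2 * (y - x)) := by gcongr
    _ = _ := by ring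

lemma sum_inv_sqrt_cube_le {e : ℝ} (he : 1 ≤ e) (n : ℕ) :
    ∑ j ∈ Finset.range n, 1 / √(j + e) ^ 3 ≤ 6 / √e := by
  have htelescope : ∑ j ∈ Finset.range n, 1 / √(j + e) ^ 3 ≤ 6 / √e - 6 / √(n + e) := by
    induction n with
    | zero => simp
    | succ n ih =>
      have hn : (1 : ℝ) ≤ n + e := by linarith [n.cast_nonneg (α := ℝ)]
      rw [Finset.sum_range_succ, Nat.cast_succ, add_right_comm]
      linarith [inv_sqrt_cube_le_sub hn]
  exact htelescope.trans (sub_le_self _ (by positivity))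

lemma conv_conv_gaussianReal_real_Iic (ρ ν : Measure ℝ) [IsFiniteMeasure ρ] [IsFiniteMeasure ν]
    {v : NNReal} (hv : v ≠ 0) (z : ℝ) :
    ((ρ ∗ ν) ∗ gaussianReal 0 v).real (Iic z) = ∫ x, ∫ w, scaledCdf (√v) (z - x - w) ∂ρ ∂ν := by
  rw [Measure.conv_comm ρ, Measure.conv_assoc, conv_real_Iic]
  simp only [conv_gaussianReal_real_Iic _ hv]

lemma abs_integral_scaledCdf₃_le (ρ : Measure ℝ) [IsProbabilityMeasure ρ] {v : NNReal}
    (hv : v ≠ 0) (w : NNReal) (a : ℝ) :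
    |∫ y, scaledCdf₃ (√v) (a - y) ∂ρ|
      ≤ kolmogorovDist ρ (gaussianReal 0 w) * stdPdf₂Var / √v ^ 3 + 1 / √(v + w) ^ 3 := by
  have hr : 0 < √(v : ℝ) := Real.sqrt_pos.2 (by positivity)
  have hq : 0 < √((v : ℝ) + w) := Real.sqrt_pos.2 (by positivity)
  have hdiff := abs_integral_scaledCdf₃_sub_le hr ρ (gaussianReal 0 w) a
  rw [integral_scaledCdf₃_gaussianReal hv] at hdiff
  linarith [abs_scaledCdf₃_le hq a, abs_sub_abs_le_abs_sub (∫ y, scaledCdf₃ (√v) (a - y) ∂ρ)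
    (scaledCdf₃ (√(v + w)) a)]

section BerryEsseen

variable (μ : Measure ℝ) [IsStdLaw μ]

lemma abs_convPow_succ_conv_gaussianReal_sub_le (k : ℕ) {v : NNReal} (hv : v ≠ 0) (z : ℝ) :
    |(convPow μ (k + 1) ∗ gaussianReal 0 v).real (Iic z)
      - (convPow μ k ∗ gaussianReal 0 (v + 1)).real (Iic z)|
      ≤ (kolmogorovDist (convPow μ k) (gaussianReal 0 k) * stdPdf₂Var / √v ^ 3
          + 1 / √(v + k) ^ 3) * (thirdMoment μ + thirdMoment (gaussianReal 0 1)) := by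
  have hsplit : gaussianReal 0 (v + 1) = gaussianReal 0 1 ∗ gaussianReal 0 v := by
    rw [gaussianReal_conv_gaussianReal, add_comm v, add_zero]
  rw [hsplit, ← Measure.conv_assoc, convPow, conv_conv_gaussianReal_real_Iic _ _ hv,
    conv_conv_gaussianReal_real_Iic _ _ hv]
  exact abs_integral_integral_scaledCdf_sub_le (Real.sqrt_pos.2 (by positivity)) _ _ _
    (abs_integral_scaledCdf₃_le _ hv k) z

-- The summands are exchanged one at a time, in the presence of a Gaussian of variance `e`.
lemma kolmogorovDist_convPow_conv_gaussianReal_le (n : ℕ) {e : NNReal} (he : 1 ≤ e) :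
    kolmogorovDist (convPow μ n ∗ gaussianReal 0 e) (gaussianReal 0 n ∗ gaussianReal 0 e)
      ≤ (thirdMoment μ + thirdMoment (gaussianReal 0 1)) * ∑ k ∈ Finset.range n,
        (stdPdf₂Var * (kolmogorovDist (convPow μ k) (gaussianReal 0 k)
          / √((n - (k + 1) : ℕ) + e) ^ 3) + 1 / √n ^ 3) := by
  have hLG : 0 ≤ thirdMoment μ + thirdMoment (gaussianReal 0 1) := by
    linarith [IsStdLaw.one_le_thirdMoment μ, IsStdLaw.one_le_thirdMoment (gaussianReal 0 1)]
  refine kolmogorovDist_le fun z => ?_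
  set E : ℕ → ℝ := fun k =>
    (convPow μ k ∗ gaussianReal 0 (((n - k : ℕ) : NNReal) + e)).real (Iic z)
  have hEn : E n = (convPow μ n ∗ gaussianReal 0 e).real (Iic z) := by simp [E]
  have hE0 : E 0 = (gaussianReal 0 n ∗ gaussianReal 0 e).real (Iic z) := by
    simp only [E, convPow, Measure.dirac_zero_conv, Nat.sub_zero, gaussianReal_conv_gaussianReal,
      add_zero]
  rw [← hEn, ← hE0, ← Finset.sum_range_sub, Finset.mul_sum]
  refine (Finset.abs_sum_le_sum_abs _ _).trans (Finset.sum_le_sum fun k hk => ?_)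
  have hkn : k + 1 ≤ n := Finset.mem_range.1 hk
  set v : NNReal := ((n - (k + 1) : ℕ) : NNReal) + e with hv
  have hnext : ((n - k : ℕ) : NNReal) + e = v + 1 := by
    rw [show n - k = n - (k + 1) + 1 by omega, Nat.cast_succ, add_right_comm]
  have hv0 : v ≠ 0 := (zero_lt_one.trans_le (he.trans le_add_self)).ne'
  have hvk : (n : ℝ) ≤ ((n - (k + 1) : ℕ) : ℝ) + e + k := by
    have : (1 : ℝ) ≤ e := he
    rw [Nat.cast_sub hkn]; push_cast; linarith
  have hn : 0 < √(n : ℝ) := Real.sqrt_pos.2 (by exact_mod_cast k.succ_pos.trans_le hkn)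
  simp only [E, hnext, mul_comm (thirdMoment μ + _)]
  refine (abs_convPow_succ_conv_gaussianReal_sub_le μ k hv0 z).trans ?_
  rw [mul_comm _ stdPdf₂Var, mul_div_assoc, hv, NNReal.coe_add, NNReal.coe_natCast]
  gcongr

end BerryEsseen

lemma div_sqrt_cube_le {n k : ℕ} (hk : k < n) {D C e : ℝ} (hD : D ≤ 1) (hC : 0 ≤ C)
    (hDC : D * √k ≤ C) (he : 1 ≤ e) :
    D / √((n - (k + 1) : ℕ) + e) ^ 3
      ≤ 3 / √n ^ 3 + 2 * C / √n * (1 / √((n - (k + 1) : ℕ) + e) ^ 3) := by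
  have hv : ((n - (k + 1) : ℕ) : ℝ) + e = n - k - 1 + e := by
    rw [Nat.cast_sub hk]; push_cast; ring
  have hkn : (k : ℝ) + 1 ≤ n := by exact_mod_cast hk
  have hn : 0 < (n : ℝ) := by linarith [k.cast_nonneg (α := ℝ)]
  rw [hv]
  set v : ℝ := n - k - 1 + e
  have hv0 : 0 < √v := Real.sqrt_pos.2 (by linarith)
  have hq : 0 < √(n : ℝ) := Real.sqrt_pos.2 hn
  have hqsq : √(n : ℝ) ^ 2 = n := Real.sq_sqrt hn.le
  rcases le_or_gt (2 * k : ℝ) n with h | h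
  · have hroot : √(n : ℝ) * 0.7 ≤ √v := Real.le_sqrt_of_sq_le (by nlinarith)
    have hcube : (√(n : ℝ) * 0.7) ^ 3 ≤ √v ^ 3 := by gcongr
    calc D / √v ^ 3 ≤ 1 / √v ^ 3 := by gcongr
      _ ≤ 3 / √n ^ 3 := by
          rw [div_le_div_iff₀ (by positivity) (by positivity)]
          nlinarith [pow_pos hq 3]
      _ ≤ _ := le_add_of_nonneg_right (by positivity)
  · have hroot : √(n : ℝ) / 2 ≤ √(k : ℝ) := Real.le_sqrt_of_sq_le (by nlinarith)
    have hDn : D ≤ 2 * C / √n := by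
      rw [le_div_iff₀ hq]
      rcases le_total D 0 with hD0 | hD0
      · nlinarith
      · nlinarith [mul_le_mul_of_nonneg_left hroot hD0]
    calc D / √v ^ 3 ≤ 2 * C / √n / √v ^ 3 := by gcongr
      _ = 2 * C / √n * (1 / √v ^ 3) := (mul_one_div _ _).symm
      _ ≤ _ := le_add_of_nonneg_left (by positivity)

lemma natCast_mul_div_sqrt_cube (n : ℕ) (c : ℝ) : n * (c / √n ^ 3) = c / √n := by
  nth_rw 1 [← Real.sq_sqrt n.cast_nonneg]
  field_simp

lemma sum_div_sqrt_cube_le {n : ℕ} {D : ℕ → ℝ} {C ε : ℝ} (hC : 0 ≤ C)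
    (hD : ∀ k < n, D k ≤ 1) (hDC : ∀ k < n, D k * √k ≤ C) (hε : 1 ≤ ε) :
    ∑ k ∈ Finset.range n, D k / √((n - (k + 1) : ℕ) + ε ^ 2) ^ 3 ≤ (3 + 12 * C / ε) / √n := by
  have hsum : ∑ k ∈ Finset.range n, 1 / √((n - (k + 1) : ℕ) + ε ^ 2) ^ 3 ≤ 6 / ε := by
    have h := sum_inv_sqrt_cube_le (one_le_pow₀ hε : 1 ≤ ε ^ 2) n
    rw [← Finset.sum_range_reflect, Real.sqrt_sq (by linarith)] at h
    refine h.trans' (le_of_eq (Finset.sum_congr rfl fun k _ => ?_))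
    rw [show n - 1 - k = n - (k + 1) by omega]
  calc ∑ k ∈ Finset.range n, D k / √((n - (k + 1) : ℕ) + ε ^ 2) ^ 3
      ≤ ∑ k ∈ Finset.range n,
          (3 / √n ^ 3 + 2 * C / √n * (1 / √((n - (k + 1) : ℕ) + ε ^ 2) ^ 3)) :=
        Finset.sum_le_sum fun k hk => have hk := Finset.mem_range.1 hk
          div_sqrt_cube_le hk (hD k hk) hC (hDC k hk) (one_le_pow₀ hε)
    _ = n * (3 / √n ^ 3)
          + 2 * C / √n * ∑ k ∈ Finset.range n, 1 / √((n - (k + 1) : ℕ) + ε ^ 2) ^ 3 := by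
        rw [Finset.sum_add_distrib, ← Finset.mul_sum, Finset.sum_const, Finset.card_range,
          nsmul_eq_mul]
    _ ≤ n * (3 / √n ^ 3) + 2 * C / √n * (6 / ε) := by gcongr
    _ = (3 + 12 * C / ε) / √n := by
        rw [natCast_mul_div_sqrt_cube]; ring

/-- The constant obtained in the Berry–Esseen inequality; it makes the induction in
`kolmogorovDist_convPow_mul_sqrt_le` close. -/
noncomputable def beConst : ℝ :=
  (1 + thirdMoment (gaussianReal 0 1)) * (580 + 588 * stdPdf₂Var)

lemma one_le_beConst : 1 ≤ beConst := by
  have hG := IsStdLaw.one_le_thirdMoment (gaussianReal 0 1)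
  have hV := stdPdf₂Var_nonneg
  unfold beConst
  nlinarith

section BerryEsseen

variable (μ : Measure ℝ) [IsStdLaw μ]

lemma kolmogorovDist_convPow_mul_sqrt_le_of_forall_lt {n : ℕ} (hn : 1 ≤ n) {C ε : ℝ} (hC : 0 ≤ C)
    (hε : 1 ≤ ε) (ih : ∀ k < n, kolmogorovDist (convPow μ k) (gaussianReal 0 k) * √k ≤ C) :
    kolmogorovDist (convPow μ n) (gaussianReal 0 n) * √n
      ≤ 2 * ((thirdMoment μ + thirdMoment (gaussianReal 0 1))
          * (stdPdf₂Var * (3 + 12 * C / ε) + 1)) + 6 * ε := by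
  set LG := thirdMoment μ + thirdMoment (gaussianReal 0 1)
  have hLG : 0 ≤ LG :=
    add_nonneg (integral_nonneg fun _ => by positivity) (integral_nonneg fun _ => by positivity)
  have hV := stdPdf₂Var_nonneg
  have hq : 0 < √(n : ℝ) := by positivity
  set e : NNReal := ⟨ε ^ 2, sq_nonneg _⟩
  have he : 1 ≤ e := NNReal.coe_le_coe.1 (one_le_pow₀ hε)
  have hsqrt : √(e : ℝ) = ε := Real.sqrt_sq (by linarith)
  have hsmoothed : kolmogorovDist (convPow μ n ∗ gaussianReal 0 e)
      (gaussianReal 0 n ∗ gaussianReal 0 e)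
        ≤ LG * (stdPdf₂Var * ((3 + 12 * C / ε) / √n) + 1 / √n) := by
    refine (kolmogorovDist_convPow_conv_gaussianReal_le μ n he).trans ?_
    rw [Finset.sum_add_distrib, ← Finset.mul_sum, Finset.sum_const, Finset.card_range,
      nsmul_eq_mul, natCast_mul_div_sqrt_cube]
    gcongr
    exact sum_div_sqrt_cube_le hC (fun k _ => kolmogorovDist_le_one) ih hε
  have hunsmooth := kolmogorovDist_le_of_conv_gaussianReal (convPow μ n) (v := e) (w := n)
    (zero_lt_one.trans_le he).ne' (by positivity)
  rw [hsqrt, NNReal.coe_natCast] at hunsmooth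
  rw [← le_div_iff₀ hq]
  calc kolmogorovDist (convPow μ n) (gaussianReal 0 n) ≤ _ := hunsmooth
    _ ≤ 2 * (LG * (stdPdf₂Var * ((3 + 12 * C / ε) / √n) + 1 / √n)) + 6 * ε / √n := by gcongr
    _ = _ := by ring

lemma kolmogorovDist_convPow_mul_sqrt_le (n : ℕ) :
    kolmogorovDist (convPow μ n) (gaussianReal 0 n) * √n ≤ beConst * thirdMoment μ := by
  set V := stdPdf₂Var
  have hV : 0 ≤ V := stdPdf₂Var_nonneg
  set G := thirdMoment (gaussianReal 0 1)
  have hG : 1 ≤ G := IsStdLaw.one_le_thirdMoment _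
  set L := thirdMoment μ
  have hL : 1 ≤ L := IsStdLaw.one_le_thirdMoment μ
  have hK : 0 ≤ beConst * L := mul_nonneg (zero_le_one.trans one_le_beConst) (by linarith)
  induction n using Nat.strong_induction_on with
  | _ n ih =>
  rcases n.eq_zero_or_pos with rfl | hn
  · rwa [Nat.cast_zero (R := ℝ), Real.sqrt_zero, mul_zero]
  -- With this smoothing scale the induction hypothesis contributes only half of the new bound.
  set ε := 48 * (1 + G) * (V + 1) * L with hε
  have hε1 : 1 ≤ ε := by
    rw [hε]
    exact one_le_mul_of_one_le_of_one_le (one_le_mul_of_one_le_of_one_le (by linarith)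
      (by linarith)) hL
  have hsmall : 12 * (1 + G) * L * V / ε ≤ 1 / 4 := by
    rw [hε, div_le_iff₀ (by positivity)]
    nlinarith [mul_pos (by positivity : 0 < 1 + G) (by positivity : 0 < L)]
  calc kolmogorovDist (convPow μ n) (gaussianReal 0 n) * √n
      ≤ 2 * ((L + G) * (V * (3 + 12 * (beConst * L) / ε) + 1)) + 6 * ε :=
        kolmogorovDist_convPow_mul_sqrt_le_of_forall_lt μ hn hK hε1 ih
    _ ≤ 2 * ((1 + G) * L * (V * (3 + 12 * (beConst * L) / ε) + 1)) + 6 * ε := by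
        gcongr; nlinarith
    _ = 2 * ((1 + G) * L * (1 + 3 * V)) + 2 * (beConst * L * (12 * (1 + G) * L * V / ε))
          + 6 * ε := by ring
    _ ≤ 2 * ((1 + G) * L * (1 + 3 * V)) + 2 * (beConst * L * (1 / 4)) + 6 * ε := by gcongr
    _ = beConst * L := by rw [hε, beConst]; ring

lemma berryEsseen_Iic {n : ℕ} (hn : 1 ≤ n) (x : ℝ) :
    |(convPow μ n).real (Iic x) - stdCdf (x / √n)| ≤ beConst * thirdMoment μ / √n := by
  have hq : 0 < √(n : ℝ) := by positivity
  have hcdf := gaussianReal_real_Iic (v := (n : NNReal)) (by positivity) x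
  rw [NNReal.coe_natCast] at hcdf
  rw [← hcdf, le_div_iff₀ hq]
  refine le_trans ?_ (kolmogorovDist_convPow_mul_sqrt_le μ n)
  gcongr
  exact abs_real_Iic_sub_le_kolmogorovDist x

lemma berryEsseen_Ici {n : ℕ} (hn : 1 ≤ n) (x : ℝ) :
    |(convPow μ n).real (Ici x) - stdCdf (-x / √n)| ≤ beConst * thirdMoment μ / √n := by
  rw [convPow_real_Ici, ← thirdMoment_neg]
  exact berryEsseen_Iic μ.neg hn (-x)

lemma convPow_real_Ioc_le {n : ℕ} (hn : 1 ≤ n) {a b : ℝ} (hab : a ≤ b) :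
    (convPow μ n).real (Ioc a b) ≤ (b - a + 2 * beConst * thirdMoment μ) / √n := by
  have hq : 0 < √(n : ℝ) := by positivity
  have hIoc : (convPow μ n).real (Ioc a b)
      = (convPow μ n).real (Iic b) - (convPow μ n).real (Iic a) := by
    rw [← Iic_sdiff_Iic, measureReal_sdiff (Iic_subset_Iic.2 hab) measurableSet_Iic]
  have hlip := le_of_abs_le (abs_stdCdf_sub_le (b / √n) (a / √n))
  rw [← sub_div, abs_div, abs_of_pos hq, abs_of_nonneg (sub_nonneg.2 hab)] at hlip
  rw [hIoc, add_div]
  linarith [le_of_abs_le (berryEsseen_Iic μ hn b), neg_le_of_abs_le (berryEsseen_Iic μ hn a),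
    show 2 * beConst * thirdMoment μ / √(n : ℝ) = 2 * (beConst * thirdMoment μ / √n) by ring]

end BerryEsseen

/-! ### The walk killed on leaving the positive half-line -/

/-- One step of the walk with increment law `μ`, killed when it becomes non-positive. -/
noncomputable def killedStep (μ ν : Measure ℝ) : Measure ℝ := (ν ∗ μ).restrict (Ioi 0)

/-- The sub-probability law at time `n`, with initial law `ν`, of the walk killed when it becomes
non-positive; the initial position itself is not killed. -/
noncomputable def aliveLaw (μ ν : Measure ℝ) (n : ℕ) : Measure ℝ := (killedStep μ)^[n] ν

/-- The law of the exit position on the event that the exit happens at time `k + 1`. -/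
noncomputable def exitLaw (μ ν : Measure ℝ) (k : ℕ) : Measure ℝ :=
  (aliveLaw μ ν k ∗ μ).restrict (Iic 0)

lemma aliveLaw_zero (μ ν : Measure ℝ) : aliveLaw μ ν 0 = ν := rfl

lemma aliveLaw_succ (μ ν : Measure ℝ) (n : ℕ) :
    aliveLaw μ ν (n + 1) = (aliveLaw μ ν n ∗ μ).restrict (Ioi 0) :=
  Function.iterate_succ_apply' _ _ _

lemma aliveLaw_add (μ ν : Measure ℝ) (m n : ℕ) :
    aliveLaw μ ν (m + n) = aliveLaw μ (aliveLaw μ ν m) n := by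
  rw [aliveLaw, add_comm, Function.iterate_add_apply]; rfl

lemma exitLaw_add (μ ν : Measure ℝ) (m n : ℕ) :
    exitLaw μ ν (m + n) = exitLaw μ (aliveLaw μ ν m) n := by
  rw [exitLaw, aliveLaw_add, exitLaw]

instance (μ ν : Measure ℝ) [IsFiniteMeasure μ] [IsFiniteMeasure ν] (n : ℕ) :
    IsFiniteMeasure (aliveLaw μ ν n) := by
  induction n with
  | zero => rw [aliveLaw_zero]; infer_instance
  | succ n ih => rw [aliveLaw_succ]; infer_instance

instance (μ ν : Measure ℝ) [IsFiniteMeasure μ] [IsFiniteMeasure ν] (n : ℕ) :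
    IsFiniteMeasure (exitLaw μ ν n) := by
  unfold exitLaw; infer_instance

lemma aliveLaw_succ_add_exitLaw (μ ν : Measure ℝ) (n : ℕ) :
    aliveLaw μ ν (n + 1) + exitLaw μ ν n = aliveLaw μ ν n ∗ μ := by
  rw [aliveLaw_succ, exitLaw, ← compl_Ioi,
    Measure.restrict_add_restrict_compl measurableSet_Ioi]

lemma aliveLaw_succ_Iic (μ ν : Measure ℝ) (n : ℕ) : aliveLaw μ ν (n + 1) (Iic 0) = 0 := by
  rw [aliveLaw_succ, Measure.restrict_apply measurableSet_Iic, Iic_inter_Ioi, Ioc_self,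
    measure_empty]

lemma aliveLaw_Iio (μ : Measure ℝ) {ν : Measure ℝ} (hν : ν (Iio 0) = 0) (n : ℕ) :
    aliveLaw μ ν n (Iio 0) = 0 := by
  cases n with
  | zero => exact hν
  | succ n => exact measure_mono_null Iio_subset_Iic_self (aliveLaw_succ_Iic μ ν n)

lemma ae_aliveLaw_nonneg (μ : Measure ℝ) {ν : Measure ℝ} (hν : ν (Iio 0) = 0) (n : ℕ) :
    ∀ᵐ w ∂aliveLaw μ ν n, 0 ≤ w := by
  rw [ae_iff]; simpa only [not_le, ← Iio_def] using aliveLaw_Iio μ hν n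

lemma ae_exitLaw_nonpos (μ ν : Measure ℝ) (n : ℕ) : ∀ᵐ w ∂exitLaw μ ν n, w ≤ 0 :=
  ae_restrict_mem measurableSet_Iic

lemma conv_real_univ (μ ν : Measure ℝ) [IsProbabilityMeasure μ] :
    (ν ∗ μ).real univ = ν.real univ := by
  rw [Measure.conv, map_measureReal_apply (by fun_prop) .univ, preimage_univ,
    ← univ_prod_univ, Measure.real, Measure.prod_prod, measure_univ (μ := μ), mul_one]
  rfl

lemma sum_measure_conv {ι : Type*} (s : Finset ι) (ν : ι → Measure ℝ) (μ : Measure ℝ)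
    [∀ i, IsFiniteMeasure (ν i)] [SFinite μ] :
    (∑ i ∈ s, ν i) ∗ μ = ∑ i ∈ s, ν i ∗ μ := by
  classical
  induction s using Finset.induction_on with
  | empty => simp
  | insert i s hi ih => rw [Finset.sum_insert hi, Finset.sum_insert hi, ← ih, Measure.add_conv]

section ExitDecomposition

variable (μ ν : Measure ℝ) [IsProbabilityMeasure μ] [IsFiniteMeasure ν]

lemma aliveLaw_real_univ_succ_add (n : ℕ) :
    (aliveLaw μ ν (n + 1)).real univ + (exitLaw μ ν n).real univ
      = (aliveLaw μ ν n).real univ := by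
  rw [← measureReal_add_apply, aliveLaw_succ_add_exitLaw, conv_real_univ]

lemma aliveLaw_real_univ_antitone : Antitone fun n => (aliveLaw μ ν n).real univ :=
  antitone_nat_of_succ_le fun n => by
    rw [← aliveLaw_real_univ_succ_add μ ν n]
    exact le_add_of_nonneg_right measureReal_nonneg

lemma aliveLaw_real_univ_le (n : ℕ) : (aliveLaw μ ν n).real univ ≤ ν.real univ :=
  aliveLaw_real_univ_antitone μ ν (Nat.zero_le n)

lemma aliveLaw_real_univ_add_sum (n : ℕ) :
    (aliveLaw μ ν n).real univ + ∑ k ∈ Finset.range n, (exitLaw μ ν k).real univ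
      = ν.real univ := by
  induction n with
  | zero => simp [aliveLaw_zero]
  | succ n ih =>
    rw [Finset.sum_range_succ, ← ih, ← aliveLaw_real_univ_succ_add μ ν n]; ring

lemma sum_exitLaw_real_univ_le (n : ℕ) :
    ∑ k ∈ Finset.range n, (exitLaw μ ν k).real univ ≤ ν.real univ :=
  (le_add_of_nonneg_left measureReal_nonneg).trans_eq (aliveLaw_real_univ_add_sum μ ν n)

lemma aliveLaw_add_sum_exitLaw_conv (n : ℕ) :
    aliveLaw μ ν n + ∑ k ∈ Finset.range n, exitLaw μ ν k ∗ convPow μ (n - 1 - k)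
      = ν ∗ convPow μ n := by
  induction n with
  | zero => simp [aliveLaw_zero, convPow, Measure.conv_dirac_zero]
  | succ n ih =>
    have hstep : (∑ k ∈ Finset.range n, exitLaw μ ν k ∗ convPow μ (n - 1 - k)) ∗ μ
        = ∑ k ∈ Finset.range n, exitLaw μ ν k ∗ convPow μ (n - k) := by
      rw [sum_measure_conv]
      refine Finset.sum_congr rfl fun k hk => ?_
      rw [Finset.mem_range] at hk
      rw [show n - k = (n - 1 - k) + 1 by omega, convPow, Measure.conv_assoc]
    rw [convPow, ← Measure.conv_assoc, ← ih, Measure.add_conv, hstep,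
      ← aliveLaw_succ_add_exitLaw, Finset.sum_range_succ]
    simp only [Nat.add_sub_cancel, Nat.sub_self, convPow, Measure.conv_dirac_zero]
    abel

lemma aliveLaw_real_add_sum (n : ℕ) (B : Set ℝ) :
    (aliveLaw μ ν n).real B
        + ∑ k ∈ Finset.range n, (exitLaw μ ν k ∗ convPow μ (n - 1 - k)).real B
      = (ν ∗ convPow μ n).real B := by
  have hsum : (∑ k ∈ Finset.range n, exitLaw μ ν k ∗ convPow μ (n - 1 - k)).real B
      = ∑ k ∈ Finset.range n, (exitLaw μ ν k ∗ convPow μ (n - 1 - k)).real B := by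
    rw [Measure.real, Measure.finsetSum_apply, ENNReal.toReal_sum fun _ _ => measure_ne_top _ _]
    rfl
  have : IsFiniteMeasure (∑ k ∈ Finset.range n, exitLaw μ ν k ∗ convPow μ (n - 1 - k)) := by
    infer_instance
  rw [← aliveLaw_add_sum_exitLaw_conv μ ν n, measureReal_add_apply, hsum]

end ExitDecomposition

/-! ### First moments of the killed walk -/

lemma integrable_conv_of_le {μ ν : Measure ℝ} [IsFiniteMeasure μ] [IsFiniteMeasure ν]
    {f a b : ℝ → ℝ} (hf : Measurable f) (ha : Integrable a ν) (hb : Integrable b μ)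
    (hfab : ∀ x y, |f (x + y)| ≤ a x + b y) : Integrable f (ν ∗ μ) := by
  rw [Measure.conv, integrable_map_measure hf.aestronglyMeasurable (by fun_prop)]
  exact ((ha.comp_fst μ).add (hb.comp_snd ν)).mono' (hf.comp measurable_add).aestronglyMeasurable
    (.of_forall fun p => hfab p.1 p.2)

lemma integrable_abs_conv {μ ν : Measure ℝ} [IsFiniteMeasure μ] [IsFiniteMeasure ν]
    (hν : Integrable (fun x => |x|) ν) (hμ : Integrable (fun x => |x|) μ) :
    Integrable (fun x => |x|) (ν ∗ μ) :=
  integrable_conv_of_le (by fun_prop) hν hμ fun x y => (abs_abs _).trans_le (abs_add_le x y)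

lemma measurable_measure_Icc_zero_abs (ρ : Measure ℝ) [SFinite ρ] :
    Measurable fun x => ρ (Icc 0 |x|) :=
  have hset : MeasurableSet {p : ℝ × ℝ | p.1 ∈ Icc 0 |p.2|} :=
    (measurableSet_le measurable_const measurable_fst).inter
      (measurableSet_le measurable_fst (by fun_prop))
  (measurable_measure_prodMk_right (μ := ρ) hset :)

-- A step leaving the half-line from `w ≥ 0` has size `|x| ≥ w`, and overshoots by less than `|x|`.
lemma setLIntegral_Iic_conv_le {μ ρ : Measure ℝ} [SFinite μ] [SFinite ρ]
    (hρ : ∀ᵐ w ∂ρ, 0 ≤ w) {ψ : ℝ → ENNReal} (hψ : Monotone ψ) :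
    ∫⁻ w in Iic 0, ψ |w| ∂(ρ ∗ μ) ≤ ∫⁻ x, ψ |x| * ρ (Icc 0 |x|) ∂μ := by
  have hψabs : Measurable fun x => ψ |x| := hψ.measurable.comp (by fun_prop)
  have hset : MeasurableSet {p : ℝ × ℝ | p.1 ∈ Icc 0 |p.2|} :=
    (measurableSet_le measurable_const measurable_fst).inter
      (measurableSet_le measurable_fst (by fun_prop))
  rw [← lintegral_indicator measurableSet_Iic,
    Measure.lintegral_conv (hψabs.indicator measurableSet_Iic)]
  calc ∫⁻ w, ∫⁻ x, (Iic 0).indicator (fun y => ψ |y|) (w + x) ∂μ ∂ρ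
      ≤ ∫⁻ w, ∫⁻ x, {p : ℝ × ℝ | p.1 ∈ Icc 0 |p.2|}.indicator (fun p => ψ |p.2|) (w, x) ∂μ ∂ρ := by
        refine lintegral_mono_ae (hρ.mono fun w hw => lintegral_mono fun x => ?_)
        rw [indicator_apply, indicator_apply]
        split_ifs with hexit hx
        · refine hψ ?_
          simp only [mem_Iic] at hexit
          rw [abs_of_nonpos hexit, abs_of_nonpos (by linarith)]
          linarith
        · simp only [mem_Iic, mem_ofPred_eq, mem_Icc, hw, true_and] at hexit hx
          exact absurd ((by linarith : w ≤ -x).trans (neg_le_abs x)) hx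
        all_goals exact zero_le
    _ = ∫⁻ x, ∫⁻ w, {p : ℝ × ℝ | p.1 ∈ Icc 0 |p.2|}.indicator (fun p => ψ |p.2|) (w, x) ∂ρ ∂μ :=
        lintegral_lintegral_swap ((hψabs.comp measurable_snd).indicator hset).aemeasurable
    _ = ∫⁻ x, ψ |x| * ρ (Icc 0 |x|) ∂μ := by
        refine lintegral_congr fun x => ?_
        rw [← lintegral_indicator_const measurableSet_Icc]
        rfl

lemma sum_lintegral_exitLaw_le (μ : Measure ℝ) [IsFiniteMeasure μ] {ν : Measure ℝ}
    [IsFiniteMeasure ν] (hν : ν (Iio 0) = 0) {ψ : ℝ → ENNReal} (hψ : Monotone ψ) (n : ℕ) :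
    ∑ k ∈ Finset.range n, ∫⁻ w, ψ |w| ∂exitLaw μ ν k
      ≤ ∫⁻ x, ψ |x| * ∑ k ∈ Finset.range n, aliveLaw μ ν k (Icc 0 |x|) ∂μ := by
  have hψabs : Measurable fun x => ψ |x| := hψ.measurable.comp (by fun_prop)
  simp_rw [Finset.mul_sum]
  rw [lintegral_finsetSum (f := fun k x => ψ |x| * aliveLaw μ ν k (Icc 0 |x|)) _
    fun k _ => hψabs.mul (measurable_measure_Icc_zero_abs _)]
  exact Finset.sum_le_sum fun k _ => setLIntegral_Iic_conv_le (ae_aliveLaw_nonneg μ hν k) hψ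

/-- The mean overshoot below `0`, accumulated over the exits that happen by time `n`. -/
noncomputable def meanOvershoot (μ ν : Measure ℝ) (n : ℕ) : ℝ :=
  ∑ k ∈ Finset.range n, ∫ w, |w| ∂exitLaw μ ν k

lemma meanOvershoot_nonneg (μ ν : Measure ℝ) (n : ℕ) : 0 ≤ meanOvershoot μ ν n :=
  Finset.sum_nonneg fun _ _ => integral_nonneg fun _ => abs_nonneg _

lemma integral_abs_exitLaw (μ ν : Measure ℝ) (k : ℕ) :
    ∫ w, |w| ∂exitLaw μ ν k = -∫ w, w ∂exitLaw μ ν k := by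
  rw [← integral_neg]
  exact integral_congr_ae ((ae_exitLaw_nonpos μ ν k).mono fun w hw => abs_of_nonpos hw)

lemma integral_aliveLaw_succ_add_exitLaw {μ ν : Measure ℝ} [SFinite μ]
    {f : ℝ → ℝ} {n : ℕ} [SFinite (aliveLaw μ ν n)] (hf : Integrable f (aliveLaw μ ν n ∗ μ)) :
    ∫ w, f w ∂aliveLaw μ ν (n + 1) + ∫ w, f w ∂exitLaw μ ν n
      = ∫ w, ∫ x, f (w + x) ∂μ ∂aliveLaw μ ν n := by
  rw [← integral_conv hf, ← aliveLaw_succ_add_exitLaw, integral_add_measure]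
  · rw [aliveLaw_succ]; exact hf.restrict
  · exact hf.restrict

section FirstMoment

variable (μ : Measure ℝ) [IsStdLaw μ] {ν : Measure ℝ} [IsFiniteMeasure ν]

lemma integrable_abs_aliveLaw (hν : Integrable (fun x => |x|) ν) (n : ℕ) :
    Integrable (fun x => |x|) (aliveLaw μ ν n) := by
  induction n with
  | zero => exact hν
  | succ n ih =>
    rw [aliveLaw_succ]
    exact (integrable_abs_conv ih (IsStdLaw.integrable_abs μ)).restrict

lemma integrable_abs_exitLaw (hν : Integrable (fun x => |x|) ν) (n : ℕ) :
    Integrable (fun x => |x|) (exitLaw μ ν n) :=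
  (integrable_abs_conv (integrable_abs_aliveLaw μ hν n) (IsStdLaw.integrable_abs μ)).restrict

lemma integral_id_aliveLaw (hν : Integrable (fun x => |x|) ν) (n : ℕ) :
    ∫ w, w ∂aliveLaw μ ν n = ∫ w, w ∂ν + meanOvershoot μ ν n := by
  induction n with
  | zero => simp [aliveLaw_zero, meanOvershoot]
  | succ n ih =>
    have hint : Integrable (fun x => x) (aliveLaw μ ν n ∗ μ) :=
      (integrable_abs_conv (integrable_abs_aliveLaw μ hν n) (IsStdLaw.integrable_abs μ)).mono'
        (by fun_prop) (.of_forall fun x => le_rfl)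
    have hmart : ∀ w, ∫ x, (w + x) ∂μ = w := fun w => by
      rw [integral_add (integrable_const _) (IsStdLaw.integrable_id μ), IsStdLaw.mean]
      simp
    have hstep := integral_aliveLaw_succ_add_exitLaw hint
    simp_rw [hmart] at hstep
    rw [meanOvershoot, Finset.sum_range_succ, integral_abs_exitLaw, ← meanOvershoot]
    linarith

end FirstMoment

/-! ### The Green function and the overshoot -/

/-- A concave function, linear below `-b`, constant above `r + b` and with second derivative
`-1` in between; along the walk its mean decreases at each visit to `[0, r]`. -/
noncomputable def concaveTest (r b w : ℝ) : ℝ :=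
  (r + b) ^ 2 / 2 - (max (r + b - w) 0) ^ 2 / 2 + (max (-b - w) 0) ^ 2 / 2

section ConcaveTest

variable {r b : ℝ}

lemma concaveTest_nonneg {w : ℝ} (hr : 0 ≤ r) (hb : 0 < b) (hw : 0 ≤ w) :
    0 ≤ concaveTest r b w := by
  unfold concaveTest
  have : max (r + b - w) 0 ≤ r + b := max_le (by linarith) (by linarith)
  have h0 := le_max_right (r + b - w) 0
  nlinarith [sq_nonneg (max (-b - w) 0)]

lemma concaveTest_le {w : ℝ} (hb : 0 < b) (hw : 0 ≤ w) :
    concaveTest r b w ≤ (r + b) ^ 2 / 2 := by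
  unfold concaveTest
  rw [max_eq_right (a := -b - w) (by linarith)]
  nlinarith [sq_nonneg (max (r + b - w) 0)]

lemma concaveTest_ge {w : ℝ} (hr : 0 ≤ r) (hb : 0 < b) (hw : w ≤ 0) :
    (r + 2 * b) * w ≤ concaveTest r b w := by
  unfold concaveTest
  rw [max_eq_left (a := r + b - w) (by linarith)]
  rcases le_total (-b - w) 0 with h | h
  · rw [max_eq_right h]; nlinarith
  · rw [max_eq_left h]; nlinarith

lemma concaveTest_zero (hr : 0 ≤ r) (hb : 0 < b) : concaveTest r b 0 = 0 := by
  unfold concaveTest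
  rw [max_eq_left (by linarith), max_eq_right (by linarith)]; ring

lemma concaveTest_le_of_nonpos {w : ℝ} (hr : 0 ≤ r) (hb : 0 < b) (hw : w ≤ 0) :
    concaveTest r b w ≤ 0 := by
  unfold concaveTest
  rw [max_eq_left (a := r + b - w) (by linarith)]
  rcases le_total (-b - w) 0 with h | h
  · rw [max_eq_right h]; nlinarith
  · rw [max_eq_left h]; nlinarith

lemma abs_concaveTest_le (hr : 0 ≤ r) (hb : 0 < b) (w : ℝ) :
    |concaveTest r b w| ≤ (r + b) ^ 2 / 2 + (r + 2 * b) * |w| := by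
  rcases le_total 0 w with hw | hw
  · rw [abs_of_nonneg (concaveTest_nonneg hr hb hw)]
    have : 0 ≤ (r + 2 * b) * |w| := by positivity
    linarith [concaveTest_le (r := r) hb hw]
  · rw [abs_of_nonpos (concaveTest_le_of_nonpos hr hb hw), abs_of_nonpos hw]
    have := concaveTest_ge hr hb hw
    nlinarith [sq_nonneg (r + b)]

lemma measurable_concaveTest : Measurable (concaveTest r b) := by
  unfold concaveTest; fun_prop

lemma integrable_concaveTest (hr : 0 ≤ r) (hb : 0 < b) {ρ : Measure ℝ} [IsFiniteMeasure ρ]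
    (hρ : Integrable (fun x => |x|) ρ) : Integrable (concaveTest r b) ρ :=
  ((integrable_const ((r + b) ^ 2 / 2)).add (hρ.const_mul (r + 2 * b))).mono'
    measurable_concaveTest.aestronglyMeasurable (.of_forall fun w => abs_concaveTest_le hr hb w)

lemma integral_concaveTest_le {ν : Measure ℝ} [IsFiniteMeasure ν] (hν0 : ν (Iio 0) = 0)
    (hr : 0 ≤ r) (hb : 0 < b) :
    ∫ w, concaveTest r b w ∂ν ≤ (r + b) ^ 2 / 2 * ν.real univ := by
  have hnonneg : ∀ᵐ w ∂ν, 0 ≤ w := ae_aliveLaw_nonneg 0 hν0 0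
  calc ∫ w, concaveTest r b w ∂ν ≤ ∫ _, (r + b) ^ 2 / 2 ∂ν :=
        integral_mono_of_nonneg (hnonneg.mono fun w hw => concaveTest_nonneg hr hb hw)
          (integrable_const _) (hnonneg.mono fun w hw => concaveTest_le hb hw)
    _ = (r + b) ^ 2 / 2 * ν.real univ := by rw [integral_const, smul_eq_mul, mul_comm]

lemma concaveTest_add_le {w : ℝ} (hr : 0 ≤ r) (hb : 0 < b) (hw : 0 ≤ w) (x : ℝ) :
    concaveTest r b (w + x) ≤ concaveTest r b w + max (r + b - w) 0 * x := by
  unfold concaveTest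
  rw [max_eq_right (a := -b - w) (by linarith)]
  rcases le_total (-b - (w + x)) 0 with hx | hx
  · rw [max_eq_right hx]
    rcases le_total (r + b - w) 0 with hwr | hwr
    · rw [max_eq_right hwr]
      nlinarith [sq_nonneg (max (r + b - (w + x)) 0)]
    · rw [max_eq_left hwr]
      rcases le_total (r + b - (w + x)) 0 with hwx | hwx
      · rw [max_eq_right hwx]; nlinarith [sq_nonneg (r + b - w)]
      · rw [max_eq_left hwx]; nlinarith [sq_nonneg x]
  · rw [max_eq_left hx, max_eq_left (a := r + b - (w + x)) (by linarith)]
    rcases le_total (r + b - w) 0 with hwr | hwr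
    · rw [max_eq_right hwr]; nlinarith
    · rw [max_eq_left hwr]; nlinarith

lemma concaveTest_add_le_sub {w : ℝ} (hb : 0 < b) (hw : 0 ≤ w) (hwr : w ≤ r) (x : ℝ) :
    concaveTest r b (w + x)
      ≤ concaveTest r b w + (r + b - w) * x - (x ^ 2 - |x| ^ 3 / b) / 2 := by
  rcases le_or_gt |x| b with hx | hx
  · have hcube : 0 ≤ |x| ^ 3 / b := by positivity
    obtain ⟨hbx, hxb⟩ := abs_le.1 hx
    unfold concaveTest
    rw [max_eq_right (a := -b - w) (by linarith), max_eq_right (a := -b - (w + x)) (by linarith),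
      max_eq_left (a := r + b - w) (by linarith), max_eq_left (a := r + b - (w + x)) (by linarith)]
    nlinarith
  · have hlin := concaveTest_add_le (hw.trans hwr) hb hw x
    rw [max_eq_left (by linarith)] at hlin
    have hcube : x ^ 2 ≤ |x| ^ 3 / b := by
      rw [le_div_iff₀ hb, ← sq_abs]
      nlinarith [sq_nonneg |x|, abs_nonneg x]
    linarith

end ConcaveTest

section GreenFunction

variable (μ : Measure ℝ) [IsStdLaw μ]

lemma integral_add_mul_self (a d : ℝ) : ∫ x, (a + d * x) ∂μ = a := by
  rw [integral_add (integrable_const _) ((IsStdLaw.integrable_id μ).const_mul d),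
    integral_const_mul, IsStdLaw.mean]
  simp

lemma integrable_add_mul_self (a d : ℝ) : Integrable (fun x => a + d * x) μ :=
  (integrable_const _).add ((IsStdLaw.integrable_id μ).const_mul d)

lemma integrable_concaveTest_const_add {r b : ℝ} (hr : 0 ≤ r) (hb : 0 < b) (w : ℝ) :
    Integrable (fun x => concaveTest r b (w + x)) μ := by
  refine ((integrable_const ((r + b) ^ 2 / 2 + (r + 2 * b) * |w|)).add
    ((IsStdLaw.integrable_abs μ).const_mul (r + 2 * b))).mono'
    (measurable_concaveTest.comp (measurable_const_add w)).aestronglyMeasurable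
    (.of_forall fun x => (abs_concaveTest_le hr hb (w + x)).trans ?_)
  have habs : (r + 2 * b) * |w + x| ≤ (r + 2 * b) * (|w| + |x|) := by
    gcongr; exact abs_add_le w x
  simp only [Pi.add_apply]
  linarith

lemma integral_concaveTest_add_le {r b w : ℝ} (hr : 0 ≤ r) (hb : 0 < b) (hw : 0 ≤ w) :
    ∫ x, concaveTest r b (w + x) ∂μ ≤ concaveTest r b w :=
  (integral_mono (integrable_concaveTest_const_add μ hr hb w) (integrable_add_mul_self μ _ _)
    fun x => concaveTest_add_le hr hb hw x).trans_eq (integral_add_mul_self μ _ _)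

lemma integral_concaveTest_add_le_sub {r b w : ℝ} (hb : 0 < b) (hw : 0 ≤ w) (hwr : w ≤ r) :
    ∫ x, concaveTest r b (w + x) ∂μ ≤ concaveTest r b w - (1 - thirdMoment μ / b) / 2 := by
  have hquad : Integrable (fun x => (x ^ 2 - |x| ^ 3 / b) / 2) μ :=
    ((IsStdLaw.integrable_sq μ).sub (IsStdLaw.integrable_cube.div_const b)).div_const 2
  calc ∫ x, concaveTest r b (w + x) ∂μ
      ≤ ∫ x, (concaveTest r b w + (r + b - w) * x - (x ^ 2 - |x| ^ 3 / b) / 2) ∂μ :=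
        integral_mono (integrable_concaveTest_const_add μ (hw.trans hwr) hb w)
          ((integrable_add_mul_self μ _ _).sub hquad) fun x => concaveTest_add_le_sub hb hw hwr x
    _ = concaveTest r b w - (1 - thirdMoment μ / b) / 2 := by
        rw [integral_sub (integrable_add_mul_self μ _ _) hquad, integral_add_mul_self,
          integral_div, integral_sub (IsStdLaw.integrable_sq μ)
          (IsStdLaw.integrable_cube.div_const b), IsStdLaw.sq, integral_div, ← thirdMoment]

variable {ν : Measure ℝ} [IsFiniteMeasure ν]

lemma neg_mul_integral_abs_le_integral_concaveTest_exitLaw (hν : Integrable (fun x => |x|) ν)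
    {r b : ℝ} (hr : 0 ≤ r) (hb : 0 < b) (k : ℕ) :
    -((r + 2 * b) * ∫ w, |w| ∂exitLaw μ ν k) ≤ ∫ w, concaveTest r b w ∂exitLaw μ ν k := by
  rw [← integral_const_mul, ← integral_neg]
  refine integral_mono_ae ((integrable_abs_exitLaw μ hν k).const_mul _).neg
    (integrable_concaveTest hr hb (integrable_abs_exitLaw μ hν k))
    ((ae_exitLaw_nonpos μ ν k).mono fun w hw => ?_)
  simp only [abs_of_nonpos hw]
  linarith [concaveTest_ge hr hb hw]

lemma integral_concaveTest_conv_aliveLaw_le (hν : Integrable (fun x => |x|) ν)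
    (hν0 : ν (Iio 0) = 0) {r b : ℝ} (hr : 0 ≤ r) (hb : 0 < b) (k : ℕ) :
    ∫ w, ∫ x, concaveTest r b (w + x) ∂μ ∂aliveLaw μ ν k
      ≤ ∫ w, concaveTest r b w ∂aliveLaw μ ν k
        - (1 - thirdMoment μ / b) / 2 * (aliveLaw μ ν k).real (Icc 0 r) := by
  have hint := integrable_concaveTest hr hb (integrable_abs_aliveLaw μ hν k)
  have hconv := integrable_concaveTest hr hb
    (integrable_abs_conv (integrable_abs_aliveLaw μ hν k) (IsStdLaw.integrable_abs μ))
  rw [Measure.conv, integrable_map_measure measurable_concaveTest.aestronglyMeasurable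
    (by fun_prop)] at hconv
  have hind : Integrable ((Icc 0 r).indicator fun _ => (1 - thirdMoment μ / b) / 2)
      (aliveLaw μ ν k) := (integrable_const _).indicator measurableSet_Icc
  rw [mul_comm, ← smul_eq_mul, ← integral_indicator_const _ measurableSet_Icc,
    ← integral_sub hint hind]
  refine integral_mono_ae hconv.integral_prod_left (hint.sub hind)
    ((ae_aliveLaw_nonneg μ hν0 k).mono fun w hw => ?_)
  simp only
  rcases le_or_gt w r with hwr | hwr
  · rw [indicator_of_mem (mem_Icc.2 ⟨hw, hwr⟩)]
    exact integral_concaveTest_add_le_sub μ hb hw hwr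
  · rw [indicator_of_notMem (by simp [hwr]), sub_zero]
    exact integral_concaveTest_add_le μ hr hb hw

-- With `b = 2 * thirdMoment μ` the test function loses at least `1 / 4` per visit to `[0, r]`.
lemma sum_aliveLaw_real_Icc_le (hν : Integrable (fun x => |x|) ν) (hν0 : ν (Iio 0) = 0) {r : ℝ}
    (hr : 0 ≤ r) (n : ℕ) :
    ∑ k ∈ Finset.range n, (aliveLaw μ ν k).real (Icc 0 r)
      ≤ 4 * (∫ w, concaveTest r (2 * thirdMoment μ) w ∂ν
        + (r + 4 * thirdMoment μ) * meanOvershoot μ ν n) := by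
  have hL : 0 < thirdMoment μ := zero_lt_one.trans_le (IsStdLaw.one_le_thirdMoment μ)
  set b := 2 * thirdMoment μ with hb_def
  have hb : 0 < b := by positivity
  have hdrift : (1 - thirdMoment μ / b) / 2 = 1 / 4 := by rw [hb_def]; field_simp; norm_num
  have hstep : ∀ k ∈ Finset.range n, (aliveLaw μ ν k).real (Icc 0 r) / 4
      ≤ ∫ w, concaveTest r b w ∂aliveLaw μ ν k - ∫ w, concaveTest r b w ∂aliveLaw μ ν (k + 1)
        + (r + 2 * b) * ∫ w, |w| ∂exitLaw μ ν k := fun k _ => by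
    have hsplit := integral_aliveLaw_succ_add_exitLaw (integrable_concaveTest hr hb
      (integrable_abs_conv (integrable_abs_aliveLaw μ hν k) (IsStdLaw.integrable_abs μ)))
    have hexit := neg_mul_integral_abs_le_integral_concaveTest_exitLaw μ hν hr hb k
    have hconv := integral_concaveTest_conv_aliveLaw_le μ hν hν0 hr hb k
    rw [hdrift] at hconv
    linarith
  have hsum := Finset.sum_le_sum hstep
  rw [← Finset.sum_div, Finset.sum_add_distrib, ← Finset.mul_sum, Finset.sum_range_sub',
    aliveLaw_zero, ← meanOvershoot, show r + 2 * b = r + 4 * thirdMoment μ by ring] at hsum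
  have hend : 0 ≤ ∫ w, concaveTest r b w ∂aliveLaw μ ν n := integral_nonneg_of_ae
    ((ae_aliveLaw_nonneg μ hν0 n).mono fun w hw => concaveTest_nonneg hr hb hw)
  linarith

lemma sum_aliveLaw_Icc_le_ofReal (hν : Integrable (fun x => |x|) ν) (hν0 : ν (Iio 0) = 0) {r : ℝ}
    (hr : 0 ≤ r) (n : ℕ) {c : ℝ} (hc : ∫ w, concaveTest r (2 * thirdMoment μ) w ∂ν ≤ c) :
    ∑ k ∈ Finset.range n, aliveLaw μ ν k (Icc 0 r)
      ≤ ENNReal.ofReal (4 * (c + (r + 4 * thirdMoment μ) * meanOvershoot μ ν n)) := by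
  have hreal := sum_aliveLaw_real_Icc_le μ hν hν0 hr n
  have hofReal : ∑ k ∈ Finset.range n, aliveLaw μ ν k (Icc 0 r)
      = ENNReal.ofReal (∑ k ∈ Finset.range n, (aliveLaw μ ν k).real (Icc 0 r)) := by
    rw [ENNReal.ofReal_sum_of_nonneg fun _ _ => measureReal_nonneg]
    exact Finset.sum_congr rfl fun k _ => (ofReal_measureReal).symm
  rw [hofReal]
  exact ENNReal.ofReal_le_ofReal (by linarith)

end GreenFunction

section MeanOvershoot

variable (μ : Measure ℝ) [IsStdLaw μ] {ν : Measure ℝ} [IsFiniteMeasure ν]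

/-- The identity truncated to arguments exceeding `a`, as a monotone weight. -/
noncomputable def tailWeight (a t : ℝ) : ENNReal := if a < t then ENNReal.ofReal t else 0

lemma tailWeight_mono (a : ℝ) : Monotone (tailWeight a) := fun t t' htt => by
  unfold tailWeight
  split_ifs with ht ht'
  · exact ENNReal.ofReal_le_ofReal htt
  · exact absurd (ht.trans_le htt) ht'
  · exact zero_le
  · exact le_rfl

lemma ofReal_meanOvershoot_le_add_tail (hν : Integrable (fun x => |x|) ν) {a : ℝ} (ha : 0 ≤ a)
    (n : ℕ) :
    ENNReal.ofReal (meanOvershoot μ ν n) ≤ ENNReal.ofReal (a * ν.real univ)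
      + ∑ k ∈ Finset.range n, ∫⁻ w, tailWeight a |w| ∂exitLaw μ ν k := by
  have hone : ∀ k, ENNReal.ofReal (∫ w, |w| ∂exitLaw μ ν k)
      ≤ ENNReal.ofReal (a * (exitLaw μ ν k).real univ)
        + ∫⁻ w, tailWeight a |w| ∂exitLaw μ ν k := fun k => by
    rw [ofReal_integral_eq_lintegral_ofReal (integrable_abs_exitLaw μ hν k)
      (.of_forall fun _ => abs_nonneg _), ENNReal.ofReal_mul ha, ofReal_measureReal,
      ← lintegral_const, ← lintegral_add_left measurable_const]
    refine lintegral_mono fun w => ?_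
    unfold tailWeight
    split_ifs with hw
    · exact le_add_self
    · rw [add_zero]; exact ENNReal.ofReal_le_ofReal (not_lt.1 hw)
  calc ENNReal.ofReal (meanOvershoot μ ν n)
      = ∑ k ∈ Finset.range n, ENNReal.ofReal (∫ w, |w| ∂exitLaw μ ν k) :=
        ENNReal.ofReal_sum_of_nonneg fun _ _ => integral_nonneg fun _ => abs_nonneg _
    _ ≤ ∑ k ∈ Finset.range n, (ENNReal.ofReal (a * (exitLaw μ ν k).real univ)
          + ∫⁻ w, tailWeight a |w| ∂exitLaw μ ν k) := Finset.sum_le_sum fun k _ => hone k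
    _ = ENNReal.ofReal (a * ∑ k ∈ Finset.range n, (exitLaw μ ν k).real univ)
          + ∑ k ∈ Finset.range n, ∫⁻ w, tailWeight a |w| ∂exitLaw μ ν k := by
        rw [Finset.sum_add_distrib, Finset.mul_sum,
          ENNReal.ofReal_sum_of_nonneg fun _ _ => by positivity]
    _ ≤ _ := by
        gcongr
        exact sum_exitLaw_real_univ_le μ ν n

lemma sum_lintegral_tailWeight_exitLaw_le (hν : Integrable (fun x => |x|) ν)
    (hν0 : ν (Iio 0) = 0) (n : ℕ) :
    ∑ k ∈ Finset.range n, ∫⁻ w, tailWeight (16 * thirdMoment μ) |w| ∂exitLaw μ ν k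
      ≤ ENNReal.ofReal ((8 * ν.real univ + 8 * meanOvershoot μ ν n / (16 * thirdMoment μ))
        * thirdMoment μ) := by
  set L := thirdMoment μ
  have hL : 1 ≤ L := IsStdLaw.one_le_thirdMoment μ
  set M := ν.real univ
  set g := meanOvershoot μ ν n
  have hg : 0 ≤ g := meanOvershoot_nonneg μ ν n
  refine (sum_lintegral_exitLaw_le μ hν0 (tailWeight_mono _) n).trans ?_
  rw [show (8 * M + 8 * g / (16 * L)) * L = ∫ x, (8 * M + 8 * g / (16 * L)) * |x| ^ 3 ∂μ from
      (integral_const_mul _ _).symm,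
    ofReal_integral_eq_lintegral_ofReal (IsStdLaw.integrable_cube.const_mul _)
      (.of_forall fun _ => by positivity)]
  refine lintegral_mono fun x => ?_
  unfold tailWeight
  split_ifs with hx
  · have hgreen := sum_aliveLaw_Icc_le_ofReal μ hν hν0 (abs_nonneg x) n
      (integral_concaveTest_le hν0 (abs_nonneg x) (b := 2 * L) (by positivity))
    refine (mul_le_mul_right hgreen _).trans ?_
    rw [← ENNReal.ofReal_mul (abs_nonneg x)]
    apply ENNReal.ofReal_le_ofReal
    have hsq : (|x| + 2 * L) ^ 2 / 2 ≤ 2 * |x| ^ 2 := by nlinarith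
    have hlin : |x| + 4 * L ≤ 2 * |x| := by linarith
    have hcube : |x| ^ 2 ≤ |x| ^ 3 / (16 * L) := by
      rw [le_div_iff₀ (by positivity)]
      nlinarith [sq_nonneg |x|]
    calc |x| * (4 * ((|x| + 2 * L) ^ 2 / 2 * M + (|x| + 4 * L) * g))
        ≤ |x| * (4 * (2 * |x| ^ 2 * M + 2 * |x| * g)) := by gcongr
      _ = 8 * M * |x| ^ 3 + 8 * g * |x| ^ 2 := by ring
      _ ≤ 8 * M * |x| ^ 3 + 8 * g * (|x| ^ 3 / (16 * L)) := by gcongr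
      _ = _ := by ring
  · rw [zero_mul]; exact zero_le

-- The overshoots above `16 * thirdMoment μ` contribute at most half of the total, by the Green
-- function bound; hence they can be absorbed.
theorem meanOvershoot_le (hν : Integrable (fun x => |x|) ν) (hν0 : ν (Iio 0) = 0) (n : ℕ) :
    meanOvershoot μ ν n ≤ 48 * thirdMoment μ * ν.real univ := by
  have hL : 0 < thirdMoment μ := zero_lt_one.trans_le (IsStdLaw.one_le_thirdMoment μ)
  have hg : 0 ≤ meanOvershoot μ ν n := meanOvershoot_nonneg μ ν n
  have hle := (ofReal_meanOvershoot_le_add_tail μ hν (by positivity) n).trans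
    (add_le_add_right (sum_lintegral_tailWeight_exitLaw_le μ hν hν0 n) _)
  rw [← ENNReal.ofReal_add (by positivity) (by positivity),
    ENNReal.ofReal_le_ofReal_iff (by positivity)] at hle
  have hhalf : 8 * meanOvershoot μ ν n / (16 * thirdMoment μ) * thirdMoment μ
      = meanOvershoot μ ν n / 2 := by field_simp; ring
  rw [add_mul, hhalf] at hle
  linarith

lemma sum_lintegral_sq_exitLaw_dirac_le (n : ℕ) :
    ∑ k ∈ Finset.range n, ∫⁻ w, ENNReal.ofReal (w ^ 2) ∂exitLaw μ (Measure.dirac 0) k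
      ≤ ENNReal.ofReal (20 * thirdMoment μ * meanOvershoot μ (Measure.dirac 0) n) := by
  set g := meanOvershoot μ (Measure.dirac 0) n
  set L := thirdMoment μ with hL_def
  have hL : 1 ≤ L := IsStdLaw.one_le_thirdMoment μ
  have hg : 0 ≤ g := meanOvershoot_nonneg μ _ n
  have hmono : Monotone fun a : ℝ => ENNReal.ofReal (max a 0 ^ 2) := fun a a' haa =>
    ENNReal.ofReal_le_ofReal (by gcongr)
  have hexit := sum_lintegral_exitLaw_le μ (ν := Measure.dirac 0) (by simp) hmono n
  simp only [abs_nonneg, sup_of_le_left, sq_abs] at hexit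
  have hint : Integrable (fun x => 4 * g * |x| ^ 3 + 16 * L * g * x ^ 2) μ :=
    (IsStdLaw.integrable_cube.const_mul _).add ((IsStdLaw.integrable_sq μ).const_mul _)
  have hmoments : 20 * L * g = ∫ x, (4 * g * |x| ^ 3 + 16 * L * g * x ^ 2) ∂μ := by
    rw [integral_add (IsStdLaw.integrable_cube.const_mul _)
      ((IsStdLaw.integrable_sq μ).const_mul _), integral_const_mul, integral_const_mul,
      IsStdLaw.sq, ← thirdMoment, ← hL_def]
    ring
  rw [hmoments, ofReal_integral_eq_lintegral_ofReal hint (.of_forall fun _ => by positivity)]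
  refine hexit.trans (lintegral_mono fun x => ?_)
  have hstart : ∫ w, concaveTest |x| (2 * L) w ∂Measure.dirac 0 ≤ 0 := by
    rw [integral_dirac, concaveTest_zero (abs_nonneg x) (by positivity)]
  refine (mul_le_mul_right (sum_aliveLaw_Icc_le_ofReal μ (integrable_dirac (by simp)) (by simp)
    (abs_nonneg x) n hstart) _).trans ?_
  rw [← ENNReal.ofReal_mul (sq_nonneg x), ← sq_abs]
  exact ENNReal.ofReal_le_ofReal (le_of_eq (by ring))

end MeanOvershoot

/-! ### Positive association of the walk with its survival -/

lemma ennreal_mul_add_mul_le_mul_add_mul {a b c d : ENNReal} (hab : a ≤ b) (hcd : c ≤ d) :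
    a * d + b * c ≤ a * c + b * d := by
  obtain ⟨s, rfl⟩ := exists_add_of_le hab
  obtain ⟨t, rfl⟩ := exists_add_of_le hcd
  calc a * (c + t) + (a + s) * c ≤ a * (c + t) + (a + s) * c + s * t := le_self_add
    _ = a * c + (a + s) * (c + t) := by ring

-- Chebyshev's association inequality: integrate `(f x - f y) * (g x - g y) ≥ 0` over both
-- variables.
lemma lintegral_mul_lintegral_le_of_monovary {α : Type*} [MeasurableSpace α] (μ : Measure α)
    [IsProbabilityMeasure μ] {f g : α → ENNReal} (hf : Measurable f) (hg : Measurable g)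
    (hfg : Monovary f g) : (∫⁻ x, f x ∂μ) * ∫⁻ x, g x ∂μ ≤ ∫⁻ x, f x * g x ∂μ := by
  have hpt : ∀ x y, f x * g y + f y * g x ≤ f x * g x + f y * g y := fun x y => by
    rcases lt_trichotomy (g x) (g y) with hxy | hxy | hxy
    · exact ennreal_mul_add_mul_le_mul_add_mul (hfg hxy) hxy.le
    · rw [hxy]
    · simpa only [add_comm] using ennreal_mul_add_mul_le_mul_add_mul (hfg hxy) hxy.le
  have hint := lintegral_mono (μ := μ) fun x => lintegral_mono (μ := μ) fun y => hpt x y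
  have hcross : ∀ x, ∫⁻ y, (f x * g y + f y * g x) ∂μ
      = f x * ∫⁻ y, g y ∂μ + (∫⁻ y, f y ∂μ) * g x := fun x => by
    rw [lintegral_add_left (hg.const_mul _), lintegral_const_mul _ hg, lintegral_mul_const _ hf]
  have hdiag : ∀ x, ∫⁻ y, (f x * g x + f y * g y) ∂μ = f x * g x + ∫⁻ y, f y * g y ∂μ :=
    fun x => by rw [lintegral_add_left measurable_const, lintegral_const, measure_univ, mul_one]
  simp_rw [hcross, hdiag] at hint
  rw [lintegral_add_left (hf.mul_const _), lintegral_mul_const _ hf, lintegral_const_mul _ hg,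
    lintegral_add_left (f := fun x => f x * g x) (hf.mul hg), lintegral_const, measure_univ,
    mul_one, ← two_mul, ← two_mul] at hint
  exact (ENNReal.mul_le_mul_iff_right two_ne_zero ENNReal.ofNat_ne_top).1 hint

/-- The transition operator of the walk with increment law `μ`. -/
noncomputable def freeOp (μ : Measure ℝ) (f : ℝ → ENNReal) (w : ℝ) : ENNReal :=
  ∫⁻ x, f (w + x) ∂μ

/-- The transition operator of the walk killed when it becomes non-positive; it is dual to
`killedStep`. -/
noncomputable def killedOp (μ : Measure ℝ) (f : ℝ → ENNReal) (w : ℝ) : ENNReal :=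
  ∫⁻ x, (Ioi 0).indicator f (w + x) ∂μ

lemma monotone_freeOp (μ : Measure ℝ) {f : ℝ → ENNReal} (hf : Monotone f) :
    Monotone (freeOp μ f) := fun _ _ hxy => lintegral_mono fun _ => hf (by linarith)

lemma monotone_indicator_of_isUpperSet {α : Type*} [Preorder α] {s : Set α} (hs : IsUpperSet s)
    {f : α → ENNReal} (hf : Monotone f) : Monotone (s.indicator f) := fun x y hxy => by
  by_cases hx : x ∈ s
  · rw [indicator_of_mem hx, indicator_of_mem (hs hxy hx)]
    exact hf hxy
  · rw [indicator_of_notMem hx]; exact zero_le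

lemma monotone_killedOp (μ : Measure ℝ) {f : ℝ → ENNReal} (hf : Monotone f) :
    Monotone (killedOp μ f) :=
  monotone_freeOp μ (monotone_indicator_of_isUpperSet (isUpperSet_Ioi 0) hf)

lemma monotone_killedOp_iterate (μ : Measure ℝ) {f : ℝ → ENNReal} (hf : Monotone f) (n : ℕ) :
    Monotone ((killedOp μ)^[n] f) := by
  induction n with
  | zero => exact hf
  | succ n ih => rw [Function.iterate_succ_apply']; exact monotone_killedOp μ ih

lemma monotone_freeOp_iterate (μ : Measure ℝ) {f : ℝ → ENNReal} (hf : Monotone f) (n : ℕ) :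
    Monotone ((freeOp μ)^[n] f) := by
  induction n with
  | zero => exact hf
  | succ n ih => rw [Function.iterate_succ_apply']; exact monotone_freeOp μ ih

lemma aliveLaw_succ_eq_aliveLaw_killedStep (μ ν : Measure ℝ) (n : ℕ) :
    aliveLaw μ ν (n + 1) = aliveLaw μ (killedStep μ ν) n := Function.iterate_succ_apply _ _ _

lemma lintegral_aliveLaw (μ ν : Measure ℝ) [SFinite μ] {f : ℝ → ENNReal}
    (hf : Monotone f) (n : ℕ) :
    ∫⁻ w, f w ∂aliveLaw μ ν n = ∫⁻ w, (killedOp μ)^[n] f w ∂ν := by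
  induction n generalizing ν with
  | zero => rfl
  | succ n ih =>
    have hmeas := (monotone_killedOp_iterate μ hf n).measurable
    rw [aliveLaw_succ_eq_aliveLaw_killedStep, ih, killedStep,
      ← lintegral_indicator measurableSet_Ioi,
      Measure.lintegral_conv (hmeas.indicator measurableSet_Ioi), Function.iterate_succ_apply']
    rfl

lemma lintegral_conv_convPow (μ ν : Measure ℝ) [IsProbabilityMeasure μ] {f : ℝ → ENNReal}
    (hf : Monotone f) (n : ℕ) :
    ∫⁻ w, f w ∂(ν ∗ convPow μ n) = ∫⁻ w, (freeOp μ)^[n] f w ∂ν := by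
  induction n generalizing f with
  | zero => rw [Measure.lintegral_conv hf.measurable]; simp [convPow]
  | succ n ih =>
    rw [convPow, ← Measure.conv_assoc, Measure.lintegral_conv hf.measurable,
      Function.iterate_succ_apply, ← ih (monotone_freeOp μ hf)]
    rfl

lemma freeOp_mul_killedOp_le (μ : Measure ℝ) [IsProbabilityMeasure μ] {f : ℝ → ENNReal}
    (hf : Monotone f) (n : ℕ) (w : ℝ) :
    (freeOp μ)^[n] f w * (killedOp μ)^[n] 1 w ≤ (killedOp μ)^[n] f w := by
  induction n generalizing w with
  | zero => simp
  | succ n ih =>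
    simp only [Function.iterate_succ_apply']
    have hfree := (monotone_freeOp_iterate μ hf n).comp (add_right_mono (a := w))
    have hkilled := (monotone_indicator_of_isUpperSet (isUpperSet_Ioi (0 : ℝ))
      (monotone_killedOp_iterate μ (f := 1) monotone_const n)).comp (add_right_mono (a := w))
    refine (lintegral_mul_lintegral_le_of_monovary μ hfree.measurable hkilled.measurable
      (hfree.monovary hkilled)).trans (lintegral_mono fun x => ?_)
    simp only [Function.comp_apply]
    by_cases hx : w + x ∈ Ioi 0
    · rw [indicator_of_mem hx, indicator_of_mem hx]
      exact ih _
    · rw [indicator_of_notMem hx, mul_zero]; exact zero_le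

-- Conditioning on survival makes the walk stochastically larger.
lemma real_Ici_mul_aliveLaw_le (μ : Measure ℝ) [IsProbabilityMeasure μ] (u b : ℝ) (n : ℕ) :
    (convPow μ n).real (Ici (b - u)) * (aliveLaw μ (Measure.dirac u) n).real univ
      ≤ (aliveLaw μ (Measure.dirac u) n).real (Ici b) := by
  have hone : Monotone (1 : ℝ → ENNReal) := monotone_const
  have hind := monotone_indicator_of_isUpperSet (isUpperSet_Ici b) hone
  have hfree : convPow μ n (Ici (b - u)) = (freeOp μ)^[n] ((Ici b).indicator 1) u := by
    rw [← lintegral_dirac' u (monotone_freeOp_iterate μ hind n).measurable,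
      ← lintegral_conv_convPow μ (Measure.dirac u) hind n,
      lintegral_indicator_one measurableSet_Ici,
      Measure.dirac_conv, Measure.map_apply (by fun_prop) measurableSet_Ici, preimage_const_add_Ici]
  have hkilled : ∀ f, Monotone f →
      ∫⁻ w, f w ∂aliveLaw μ (Measure.dirac u) n = (killedOp μ)^[n] f u := fun f hf => by
    rw [lintegral_aliveLaw μ _ hf n,
      lintegral_dirac' _ (monotone_killedOp_iterate μ hf n).measurable]
  have hle := freeOp_mul_killedOp_le μ hind n u
  rw [← hfree, ← hkilled _ hone, ← hkilled _ hind,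
    lintegral_indicator_one measurableSet_Ici] at hle
  simp only [Pi.one_apply, lintegral_one] at hle
  simpa only [measureReal_def, ENNReal.toReal_mul] using
    ENNReal.toReal_mono (measure_ne_top _ _) hle

/-! ### Survival probabilities -/

lemma integrable_abs_dirac (u : ℝ) : Integrable (fun x : ℝ => |x|) (Measure.dirac u) :=
  integrable_dirac (by simp)

lemma dirac_Iio_zero {u : ℝ} (hu : 0 ≤ u) : Measure.dirac u (Iio 0) = 0 := by
  simp [hu]

lemma aliveLaw_dirac_real_univ_le_one (μ : Measure ℝ) [IsProbabilityMeasure μ] (u : ℝ) (n : ℕ) :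
    (aliveLaw μ (Measure.dirac u) n).real univ ≤ 1 :=
  (aliveLaw_real_univ_le μ (Measure.dirac u) n).trans_eq probReal_univ

lemma mul_real_Ici_le_integral {ρ : Measure ℝ} [IsFiniteMeasure ρ]
    (hρ : Integrable (fun x => |x|) ρ) (hρ0 : ∀ᵐ w ∂ρ, 0 ≤ w) (b : ℝ) :
    b * ρ.real (Ici b) ≤ ∫ w, w ∂ρ := by
  rw [mul_comm, ← smul_eq_mul, ← integral_indicator_const _ measurableSet_Ici]
  refine integral_mono_ae ((integrable_const _).indicator measurableSet_Ici)
    (hρ.mono' (by fun_prop) (.of_forall fun _ => le_rfl)) (hρ0.mono fun w hw => ?_)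
  by_cases hb : w ∈ Ici b
  · rw [indicator_of_mem hb]; exact hb
  · rw [indicator_of_notMem hb]; exact hw

section Survival

variable (μ : Measure ℝ) [IsStdLaw μ]

lemma one_div_eight_le_convPow_real_Ici {n : ℕ} (hn : 8 * beConst * thirdMoment μ ≤ √n) :
    1 / 8 ≤ (convPow μ n).real (Ici (√n / 4)) := by
  have hK : 1 ≤ beConst := one_le_beConst
  have hL : 1 ≤ thirdMoment μ := IsStdLaw.one_le_thirdMoment μ
  have hq : 0 < √(n : ℝ) := lt_of_lt_of_le (by positivity) hn
  have hbe := (abs_le.1 (berryEsseen_Ici μ (Nat.cast_pos.1 (Real.sqrt_pos.1 hq)) (√n / 4))).1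
  rw [show -(√(n : ℝ) / 4) / √n = -(1 / 4) by field_simp] at hbe
  have hhalf : stdCdf 0 = 1 / 2 := by
    have := stdCdf_neg 0
    rw [neg_zero] at this; linarith
  have hlip := (abs_le.1 (abs_stdCdf_sub_le 0 (-(1 / 4)))).2
  rw [show |(0 : ℝ) - -(1 / 4)| = 1 / 4 by norm_num] at hlip
  have herr : beConst * thirdMoment μ / √(n : ℝ) ≤ 1 / 8 := by
    rw [div_le_div_iff₀ hq (by norm_num)]; linarith
  linarith

-- A surviving walk is above `√n / 4` with probability at least `1 / 8` by association, so its
-- mean, which is known from the martingale property, bounds the survival probability.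
lemma aliveLaw_dirac_real_univ_le_meanOvershoot {u : ℝ} (hu : 0 ≤ u) {n : ℕ}
    (hn : 8 * beConst * thirdMoment μ ≤ √n) :
    (aliveLaw μ (Measure.dirac u) n).real univ
      ≤ 32 * (u + meanOvershoot μ (Measure.dirac u) n) / √n := by
  have hK : 1 ≤ beConst := one_le_beConst
  have hL : 1 ≤ thirdMoment μ := IsStdLaw.one_le_thirdMoment μ
  have hq : 0 < √(n : ℝ) := lt_of_lt_of_le (by positivity) hn
  have hfree : 1 / 8 ≤ (convPow μ n).real (Ici (√n / 4 - u)) :=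
    (one_div_eight_le_convPow_real_Ici μ hn).trans
      (measureReal_mono (Ici_subset_Ici.2 (by linarith)))
  have hassoc : 1 / 8 * (aliveLaw μ (Measure.dirac u) n).real univ
      ≤ (aliveLaw μ (Measure.dirac u) n).real (Ici (√n / 4)) :=
    (mul_le_mul_of_nonneg_right hfree measureReal_nonneg).trans
      (real_Ici_mul_aliveLaw_le μ u (√n / 4) n)
  have hmean := mul_real_Ici_le_integral (integrable_abs_aliveLaw μ (integrable_abs_dirac u) n)
    (ae_aliveLaw_nonneg μ (dirac_Iio_zero hu) n) (√n / 4)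
  rw [integral_id_aliveLaw μ (integrable_abs_dirac u) n, integral_dirac] at hmean
  rw [le_div_iff₀ hq]
  nlinarith

lemma aliveLaw_dirac_real_univ_le {u : ℝ} (hu : 0 ≤ u) (n : ℕ) :
    (aliveLaw μ (Measure.dirac u) n).real univ
      ≤ 3072 * beConst * (u + thirdMoment μ) / √(n + 1) := by
  set K := beConst
  have hK : 1 ≤ K := one_le_beConst
  set L := thirdMoment μ
  have hL : 1 ≤ L := IsStdLaw.one_le_thirdMoment μ
  have hsqrt : √((n : ℝ) + 1) ≤ √(n : ℝ) + 1 := by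
    refine Real.sqrt_le_iff.2 ⟨by positivity, ?_⟩
    nlinarith [Real.sq_sqrt (n.cast_nonneg : (0 : ℝ) ≤ n), Real.sqrt_nonneg (n : ℝ)]
  have hKL : 1 ≤ K * L := one_le_mul_of_one_le_of_one_le hK hL
  have hKu : 0 ≤ K * u := by positivity
  rw [le_div_iff₀ (by positivity)]
  rcases le_or_gt (8 * K * L) (√n) with hn | hn
  · have hsurv := aliveLaw_dirac_real_univ_le_meanOvershoot μ hu hn
    have hover := meanOvershoot_le μ (integrable_abs_dirac u) (dirac_Iio_zero hu) n
    rw [probReal_univ (μ := Measure.dirac u), mul_one] at hover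
    rw [le_div_iff₀ (lt_of_lt_of_le (by positivity) hn)] at hsurv
    calc _ ≤ (aliveLaw μ (Measure.dirac u) n).real univ * (2 * √n) := by
          gcongr; nlinarith
      _ ≤ 2 * (32 * (u + 48 * L)) := by linarith
      _ ≤ 3072 * K * (u + L) := by nlinarith
  · calc _ ≤ 1 * (√n + 1) := by gcongr; exact aliveLaw_dirac_real_univ_le_one μ u n
      _ ≤ _ := by nlinarith

lemma inv_le_integral_abs : 1 / thirdMoment μ ≤ ∫ x, |x| ∂μ := by
  set L := thirdMoment μ with hL_def
  have hL : 0 < L := zero_lt_one.trans_le (IsStdLaw.one_le_thirdMoment μ)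
  have hamgm : ∀ x : ℝ, x ^ 2 ≤ L / 2 * |x| + 1 / (2 * L) * |x| ^ 3 := fun x => by
    have hsq : L / 2 * |x| + 1 / (2 * L) * |x| ^ 3 - |x| ^ 2
        = |x| * (L - |x|) ^ 2 / (2 * L) := by field_simp; ring
    have hnonneg : 0 ≤ |x| * (L - |x|) ^ 2 / (2 * L) := by positivity
    rw [← sq_abs]
    linarith
  have hint := integral_mono (IsStdLaw.integrable_sq μ)
    (((IsStdLaw.integrable_abs μ).const_mul _).add (IsStdLaw.integrable_cube.const_mul _)) hamgm
  rw [IsStdLaw.sq, integral_add' ((IsStdLaw.integrable_abs μ).const_mul _)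
    (IsStdLaw.integrable_cube.const_mul _), integral_const_mul, integral_const_mul,
    ← thirdMoment, ← hL_def, show 1 / (2 * L) * L = 1 / 2 by field_simp] at hint
  rw [div_le_iff₀ hL]
  linarith

lemma integral_abs_exitLaw_dirac_zero :
    ∫ w, |w| ∂exitLaw μ (Measure.dirac 0) 0 = (∫ x, |x| ∂μ) / 2 := by
  have hneg : (Iic (0 : ℝ)).indicator (fun w => |w|) = fun w => (|w| - w) / 2 := by
    ext w
    by_cases hw : w ∈ Iic 0
    · rw [indicator_of_mem hw, abs_of_nonpos hw]; ring
    · rw [indicator_of_notMem hw, abs_of_pos (not_le.1 hw)]; ring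
  rw [exitLaw, aliveLaw_zero, Measure.dirac_zero_conv, ← integral_indicator measurableSet_Iic,
    hneg, integral_div, integral_sub (IsStdLaw.integrable_abs μ) (IsStdLaw.integrable_id μ),
    IsStdLaw.mean, sub_zero]

lemma le_meanOvershoot_dirac {n : ℕ} (hn : 1 ≤ n) :
    1 / (2 * thirdMoment μ) ≤ meanOvershoot μ (Measure.dirac 0) n :=
  calc 1 / (2 * thirdMoment μ) = 1 / thirdMoment μ / 2 := by ring
    _ ≤ (∫ x, |x| ∂μ) / 2 := by gcongr; exact inv_le_integral_abs μ
    _ = ∫ w, |w| ∂exitLaw μ (Measure.dirac 0) 0 := (integral_abs_exitLaw_dirac_zero μ).symm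
    _ ≤ meanOvershoot μ (Measure.dirac 0) n :=
      Finset.single_le_sum (f := fun k => ∫ w, |w| ∂exitLaw μ (Measure.dirac 0) k)
        (fun k _ => integral_nonneg fun _ => abs_nonneg _) (Finset.mem_range.2 hn)

end Survival

/-! ### Time reversal -/

lemma measurable_measure_Ioc_sub (ρ : Measure ℝ) [SFinite ρ] (a : ℝ) :
    Measurable fun w => ρ (Ioc (w - a) w) := by
  have hfst : Measurable fun p : ℝ × ℝ => p.1 - a := by fun_prop
  have hset : MeasurableSet {p : ℝ × ℝ | p.2 ∈ Ioc (p.1 - a) p.1} :=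
    (measurableSet_lt hfst measurable_snd).inter (measurableSet_le measurable_snd measurable_fst)
  exact (measurable_measure_prodMk_left (ν := ρ) hset :)

lemma conv_Ioc (ρ μ : Measure ℝ) [SFinite μ] (a b : ℝ) :
    (ρ ∗ μ) (Ioc a b) = ∫⁻ x, μ (Ioc (a - x) (b - x)) ∂ρ := by
  rw [← lintegral_indicator_one measurableSet_Ioc,
    Measure.lintegral_conv (measurable_one.indicator measurableSet_Ioc)]
  refine lintegral_congr fun x => ?_
  rw [← lintegral_indicator_one measurableSet_Ioc, ← preimage_const_add_Ioc]
  rfl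

instance (μ : Measure ℝ) [IsProbabilityMeasure μ] : IsProbabilityMeasure μ.neg :=
  Measure.isProbabilityMeasure_map (by fun_prop)

instance (μ ν : Measure ℝ) [IsFiniteMeasure μ] [IsFiniteMeasure ν] :
    IsFiniteMeasure (killedStep μ ν) := by
  unfold killedStep; infer_instance

lemma lintegral_killedStep_Ioc_le (μ ρ ν : Measure ℝ) [SFinite μ] [SFinite ρ]
    (hρ : ρ (Iic 0) = 0) (a : ℝ) :
    ∫⁻ w, killedStep μ ρ (Ioc (w - a) w) ∂ν ≤ ∫⁻ w, ρ (Ioc (w - a) w) ∂killedStep μ.neg ν := by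
  have hmeas := measurable_measure_Ioc_sub ρ a
  have hind : (Ioi (0 : ℝ)).indicator (fun w => ρ (Ioc (w - a) w))
      = fun w => ρ (Ioc (w - a) w) := by
    refine indicator_eq_self.2 fun w hw => mem_Ioi.2 (not_le.1 fun hw0 => hw ?_)
    exact measure_mono_null (fun u hu => hu.2.trans hw0) hρ
  rw [killedStep, killedStep, ← lintegral_indicator measurableSet_Ioi, hind,
    Measure.lintegral_conv hmeas]
  refine lintegral_mono fun w => (Measure.restrict_apply_le _ _).trans ?_
  have hmeas_add : Measurable fun y => ρ (Ioc (w + y - a) (w + y)) :=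
    hmeas.comp (measurable_const_add w)
  rw [Measure.conv_comm, conv_Ioc, Measure.neg, lintegral_map hmeas_add measurable_neg]
  exact le_of_eq (lintegral_congr fun x => by rw [← sub_eq_add_neg, sub_right_comm])

-- Reading the excursion backwards from its last step `x`, the walk starts at `|x|`, stays positive,
-- and ends within distance `|x|` of a point distributed according to `ρ`.
lemma lintegral_exitLaw_le_reversed (μ ρ : Measure ℝ) [IsProbabilityMeasure μ] [IsFiniteMeasure ρ]
    (hρ : ρ (Iic 0) = 0) {φ : ℝ → ENNReal} (hφ : Monotone φ) (j : ℕ) :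
    ∫⁻ w, φ |w| ∂exitLaw μ ρ j ≤ ∫⁻ x, φ |x| * ∫⁻ w, ρ (Ioc (w - |x|) w)
        ∂aliveLaw μ.neg (Measure.dirac |x|) j ∂μ := by
  induction j generalizing ρ with
  | zero =>
    have hexit := sum_lintegral_exitLaw_le μ (measure_mono_null Iio_subset_Iic_self hρ) hφ 1
    simp only [Finset.range_one, Finset.sum_singleton, aliveLaw_zero] at hexit
    refine hexit.trans (lintegral_mono fun x => mul_le_mul' le_rfl ?_)
    rw [aliveLaw_zero, lintegral_dirac' _ (measurable_measure_Ioc_sub ρ _), sub_self]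
    calc ρ (Icc 0 |x|) ≤ ρ (Iic 0 ∪ Ioc 0 |x|) := measure_mono fun u hu =>
          (le_or_gt u 0).imp id fun hu0 => ⟨hu0, hu.2⟩
      _ ≤ ρ (Iic 0) + ρ (Ioc 0 |x|) := measure_union_le _ _
      _ = ρ (Ioc 0 |x|) := by rw [hρ, zero_add]
  | succ j ih =>
    rw [add_comm j 1, exitLaw_add]
    refine (ih (killedStep μ ρ) (aliveLaw_succ_Iic μ ρ 0)).trans (lintegral_mono fun x =>
      mul_le_mul' le_rfl ((lintegral_killedStep_Ioc_le μ ρ _ hρ |x|).trans (le_of_eq ?_)))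
    rw [add_comm 1 j, aliveLaw_succ, killedStep]

section LocalBound

variable (μ : Measure ℝ) [IsStdLaw μ] {ν : Measure ℝ} [IsFiniteMeasure ν]

lemma aliveLaw_Ioc_le {i : ℕ} (hi : 1 ≤ i) {a b : ℝ} (hab : a ≤ b) :
    aliveLaw μ ν i (Ioc a b)
      ≤ ENNReal.ofReal ((b - a + 2 * beConst * thirdMoment μ) / √i * ν.real univ) := by
  have hK : 1 ≤ beConst := one_le_beConst
  have hL : 1 ≤ thirdMoment μ := IsStdLaw.one_le_thirdMoment μ
  have hnonneg : 0 ≤ (b - a + 2 * beConst * thirdMoment μ) / √i :=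
    div_nonneg (by nlinarith) (Real.sqrt_nonneg _)
  calc aliveLaw μ ν i (Ioc a b) ≤ (ν ∗ convPow μ i) (Ioc a b) := by
        rw [← aliveLaw_add_sum_exitLaw_conv]
        exact Measure.le_add_right le_rfl _
    _ = ∫⁻ u, convPow μ i (Ioc (a - u) (b - u)) ∂ν := conv_Ioc _ _ _ _
    _ ≤ ∫⁻ _, ENNReal.ofReal ((b - a + 2 * beConst * thirdMoment μ) / √i) ∂ν :=
        lintegral_mono fun u => by
          have hloc := convPow_real_Ioc_le μ hi (a := a - u) (b := b - u) (by linarith)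
          rw [sub_sub_sub_cancel_right] at hloc
          rw [← ofReal_measureReal]
          exact ENNReal.ofReal_le_ofReal hloc
    _ = _ := by
        rw [lintegral_const, ← ofReal_measureReal, ENNReal.ofReal_mul hnonneg]

lemma lintegral_aliveLaw_Ioc_reversed_le {i : ℕ} (hi : 1 ≤ i) (j : ℕ) {u : ℝ} (hu : 0 ≤ u) :
    ∫⁻ w, aliveLaw μ ν i (Ioc (w - u) w) ∂aliveLaw μ.neg (Measure.dirac u) j
      ≤ ENNReal.ofReal ((u + 2 * beConst * thirdMoment μ) / √i * ν.real univ
          * (3072 * beConst * (u + thirdMoment μ) / √(j + 1))) := by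
  have hK : 1 ≤ beConst := one_le_beConst
  have hL : 1 ≤ thirdMoment μ := IsStdLaw.one_le_thirdMoment μ
  rw [ENNReal.ofReal_mul (by positivity)]
  calc ∫⁻ w, aliveLaw μ ν i (Ioc (w - u) w) ∂aliveLaw μ.neg (Measure.dirac u) j
      ≤ ∫⁻ _, ENNReal.ofReal ((u + 2 * beConst * thirdMoment μ) / √i * ν.real univ)
          ∂aliveLaw μ.neg (Measure.dirac u) j := lintegral_mono fun w => by
        have hloc := aliveLaw_Ioc_le μ (ν := ν) hi (sub_le_self w hu)
        rwa [sub_sub_cancel] at hloc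
    _ ≤ _ := by
        rw [lintegral_const, ← ofReal_measureReal]
        gcongr
        simpa only [thirdMoment_neg] using aliveLaw_dirac_real_univ_le μ.neg hu j

lemma thirdMoment_le_cube : thirdMoment μ ≤ thirdMoment μ ^ 3 :=
  le_self_pow₀ (IsStdLaw.one_le_thirdMoment μ) three_ne_zero

lemma integral_four_mul_cube_add_le :
    ∫ x, 4 * (thirdMoment μ ^ 3 + |x| ^ 3) ∂μ ≤ 8 * thirdMoment μ ^ 3 := by
  rw [integral_const_mul, integral_add (integrable_const _) IsStdLaw.integrable_cube,
    ← thirdMoment, integral_const, probReal_univ, one_smul]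
  linarith [thirdMoment_le_cube μ]

-- The `i` steps before the reversal give the factor `1 / √i`, the `j` reversed ones `1 / √(j + 1)`.
lemma integral_exitLaw_add_le {i : ℕ} (hi : 1 ≤ i) (j : ℕ) (hν : Integrable (fun x => |x|) ν) :
    ∫ w, (thirdMoment μ + |w|) ∂exitLaw μ ν (i + j)
      ≤ 49152 * beConst ^ 2 * thirdMoment μ ^ 3 / (√i * √(j + 1)) * ν.real univ := by
  set K := beConst
  have hK : 1 ≤ K := one_le_beConst
  set L := thirdMoment μ
  have hL : 1 ≤ L := IsStdLaw.one_le_thirdMoment μ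
  set c := 6144 * K ^ 2 * ν.real univ / (√i * √(j + 1))
  have : 0 ≤ c := by positivity
  have hcube : Integrable (fun x => c * (4 * (L ^ 3 + |x| ^ 3))) μ :=
    (((integrable_const _).add IsStdLaw.integrable_cube).const_mul 4).const_mul c
  have hint : Integrable (fun w => L + |w|) (exitLaw μ ν (i + j)) :=
    (integrable_const _).add (integrable_abs_exitLaw μ hν _)
  have hweight : Monotone fun a => ENNReal.ofReal (L + a) := fun a b hab =>
    ENNReal.ofReal_le_ofReal (by linarith)
  have hstart : aliveLaw μ ν i (Iic 0) = 0 := by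
    rw [← Nat.sub_add_cancel hi]; exact aliveLaw_succ_Iic μ ν _
  have hpt : ∀ x : ℝ, (L + |x|) * ((|x| + 2 * K * L) / √i * ν.real univ
      * (3072 * K * (|x| + L) / √(j + 1))) ≤ c * (4 * (L ^ 3 + |x| ^ 3)) := fun x => by
    have hlin : |x| + 2 * K * L ≤ 2 * K * (|x| + L) := by nlinarith [abs_nonneg x]
    have hpow : (L + |x|) ^ 3 ≤ 4 * (L ^ 3 + |x| ^ 3) :=
      (add_pow_le (by linarith) (abs_nonneg x) 3).trans_eq (by norm_num)
    calc _ ≤ (L + |x|) * (2 * K * (|x| + L) / √i * ν.real univ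
          * (3072 * K * (|x| + L) / √(j + 1))) := by gcongr
      _ = c * (L + |x|) ^ 3 := by simp only [c]; field_simp; ring
      _ ≤ c * (4 * (L ^ 3 + |x| ^ 3)) := by gcongr
  have hreal : ∫ w, (L + |w|) ∂exitLaw μ ν (i + j) ≤ ∫ x, c * (4 * (L ^ 3 + |x| ^ 3)) ∂μ := by
    rw [← ENNReal.ofReal_le_ofReal_iff (integral_nonneg fun x => by positivity),
      ofReal_integral_eq_lintegral_ofReal hint (.of_forall fun _ => by positivity),
      ofReal_integral_eq_lintegral_ofReal hcube (.of_forall fun _ => by positivity), exitLaw_add]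
    refine (lintegral_exitLaw_le_reversed μ (aliveLaw μ ν i) hstart hweight j).trans
      (lintegral_mono fun x => ?_)
    refine (mul_le_mul' le_rfl (lintegral_aliveLaw_Ioc_reversed_le μ hi j (abs_nonneg x))).trans ?_
    rw [← ENNReal.ofReal_mul (by positivity)]
    exact ENNReal.ofReal_le_ofReal (hpt x)
  calc _ ≤ ∫ x, c * (4 * (L ^ 3 + |x| ^ 3)) ∂μ := hreal
    _ ≤ c * (8 * L ^ 3) := by
        rw [integral_const_mul]; gcongr; exact integral_four_mul_cube_add_le μ
    _ = _ := by simp only [c]; ring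

lemma sum_integral_exitLaw_le (hν : Integrable (fun x => |x|) ν) (hν0 : ν (Iio 0) = 0)
    (n : ℕ) :
    ∑ k ∈ Finset.range n, ∫ w, (thirdMoment μ + |w|) ∂exitLaw μ ν k
      ≤ 49 * thirdMoment μ * ν.real univ := by
  have hL : 1 ≤ thirdMoment μ := IsStdLaw.one_le_thirdMoment μ
  have hsplit : ∀ k, ∫ w, (thirdMoment μ + |w|) ∂exitLaw μ ν k
      = thirdMoment μ * (exitLaw μ ν k).real univ + ∫ w, |w| ∂exitLaw μ ν k := fun k => by
    rw [integral_add (integrable_const _) (integrable_abs_exitLaw μ hν k), integral_const,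
      smul_eq_mul, mul_comm]
  simp_rw [hsplit]
  rw [Finset.sum_add_distrib, ← Finset.mul_sum, ← meanOvershoot]
  nlinarith [sum_exitLaw_real_univ_le μ ν n, meanOvershoot_le μ hν hν0 n]

lemma integral_exitLaw_le (hν : Integrable (fun x => |x|) ν) (hν0 : ν (Iio 0) = 0) (k : ℕ) :
    ∫ w, (thirdMoment μ + |w|) ∂exitLaw μ ν k
      ≤ 196608 * beConst ^ 2 * thirdMoment μ ^ 3 / (k + 1) * ν.real univ := by
  have hK : 1 ≤ beConst := one_le_beConst
  have hL : 1 ≤ thirdMoment μ := IsStdLaw.one_le_thirdMoment μ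
  rcases Nat.eq_zero_or_pos k with rfl | hk
  · have hfirst := sum_integral_exitLaw_le μ hν hν0 1
    rw [Finset.range_one, Finset.sum_singleton] at hfirst
    refine hfirst.trans (mul_le_mul_of_nonneg_right ?_ measureReal_nonneg)
    rw [Nat.cast_zero, zero_add, div_one]
    nlinarith [thirdMoment_le_cube μ, one_le_pow₀ hK (n := 2)]
  · obtain ⟨i, j, hi, rfl, hki, hkj⟩ : ∃ i j, 1 ≤ i ∧ k = i + j ∧ k + 1 ≤ 4 * i
        ∧ k + 1 ≤ 4 * (j + 1) :=
      ⟨(k + 1) / 2, k - (k + 1) / 2, by omega, by omega, by omega, by omega⟩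
    have hi' : ((i + j : ℕ) : ℝ) + 1 ≤ 4 * i := mod_cast hki
    have hj' : ((i + j : ℕ) : ℝ) + 1 ≤ 4 * (j + 1) := mod_cast hkj
    have hsqrt : (((i + j : ℕ) : ℝ) + 1) / 4 ≤ √i * √(j + 1) := by
      rw [← Real.sqrt_mul (by positivity)]
      apply Real.le_sqrt_of_sq_le
      nlinarith
    refine (integral_exitLaw_add_le μ hi j hν).trans ?_
    gcongr ?_ * _
    calc _ ≤ 49152 * beConst ^ 2 * thirdMoment μ ^ 3 / ((((i + j : ℕ) : ℝ) + 1) / 4) := by gcongr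
      _ = _ := by field_simp; ring

end LocalBound

/-! ### The reflection principle -/

/-- The probability that Brownian motion started from `y`, killed at `0`, is above `z` at the time
`s ^ 2`. -/
noncomputable def killedHeat (z s y : ℝ) : ℝ := scaledCdf s (y - z) - scaledCdf s (-z - y)

lemma continuous_scaledCdf (s : ℝ) : Continuous (scaledCdf s) :=
  continuous_iff_continuousAt.2 fun y => (hasDerivAt_scaledCdf s y).continuousAt

lemma integrable_killedHeat (z s : ℝ) (ν : Measure ℝ) [IsFiniteMeasure ν] :
    Integrable (killedHeat z s) ν := by
  have hcont := continuous_scaledCdf s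
  have hint : ∀ {g : ℝ → ℝ}, Continuous g → Integrable (fun y => scaledCdf s (g y)) ν :=
    fun hg => (integrable_const (1 : ℝ)).mono' (hcont.comp hg).aestronglyMeasurable
      (.of_forall fun _ => abs_scaledCdf_le _ _)
  exact (hint (by fun_prop)).sub (hint (by fun_prop))

/-- The discrete counterpart of `killedHeat`: for the free walk started from `y`, the probability
of being at or above `z` after `j` steps, minus the probability of being at or below `-z`. -/
noncomputable def imageKernel (μ : Measure ℝ) (j : ℕ) (z y : ℝ) : ℝ :=
  (convPow μ j).real (Ici (z - y)) - (convPow μ j).real (Iic (-z - y))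

section

variable (μ : Measure ℝ) [IsProbabilityMeasure μ]

lemma integrable_imageKernel (j : ℕ) (z : ℝ) (ρ : Measure ℝ) [IsFiniteMeasure ρ] :
    Integrable (imageKernel μ j z) ρ :=
  (integrable_real_Ici_const_sub _ _ z).sub (integrable_real_Iic_const_sub _ _ (-z))

lemma conv_convPow_real_Ici_sub_Iic (ρ : Measure ℝ) [IsFiniteMeasure ρ] (j : ℕ) (z : ℝ) :
    (ρ ∗ convPow μ j).real (Ici z) - (ρ ∗ convPow μ j).real (Iic (-z))
      = ∫ y, imageKernel μ j z y ∂ρ := by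
  rw [conv_real_Ici, conv_real_Iic, ← integral_sub (integrable_real_Ici_const_sub _ _ z)
    (integrable_real_Iic_const_sub _ _ (-z))]
  rfl

lemma abs_imageKernel_le_one (j : ℕ) (z y : ℝ) : |imageKernel μ j z y| ≤ 1 :=
  abs_sub_le_iff.2 ⟨(sub_le_self _ measureReal_nonneg).trans measureReal_le_one,
    (sub_le_self _ measureReal_nonneg).trans measureReal_le_one⟩

-- The killed walk never meets `Iic (-z)`, so subtracting the two decompositions by the exit time
-- leaves only differences of probabilities for the free walk.
lemma aliveLaw_real_Ici_eq (ν : Measure ℝ) [IsFiniteMeasure ν] {m : ℕ} (hm : 1 ≤ m) {z : ℝ}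
    (hz : 0 ≤ z) :
    (aliveLaw μ ν m).real (Ici z) = ∫ y, imageKernel μ m z y ∂ν
      - ∑ k ∈ Finset.range m, ∫ w, imageKernel μ (m - 1 - k) z w ∂exitLaw μ ν k := by
  have hIic : (aliveLaw μ ν m).real (Iic (-z)) = 0 := by
    obtain ⟨m, rfl⟩ := Nat.exists_eq_add_of_le' hm
    rw [measureReal_def, measure_mono_null (Iic_subset_Iic.2 (neg_nonpos.2 hz))
      (aliveLaw_succ_Iic μ ν m), ENNReal.toReal_zero]
  simp only [← conv_convPow_real_Ici_sub_Iic, Finset.sum_sub_distrib]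
  linarith [aliveLaw_real_add_sum μ ν m (Ici z), aliveLaw_real_add_sum μ ν m (Iic (-z))]

end

lemma sum_inv_sqrt_le (m : ℕ) : ∑ k ∈ Finset.range m, 1 / √((m - k : ℕ) : ℝ) ≤ 2 * √m := by
  have hstep : ∀ n : ℕ, 1 / √((n : ℝ) + 1) ≤ 2 * √((n : ℝ) + 1) - 2 * √n := fun n => by
    rw [div_le_iff₀ (by positivity)]
    nlinarith [sq_nonneg (√((n : ℝ) + 1) - √n), Real.sq_sqrt (n.cast_nonneg (α := ℝ)),
      Real.sq_sqrt (by positivity : (0 : ℝ) ≤ n + 1)]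
  have hsum : ∀ n : ℕ, ∑ k ∈ Finset.range n, 1 / √((k : ℝ) + 1) ≤ 2 * √n := fun n => by
    induction n with
    | zero => simp
    | succ n ih =>
      rw [Finset.sum_range_succ]
      push_cast
      linarith [hstep n]
  refine le_trans (le_of_eq ?_) (hsum m)
  rw [← Finset.sum_range_reflect]
  refine Finset.sum_congr rfl fun k hk => ?_
  rw [show m - (m - 1 - k) = k + 1 by have := Finset.mem_range.1 hk; omega, Nat.cast_add_one]

section ReflectionPrinciple

variable (μ : Measure ℝ) [IsStdLaw μ] {ν : Measure ℝ} [IsFiniteMeasure ν]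

lemma abs_imageKernel_le (j : ℕ) (z w : ℝ) :
    |imageKernel μ j z w| ≤ 4 * beConst * (thirdMoment μ + |w|) / √(j + 1 : ℕ) := by
  have hK : 1 ≤ beConst := one_le_beConst
  have hL : 1 ≤ thirdMoment μ := IsStdLaw.one_le_thirdMoment μ
  rcases Nat.eq_zero_or_pos j with rfl | hj
  · rw [zero_add, Nat.cast_one, Real.sqrt_one, div_one]
    refine (abs_imageKernel_le_one μ 0 z w).trans ?_
    nlinarith [abs_nonneg w, one_le_mul_of_one_le_of_one_le hK hL]
  · have hq : 0 < √(j : ℝ) := by positivity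
    have hcdf : |stdCdf (-(z - w) / √j) - stdCdf ((-z - w) / √j)| ≤ 2 * |w| / √j := by
      refine (abs_stdCdf_sub_le _ _).trans_eq ?_
      rw [← sub_div, show -(z - w) - (-z - w) = 2 * w by ring, abs_div, abs_of_pos hq, abs_mul,
        abs_two]
    have hsqrt : √((j + 1 : ℕ) : ℝ) ≤ 2 * √(j : ℝ) := by
      have : (1 : ℝ) ≤ j := by exact_mod_cast hj
      refine Real.sqrt_le_iff.2 ⟨by positivity, ?_⟩
      rw [mul_pow, Real.sq_sqrt (by positivity)]; push_cast; linarith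
    calc |imageKernel μ j z w|
        ≤ 2 * (beConst * thirdMoment μ / √j) + 2 * |w| / √j := by
          have hup := abs_le.1 (berryEsseen_Ici μ hj (z - w))
          have hlow := abs_le.1 (berryEsseen_Iic μ hj (-z - w))
          have hmid := abs_le.1 hcdf
          exact abs_le.2 ⟨by rw [imageKernel]; linarith, by rw [imageKernel]; linarith⟩
      _ = 4 * (beConst * thirdMoment μ + |w|) / (2 * √(j : ℝ)) := by field_simp; ring
      _ ≤ 4 * (beConst * thirdMoment μ + beConst * |w|) / √((j + 1 : ℕ) : ℝ) := by
          gcongr; exact le_mul_of_one_le_left (abs_nonneg w) hK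
      _ = _ := by ring

lemma abs_integral_imageKernel_sub_killedHeat_le {m : ℕ} (hm : 1 ≤ m) (z : ℝ) :
    |∫ y, imageKernel μ m z y ∂ν - ∫ y, killedHeat z (√m) y ∂ν|
      ≤ 2 * (beConst * thirdMoment μ / √m) * ν.real univ := by
  rw [← integral_sub (integrable_imageKernel μ m z ν) (integrable_killedHeat z _ ν)]
  refine norm_integral_le_of_norm_le_const (G := ℝ) (μ := ν) (.of_forall fun y => ?_)
  have hup := abs_le.1 (berryEsseen_Ici μ hm (z - y))
  have hlow := abs_le.1 (berryEsseen_Iic μ hm (-z - y))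
  rw [neg_sub] at hup
  rw [Real.norm_eq_abs, imageKernel, killedHeat, scaledCdf, scaledCdf]
  exact abs_le.2 ⟨by linarith, by linarith⟩

lemma abs_integral_imageKernel_exitLaw_le (hν : Integrable (fun x => |x|) ν) (z : ℝ) {k m : ℕ}
    (hk : k < m) :
    |∫ w, imageKernel μ (m - 1 - k) z w ∂exitLaw μ ν k|
      ≤ 4 * beConst * ((∫ w, (thirdMoment μ + |w|) ∂exitLaw μ ν k) / √((m - k : ℕ) : ℝ)) := by
  have hint : Integrable (fun w => thirdMoment μ + |w|) (exitLaw μ ν k) :=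
    (integrable_const _).add (integrable_abs_exitLaw μ hν k)
  rw [← integral_div, ← integral_const_mul]
  refine norm_integral_le_of_norm_le (G := ℝ) ((hint.div_const _).const_mul _)
    (.of_forall fun w => ?_)
  have hpt := abs_imageKernel_le μ (m - 1 - k) z w
  rwa [show m - 1 - k + 1 = m - k by omega, mul_div_assoc] at hpt

-- For `2 * (k + 1) ≤ m` the factor `1 / √(m - k)` is of order `1 / √m`; otherwise the local bound
-- on the exit law makes the integral of order `1 / m`.
lemma integral_exitLaw_div_sqrt_le (hν : Integrable (fun x => |x|) ν) (hν0 : ν (Iio 0) = 0)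
    {k m : ℕ} (hk : k < m) :
    (∫ w, (thirdMoment μ + |w|) ∂exitLaw μ ν k) / √((m - k : ℕ) : ℝ)
      ≤ 2 / √m * (∫ w, (thirdMoment μ + |w|) ∂exitLaw μ ν k)
        + 393216 * beConst ^ 2 * thirdMoment μ ^ 3 * ν.real univ / m
          * (1 / √((m - k : ℕ) : ℝ)) := by
  have hK : 1 ≤ beConst := one_le_beConst
  have hL : 1 ≤ thirdMoment μ := IsStdLaw.one_le_thirdMoment μ
  have hm : 0 < (m : ℝ) := by exact_mod_cast k.zero_le.trans_lt hk
  have : 0 ≤ ∫ w, (thirdMoment μ + |w|) ∂exitLaw μ ν k := integral_nonneg fun _ => by positivity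
  rcases le_or_gt (2 * (k + 1)) m with hkm | hkm
  · refine le_add_of_le_of_nonneg ?_ (by positivity)
    have hsqrt : √(m : ℝ) / 2 ≤ √((m - k : ℕ) : ℝ) := by
      have : (2 * (k + 1) : ℝ) ≤ m := by exact_mod_cast hkm
      apply Real.le_sqrt_of_sq_le
      rw [div_pow, Real.sq_sqrt hm.le, Nat.cast_sub hk.le]
      linarith
    calc _ ≤ (∫ w, (thirdMoment μ + |w|) ∂exitLaw μ ν k) / (√(m : ℝ) / 2) := by gcongr
      _ = _ := by field_simp
  · refine le_add_of_nonneg_of_le (by positivity) ?_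
    have hmk : (m : ℝ) / 2 ≤ k + 1 := by
      have : (m : ℝ) ≤ 2 * (k + 1) := by exact_mod_cast hkm.le
      linarith
    rw [mul_one_div]
    gcongr
    calc _ ≤ 196608 * beConst ^ 2 * thirdMoment μ ^ 3 / (k + 1) * ν.real univ :=
          integral_exitLaw_le μ hν hν0 k
      _ ≤ 196608 * beConst ^ 2 * thirdMoment μ ^ 3 / (m / 2) * ν.real univ := by gcongr
      _ = _ := by field_simp; ring

lemma abs_sum_integral_imageKernel_exitLaw_le (hν : Integrable (fun x => |x|) ν)
    (hν0 : ν (Iio 0) = 0) (m : ℕ) (z : ℝ) :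
    |∑ k ∈ Finset.range m, ∫ w, imageKernel μ (m - 1 - k) z w ∂exitLaw μ ν k|
      ≤ 4 * beConst * (2 / √m * (49 * thirdMoment μ * ν.real univ)
        + 393216 * beConst ^ 2 * thirdMoment μ ^ 3 * ν.real univ / m * (2 * √m)) := by
  have hK : 1 ≤ beConst := one_le_beConst
  have hL : 1 ≤ thirdMoment μ := IsStdLaw.one_le_thirdMoment μ
  calc _ ≤ ∑ k ∈ Finset.range m, 4 * beConst * (2 / √m
            * (∫ w, (thirdMoment μ + |w|) ∂exitLaw μ ν k)
          + 393216 * beConst ^ 2 * thirdMoment μ ^ 3 * ν.real univ / m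
            * (1 / √((m - k : ℕ) : ℝ))) := by
        refine (Finset.abs_sum_le_sum_abs _ _).trans (Finset.sum_le_sum fun k hk => ?_)
        refine (abs_integral_imageKernel_exitLaw_le μ hν z (Finset.mem_range.1 hk)).trans ?_
        gcongr
        exact integral_exitLaw_div_sqrt_le μ hν hν0 (Finset.mem_range.1 hk)
    _ ≤ _ := by
        rw [← Finset.mul_sum, Finset.sum_add_distrib, ← Finset.mul_sum, ← Finset.mul_sum]
        gcongr
        · exact sum_integral_exitLaw_le μ hν hν0 m
        · exact sum_inv_sqrt_le m

lemma abs_aliveLaw_real_Ici_sub_le (hν : Integrable (fun x => |x|) ν) (hν0 : ν (Iio 0) = 0)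
    {m : ℕ} (hm : 1 ≤ m) {z : ℝ} (hz : 0 ≤ z) :
    |(aliveLaw μ ν m).real (Ici z) - ∫ y, killedHeat z (√m) y ∂ν|
      ≤ 4000000 * beConst ^ 3 * thirdMoment μ ^ 3 / √m * ν.real univ := by
  set K := beConst
  have hK : 1 ≤ K := one_le_beConst
  set L := thirdMoment μ
  have hL : 1 ≤ L := IsStdLaw.one_le_thirdMoment μ
  set M := ν.real univ
  have : 0 ≤ M := measureReal_nonneg
  set q := √(m : ℝ)
  have hq : 0 < q := by positivity
  have hmain := abs_le.1 (abs_integral_imageKernel_sub_killedHeat_le μ (ν := ν) hm z)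
  have hexit := abs_le.1 (abs_sum_integral_imageKernel_exitLaw_le μ hν hν0 m z)
  have hKL : K * L ≤ K ^ 3 * L ^ 3 := by
    rw [← mul_pow]
    exact le_self_pow₀ (one_le_mul_of_one_le_of_one_le hK hL) three_ne_zero
  have htotal : 2 * (K * L / q) * M
      + 4 * K * (2 / q * (49 * L * M) + 393216 * K ^ 2 * L ^ 3 * M / m * (2 * q))
        ≤ 4000000 * K ^ 3 * L ^ 3 / q * M := by
    calc _ = (394 * (K * L) + 3145728 * (K ^ 3 * L ^ 3)) / q * M := by
          rw [← Real.sq_sqrt m.cast_nonneg]; field_simp; ring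
      _ ≤ _ := by
          gcongr
          linarith [show 0 ≤ K ^ 3 * L ^ 3 by positivity]
  rw [aliveLaw_real_Ici_eq μ ν hm hz]
  exact abs_le.2 ⟨by linarith, by linarith⟩

end ReflectionPrinciple

/-! ### The mean exit position of the walk started from the origin -/

lemma meanOvershoot_add (μ ν : Measure ℝ) (i j : ℕ) :
    meanOvershoot μ ν (i + j) = meanOvershoot μ ν i + meanOvershoot μ (aliveLaw μ ν i) j := by
  simp only [meanOvershoot, Finset.sum_range_add, exitLaw_add]

/-- The probability that the walk with step law `μ` started from the origin is positive at each of
the times `1, …, n`. -/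
noncomputable def survivalProb (μ : Measure ℝ) (n : ℕ) : ℝ :=
  (aliveLaw μ (Measure.dirac 0) n).real univ

/-- The modulus of the mean exit position of the walk started from the origin. -/
noncomputable def exitMean (μ : Measure ℝ) : ℝ :=
  ∑' k, ∫ w, |w| ∂exitLaw μ (Measure.dirac 0) k

lemma survivalProb_nonneg (μ : Measure ℝ) (n : ℕ) : 0 ≤ survivalProb μ n := measureReal_nonneg

section ExitMean

variable (μ : Measure ℝ) [IsStdLaw μ]

lemma summable_integral_abs_exitLaw :
    Summable fun k => ∫ w, |w| ∂exitLaw μ (Measure.dirac 0) k :=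
  summable_of_sum_range_le (fun _ => integral_nonneg fun _ => abs_nonneg _)
    (meanOvershoot_le μ (integrable_abs_dirac 0) (dirac_Iio_zero le_rfl))

lemma meanOvershoot_le_exitMean (n : ℕ) : meanOvershoot μ (Measure.dirac 0) n ≤ exitMean μ :=
  (summable_integral_abs_exitLaw μ).sum_le_tsum _ fun _ _ => integral_nonneg fun _ => abs_nonneg _

lemma meanOvershoot_sub_le {i m : ℕ} (h : i ≤ m) :
    meanOvershoot μ (Measure.dirac 0) m - meanOvershoot μ (Measure.dirac 0) i
      ≤ 48 * thirdMoment μ * survivalProb μ i := by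
  obtain ⟨j, rfl⟩ := Nat.exists_eq_add_of_le h
  rw [meanOvershoot_add, add_sub_cancel_left]
  exact meanOvershoot_le μ (integrable_abs_aliveLaw μ (integrable_abs_dirac 0) i)
    (aliveLaw_Iio μ (dirac_Iio_zero le_rfl) i) j

lemma exitMean_sub_le (m : ℕ) :
    exitMean μ - meanOvershoot μ (Measure.dirac 0) m
      ≤ 48 * thirdMoment μ * survivalProb μ m := by
  have hlim : Tendsto (meanOvershoot μ (Measure.dirac 0)) atTop (𝓝 (exitMean μ)) :=
    (summable_integral_abs_exitLaw μ).hasSum.tendsto_sum_nat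
  exact le_of_tendsto (hlim.sub_const _) (eventually_atTop.2 ⟨m, fun n => meanOvershoot_sub_le μ⟩)

lemma le_exitMean : 1 / (2 * thirdMoment μ) ≤ exitMean μ :=
  (le_meanOvershoot_dirac μ le_rfl).trans (meanOvershoot_le_exitMean μ 1)

lemma exitMean_pos : 0 < exitMean μ := by
  have hL : 1 ≤ thirdMoment μ := IsStdLaw.one_le_thirdMoment μ
  exact lt_of_lt_of_le (by positivity) (le_exitMean μ)

lemma survivalProb_le_exitMean_div {n : ℕ} (hn : 8 * beConst * thirdMoment μ ≤ √n) :
    survivalProb μ n ≤ 32 * exitMean μ / √n := by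
  refine (aliveLaw_dirac_real_univ_le_meanOvershoot μ le_rfl hn).trans ?_
  rw [zero_add]
  gcongr
  exact meanOvershoot_le_exitMean μ n

lemma survivalProb_le (n : ℕ) :
    survivalProb μ n ≤ 64 * beConst * thirdMoment μ ^ 2 * exitMean μ / √(n + 1) := by
  set K := beConst
  have hK : 1 ≤ K := one_le_beConst
  set L := thirdMoment μ
  have hL : 1 ≤ L := IsStdLaw.one_le_thirdMoment μ
  have hκ := exitMean_pos μ
  have hsqrt : √((n : ℝ) + 1) ≤ √n + 1 := Real.sqrt_le_iff.2 ⟨by positivity, by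
    nlinarith [Real.sq_sqrt (n.cast_nonneg (α := ℝ)), Real.sqrt_nonneg (n : ℝ)]⟩
  have hKL : 1 ≤ K * L := one_le_mul_of_one_le_of_one_le hK hL
  have hp : 0 ≤ survivalProb μ n := survivalProb_nonneg μ n
  rw [le_div_iff₀ (by positivity)]
  rcases le_or_gt (8 * K * L) √n with hlarge | hsmall
  · have hq : 0 < √(n : ℝ) := lt_of_lt_of_le (by positivity) hlarge
    calc _ ≤ survivalProb μ n * (2 * √n) := by gcongr; linarith
      _ = 2 * (survivalProb μ n * √n) := by ring
      _ ≤ 2 * (32 * exitMean μ) := mul_le_mul_of_nonneg_left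
          ((le_div_iff₀ hq).1 (survivalProb_le_exitMean_div μ hlarge)) two_pos.le
      _ = 64 * 1 * exitMean μ := by ring
      _ ≤ 64 * (K * L ^ 2) * exitMean μ := by
          gcongr
          exact one_le_mul_of_one_le_of_one_le hK (one_le_pow₀ hL)
      _ = _ := by ring
  · have hκ' : 1 ≤ exitMean μ * (2 * L) := (div_le_iff₀ (by positivity)).1 (le_exitMean μ)
    calc _ ≤ 1 * (√n + 1) := by
          gcongr
          exact aliveLaw_dirac_real_univ_le_one μ 0 n
      _ ≤ 9 * (K * L) * 1 := by linarith
      _ ≤ 9 * (K * L) * (exitMean μ * (2 * L)) := by gcongr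
      _ = 18 * K * L ^ 2 * exitMean μ := by ring
      _ ≤ _ := by gcongr; norm_num

lemma sum_survivalProb_le (m : ℕ) :
    ∑ k ∈ Finset.range m, survivalProb μ k
      ≤ 128 * beConst * thirdMoment μ ^ 2 * exitMean μ * √m := by
  have hK := one_le_beConst
  have hκ := exitMean_pos μ
  calc _ ≤ ∑ k ∈ Finset.range m, 64 * beConst * thirdMoment μ ^ 2 * exitMean μ
        * (1 / √((m - (m - 1 - k) : ℕ) : ℝ)) := by
        refine Finset.sum_le_sum fun k hk => ?_
        rw [Finset.mem_range] at hk
        rw [show m - (m - 1 - k) = k + 1 by omega, mul_one_div]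
        push_cast
        exact survivalProb_le μ k
    _ = 64 * beConst * thirdMoment μ ^ 2 * exitMean μ
        * ∑ k ∈ Finset.range m, 1 / √((m - k : ℕ) : ℝ) := by
        rw [← Finset.mul_sum, Finset.sum_range_reflect (fun k => 1 / √((m - k : ℕ) : ℝ))]
    _ ≤ 64 * beConst * thirdMoment μ ^ 2 * exitMean μ * (2 * √m) := by
        gcongr
        exact sum_inv_sqrt_le m
    _ = _ := by ring

lemma integrable_sq_exitLaw_dirac (k : ℕ) :
    Integrable (fun w : ℝ => w ^ 2) (exitLaw μ (Measure.dirac 0) k) := by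
  refine ⟨by fun_prop, ?_⟩
  rw [hasFiniteIntegral_iff_ofReal (.of_forall fun w => sq_nonneg w)]
  calc _ ≤ ∑ j ∈ Finset.range (k + 1),
        ∫⁻ w, ENNReal.ofReal (w ^ 2) ∂exitLaw μ (Measure.dirac 0) j :=
        Finset.single_le_sum
          (f := fun j => ∫⁻ w, ENNReal.ofReal (w ^ 2) ∂exitLaw μ (Measure.dirac 0) j)
          (fun _ _ => zero_le) (Finset.self_mem_range_succ k)
    _ ≤ _ := sum_lintegral_sq_exitLaw_dirac_le μ (k + 1)
    _ < ⊤ := ENNReal.ofReal_lt_top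

lemma sum_integral_sq_exitLaw_dirac_le (n : ℕ) :
    ∑ k ∈ Finset.range n, ∫ w, w ^ 2 ∂exitLaw μ (Measure.dirac 0) k
      ≤ 20 * thirdMoment μ * exitMean μ := by
  have hL := IsStdLaw.one_le_thirdMoment μ
  have h := sum_lintegral_sq_exitLaw_dirac_le μ n
  simp_rw [← ofReal_integral_eq_lintegral_ofReal (integrable_sq_exitLaw_dirac μ _)
    (.of_forall fun w => sq_nonneg w)] at h
  rw [← ENNReal.ofReal_sum_of_nonneg fun _ _ => integral_nonneg fun _ => sq_nonneg _,
    ENNReal.ofReal_le_ofReal_iff (mul_nonneg (by positivity) (meanOvershoot_nonneg μ _ n))] at h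
  refine h.trans ?_
  gcongr
  exact meanOvershoot_le_exitMean μ n

end ExitMean

lemma sum_range_succ_mul_eq_sum_sub {R : Type*} [CommRing R] (e : ℕ → R) (m : ℕ) :
    ∑ k ∈ Finset.range m, ((k : R) + 1) * e k
      = ∑ i ∈ Finset.range m, (∑ k ∈ Finset.range m, e k - ∑ k ∈ Finset.range i, e k) := by
  induction m with
  | zero => simp
  | succ m ih =>
    rw [Finset.sum_range_succ, ih]
    simp only [Finset.sum_sub_distrib, Finset.sum_const, Finset.card_range, nsmul_eq_mul,
      Finset.sum_range_succ]
    push_cast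
    ring

lemma sum_succ_mul_integral_abs_exitLaw_le (μ : Measure ℝ) [IsStdLaw μ] (m : ℕ) :
    ∑ k ∈ Finset.range m, ((k : ℝ) + 1) * ∫ w, |w| ∂exitLaw μ (Measure.dirac 0) k
      ≤ 48 * thirdMoment μ * ∑ k ∈ Finset.range m, survivalProb μ k := by
  rw [sum_range_succ_mul_eq_sum_sub, Finset.mul_sum]
  exact Finset.sum_le_sum fun i hi => meanOvershoot_sub_le μ (Finset.mem_range.1 hi).le

/-! ### The killed heat semigroup -/

/-- The first derivative of `killedHeat` in the starting point. -/
noncomputable def killedHeat₁ (z s y : ℝ) : ℝ := scaledCdf₁ s (y - z) + scaledCdf₁ s (-z - y)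

/-- The second derivative of `killedHeat` in the starting point. -/
noncomputable def killedHeat₂ (z s y : ℝ) : ℝ := scaledCdf₂ s (y - z) - scaledCdf₂ s (-z - y)

/-- The third derivative of `killedHeat` in the starting point. -/
noncomputable def killedHeat₃ (z s y : ℝ) : ℝ := scaledCdf₃ s (y - z) + scaledCdf₃ s (-z - y)

section KilledHeat

variable {s : ℝ} (z : ℝ)

lemma killedHeat_zero : killedHeat z s 0 = 0 := by simp [killedHeat]

lemma hasDerivAt_killedHeat (y : ℝ) : HasDerivAt (killedHeat z s) (killedHeat₁ z s y) y :=
  (((hasDerivAt_scaledCdf s (y - z)).comp_sub_const y z).sub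
    ((hasDerivAt_scaledCdf s (-z - y)).comp_const_sub (-z) y)).congr_deriv (sub_neg_eq_add _ _)

lemma hasDerivAt_killedHeat₁ (hs : 0 < s) (y : ℝ) :
    HasDerivAt (killedHeat₁ z s) (killedHeat₂ z s y) y :=
  (((hasDerivAt_scaledCdf₁ hs (y - z)).comp_sub_const y z).add
    ((hasDerivAt_scaledCdf₁ hs (-z - y)).comp_const_sub (-z) y)).congr_deriv
      (sub_eq_add_neg _ _).symm

lemma hasDerivAt_killedHeat₂ (hs : 0 < s) (y : ℝ) :
    HasDerivAt (killedHeat₂ z s) (killedHeat₃ z s y) y :=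
  (((hasDerivAt_scaledCdf₂ hs (y - z)).comp_sub_const y z).sub
    ((hasDerivAt_scaledCdf₂ hs (-z - y)).comp_const_sub (-z) y)).congr_deriv (sub_neg_eq_add _ _)

lemma continuous_killedHeat : Continuous (killedHeat z s) :=
  continuous_iff_continuousAt.2 fun y => (hasDerivAt_killedHeat z y).continuousAt

lemma abs_killedHeat₂_le (hs : 0 < s) (y : ℝ) : |killedHeat₂ z s y| ≤ 2 / s ^ 2 :=
  calc _ ≤ |scaledCdf₂ s (y - z)| + |scaledCdf₂ s (-z - y)| := abs_sub _ _
    _ ≤ 1 / s ^ 2 + 1 / s ^ 2 := add_le_add (abs_scaledCdf₂_le hs _) (abs_scaledCdf₂_le hs _)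
    _ = 2 / s ^ 2 := by ring

lemma abs_killedHeat₃_le (hs : 0 < s) (y : ℝ) : |killedHeat₃ z s y| ≤ 2 / s ^ 3 :=
  calc _ ≤ |scaledCdf₃ s (y - z)| + |scaledCdf₃ s (-z - y)| := abs_add_le _ _
    _ ≤ 1 / s ^ 3 + 1 / s ^ 3 := add_le_add (abs_scaledCdf₃_le hs _) (abs_scaledCdf₃_le hs _)
    _ = 2 / s ^ 3 := by ring

lemma killedHeat₁_zero : killedHeat₁ z s 0 = 2 * scaledCdf₁ s z := by
  have heven : scaledCdf₁ s (-z) = scaledCdf₁ s z := by simp [scaledCdf₁, stdPdf, neg_div]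
  rw [killedHeat₁, zero_sub, sub_zero, heven, two_mul]

lemma abs_killedHeat_sub_le (hs : 0 < s) (w : ℝ) :
    |killedHeat z s w - 2 * scaledCdf₁ s z * w| ≤ 2 / s ^ 2 * w ^ 2 := by
  have := abs_sub_taylor_one_le (hasDerivAt_killedHeat z) (hasDerivAt_killedHeat₁ z hs)
    (abs_killedHeat₂_le z hs) w
  rwa [killedHeat_zero, sub_zero, killedHeat₁_zero] at this

lemma integral_killedHeat_gaussianReal {v : NNReal} (hv : v ≠ 0) (w : NNReal) (a : ℝ) :
    ∫ x, killedHeat z (√v) (a + x) ∂gaussianReal 0 w = killedHeat z (√(v + w)) a := by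
  have hint : ∀ b, Integrable (fun x => scaledCdf (√v) (b - x)) (gaussianReal 0 w) := fun b =>
    (integrable_const (1 : ℝ)).mono'
      ((continuous_scaledCdf _).comp (continuous_const.sub continuous_id)).aestronglyMeasurable
      (.of_forall fun _ => abs_scaledCdf_le _ _)
  have hint' : Integrable (fun x => scaledCdf (√v) (a - z + x)) (gaussianReal 0 w) :=
    (integrable_const (1 : ℝ)).mono'
      ((continuous_scaledCdf _).comp (continuous_const_add _)).aestronglyMeasurable
      (.of_forall fun _ => abs_scaledCdf_le _ _)
  calc _ = ∫ x, (scaledCdf (√v) (a - z + x) - scaledCdf (√v) (-z - a - x)) ∂gaussianReal 0 w := by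
        refine integral_congr_ae (.of_forall fun x => ?_)
        simp only [killedHeat]
        ring_nf
    _ = ∫ x, scaledCdf (√v) (a - z - x) ∂gaussianReal 0 w
        - ∫ x, scaledCdf (√v) (-z - a - x) ∂gaussianReal 0 w := by
        rw [integral_sub hint' (hint _), ← integral_comp_neg_gaussianReal]
        simp only [← sub_eq_add_neg]
    _ = _ := by rw [integral_scaledCdf_gaussianReal hv, integral_scaledCdf_gaussianReal hv,
        killedHeat]

lemma abs_integral_killedHeat_sub_le (μ : Measure ℝ) [IsStdLaw μ] {t : ℝ} (ht : 0 < t) (w : ℝ) :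
    |∫ x, killedHeat z (√t) (w + x) ∂μ - killedHeat z (√(t + 1)) w|
      ≤ 2 / √t ^ 3 * (thirdMoment μ + thirdMoment (gaussianReal 0 1)) := by
  have hs : 0 < √t := Real.sqrt_pos.2 ht
  lift t to NNReal using ht.le
  rw [← NNReal.coe_one,
    ← integral_killedHeat_gaussianReal z (NNReal.coe_pos.1 ht).ne' 1 w]
  exact abs_integral_sub_integral_le_of_stdLaw μ (gaussianReal 0 1)
    (fun y => (hasDerivAt_killedHeat z (w + y)).comp_const_add w y)
    (fun y => (hasDerivAt_killedHeat₁ z hs (w + y)).comp_const_add w y)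
    (fun y => (hasDerivAt_killedHeat₂ z hs (w + y)).comp_const_add w y)
    fun y => abs_killedHeat₃_le z hs (w + y)

end KilledHeat

-- The heat equation for the Gaussian density `scaledCdf₁ (√t)` of variance `t`.
lemma hasDerivAt_scaledCdf₁_sqrt {t : ℝ} (ht : 0 < t) (z : ℝ) :
    HasDerivAt (fun t => scaledCdf₁ (√t) z) (scaledCdf₃ (√t) z / 2) t := by
  have hs : √t ≠ 0 := (Real.sqrt_pos.2 ht).ne'
  have hsqrt := Real.hasDerivAt_sqrt ht.ne'
  have hquot : HasDerivAt (fun t => z / √t) (-(z * (1 / (2 * √t))) / √t ^ 2) t :=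
    ((hasDerivAt_const t z).div hsqrt hs).congr_deriv (by simp)
  refine (((hasDerivAt_stdPdf (z / √t)).comp t hquot).div hsqrt hs).congr_deriv ?_
  simp only [scaledCdf₃, stdPdf₂, Function.comp_apply]
  field_simp

lemma abs_scaledCdf₁_sqrt_sub_le {t n : ℝ} (hn : 0 < n) (ht : n / 2 ≤ t) (htn : t ≤ n) (z : ℝ) :
    |scaledCdf₁ (√t) z - scaledCdf₁ (√n) z| ≤ 2 * (n - t) / (n * √n) := by
  have hbound : ∀ u ∈ Icc t n, ‖scaledCdf₃ (√u) z / 2‖ ≤ 2 / (n * √n) := fun u hu => by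
    have hnu : n ≤ 2 * u := by linarith [hu.1]
    have hu0 : 0 < u := by linarith
    have hsqrt : √n ≤ 2 * √u := Real.sqrt_le_iff.2 ⟨by positivity, by
      rw [mul_pow, Real.sq_sqrt hu0.le]; linarith⟩
    calc ‖scaledCdf₃ (√u) z / 2‖ = |scaledCdf₃ (√u) z| / 2 := by simp
      _ ≤ 1 / √u ^ 3 / 2 := by gcongr; exact abs_scaledCdf₃_le (Real.sqrt_pos.2 hu0) z
      _ = 2 / (2 * u * (2 * √u)) := by
          rw [pow_succ, Real.sq_sqrt hu0.le]; field_simp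
      _ ≤ 2 / (n * √n) := by gcongr
  have hmvt := (convex_Icc t n).norm_image_sub_le_of_norm_hasDerivWithin_le
    (fun u hu => (hasDerivAt_scaledCdf₁_sqrt (by linarith [hu.1]) z).hasDerivWithinAt) hbound
    (right_mem_Icc.2 htn) (left_mem_Icc.2 htn)
  calc _ ≤ 2 / (n * √n) * ‖t - n‖ := hmvt
    _ = _ := by
      rw [Real.norm_eq_abs, abs_sub_comm, abs_of_nonneg (sub_nonneg.2 htn)]
      ring

/-! ### The asymptotics of the walk killed at the origin -/

lemma abs_integral_killedHeat_conv_sub_le (μ ν : Measure ℝ) [IsStdLaw μ] [IsFiniteMeasure ν]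
    (z : ℝ) {t : ℝ} (ht : 0 < t) :
    |∫ w, killedHeat z (√t) w ∂(ν ∗ μ) - ∫ w, killedHeat z (√(t + 1)) w ∂ν|
      ≤ 2 / √t ^ 3 * (thirdMoment μ + thirdMoment (gaussianReal 0 1)) * ν.real univ := by
  have hprod : Integrable (fun p : ℝ × ℝ => killedHeat z (√t) (p.1 + p.2)) (ν.prod μ) :=
    (integrable_map_measure (continuous_killedHeat z).aestronglyMeasurable (by fun_prop)).1
      (integrable_killedHeat z (√t) (ν ∗ μ))
  rw [integral_conv (integrable_killedHeat z (√t) _),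
    ← integral_sub hprod.integral_prod_left (integrable_killedHeat z _ ν)]
  exact norm_integral_le_of_norm_le_const (G := ℝ) (μ := ν)
    (.of_forall fun w => abs_integral_killedHeat_sub_le z μ ht w)

lemma abs_integral_killedHeat_sub_integral_le {ρ : Measure ℝ} [IsFiniteMeasure ρ]
    (hid : Integrable (fun w : ℝ => w) ρ) (hsq : Integrable (fun w : ℝ => w ^ 2) ρ) (z : ℝ)
    {s : ℝ} (hs : 0 < s) :
    |∫ w, killedHeat z s w ∂ρ - 2 * scaledCdf₁ s z * ∫ w, w ∂ρ| ≤ 2 / s ^ 2 * ∫ w, w ^ 2 ∂ρ := by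
  rw [← integral_const_mul, ← integral_sub (integrable_killedHeat z s ρ) (hid.const_mul _),
    ← integral_const_mul]
  exact norm_integral_le_of_norm_le (G := ℝ) (hsq.const_mul _)
    (.of_forall fun w => abs_killedHeat_sub_le z hs w)

lemma two_div_sqrt_pow_three_le {n t : ℝ} (hn : 0 < n) (hnt : n ≤ 2 * t) :
    2 / √t ^ 3 ≤ 6 / (n * √n) := by
  have ht : 0 < t := by linarith
  have hsqrt : 2 / 3 * √n ≤ √t := Real.le_sqrt_of_sq_le (by
    rw [mul_pow, Real.sq_sqrt hn.le]; linarith)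
  calc 2 / √t ^ 3 = 2 / (t * √t) := by rw [pow_succ, Real.sq_sqrt ht.le]
    _ ≤ 2 / (n / 2 * (2 / 3 * √n)) := by gcongr; linarith
    _ = 6 / (n * √n) := by field_simp; norm_num

section KilledAsymptotics

variable (μ : Measure ℝ) [IsStdLaw μ]

lemma abs_integral_killedHeat_aliveLaw_succ_sub_le (z : ℝ) (k : ℕ) {t : ℝ} (ht : 0 < t) :
    |∫ w, killedHeat z (√t) w ∂aliveLaw μ (Measure.dirac 0) (k + 1)
      - ∫ w, killedHeat z (√(t + 1)) w ∂aliveLaw μ (Measure.dirac 0) k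
      - 2 * scaledCdf₁ (√t) z * ∫ w, |w| ∂exitLaw μ (Measure.dirac 0) k|
    ≤ 2 / √t ^ 3 * (thirdMoment μ + thirdMoment (gaussianReal 0 1)) * survivalProb μ k
      + 2 / t * ∫ w, w ^ 2 ∂exitLaw μ (Measure.dirac 0) k := by
  have hid : Integrable (fun w : ℝ => w) (exitLaw μ (Measure.dirac 0) k) :=
    (integrable_abs_exitLaw μ (integrable_abs_dirac 0) k).mono' (by fun_prop)
      (.of_forall fun _ => le_rfl)
  have hdecomp : ∫ w, killedHeat z (√t) w ∂aliveLaw μ (Measure.dirac 0) (k + 1)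
      + ∫ w, killedHeat z (√t) w ∂exitLaw μ (Measure.dirac 0) k
        = ∫ w, killedHeat z (√t) w ∂(aliveLaw μ (Measure.dirac 0) k ∗ μ) :=
    have hint := integrable_killedHeat z (√t) (aliveLaw μ (Measure.dirac 0) k ∗ μ)
    (integral_aliveLaw_succ_add_exitLaw hint).trans (integral_conv hint).symm
  have hfree := abs_le.1
    (abs_integral_killedHeat_conv_sub_le μ (aliveLaw μ (Measure.dirac 0) k) z ht)
  have hexit := abs_integral_killedHeat_sub_integral_le hid (integrable_sq_exitLaw_dirac μ k) z
    (Real.sqrt_pos.2 ht)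
  rw [Real.sq_sqrt ht.le] at hexit
  have hexit := abs_le.1 hexit
  rw [integral_abs_exitLaw, survivalProb]
  exact abs_le.2 ⟨by linarith, by linarith⟩

lemma abs_integral_killedHeat_aliveLaw_increment_le (z : ℝ) {n : ℝ} {k : ℕ}
    (hk : 2 * ((k : ℝ) + 1) ≤ n) :
    |∫ w, killedHeat z (√(n - (k + 1))) w ∂aliveLaw μ (Measure.dirac 0) (k + 1)
      - ∫ w, killedHeat z (√(n - k)) w ∂aliveLaw μ (Measure.dirac 0) k
      - 2 * scaledCdf₁ (√n) z * ∫ w, |w| ∂exitLaw μ (Measure.dirac 0) k|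
    ≤ 6 * (thirdMoment μ + thirdMoment (gaussianReal 0 1)) / (n * √n) * survivalProb μ k
      + 4 / (n * √n) * ((k + 1) * ∫ w, |w| ∂exitLaw μ (Measure.dirac 0) k)
      + 4 / n * ∫ w, w ^ 2 ∂exitLaw μ (Measure.dirac 0) k := by
  have hM : 0 ≤ thirdMoment μ + thirdMoment (gaussianReal 0 1) := by
    linarith [IsStdLaw.one_le_thirdMoment μ, IsStdLaw.one_le_thirdMoment (gaussianReal 0 1)]
  set e := ∫ w, |w| ∂exitLaw μ (Measure.dirac 0) k
  have he : 0 ≤ e := integral_nonneg fun _ => abs_nonneg _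
  have hr : 0 ≤ ∫ w, w ^ 2 ∂exitLaw μ (Measure.dirac 0) k := integral_nonneg fun _ => sq_nonneg _
  have hp := survivalProb_nonneg μ k
  have hn : 0 < n := by linarith [k.cast_nonneg (α := ℝ)]
  obtain ⟨t, ht⟩ : ∃ t, t = n - (k + 1) := ⟨_, rfl⟩
  have hnt : n ≤ 2 * t := by linarith
  have ht0 : 0 < t := by linarith
  have hstep := abs_le.1 (abs_integral_killedHeat_aliveLaw_succ_sub_le μ z k ht0)
  rw [← ht, show n - k = t + 1 by rw [ht]; ring]
  have hfree : 2 / √t ^ 3 * (thirdMoment μ + thirdMoment (gaussianReal 0 1)) * survivalProb μ k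
      ≤ 6 * (thirdMoment μ + thirdMoment (gaussianReal 0 1)) / (n * √n) * survivalProb μ k := by
    rw [mul_div_right_comm]
    have := two_div_sqrt_pow_three_le hn hnt
    gcongr
  have hexit : 2 / t ≤ 4 / n := by rw [div_le_div_iff₀ ht0 hn]; linarith
  have hexit' := mul_le_mul_of_nonneg_right hexit hr
  have hdensity : |(2 * scaledCdf₁ (√t) z - 2 * scaledCdf₁ (√n) z) * e|
      ≤ 4 / (n * √n) * ((k + 1) * e) := by
    rw [← mul_sub, abs_mul, abs_mul, abs_two, abs_of_nonneg he]
    calc _ ≤ 2 * (2 * (n - t) / (n * √n)) * e := by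
          gcongr
          exact abs_scaledCdf₁_sqrt_sub_le hn (by linarith) (by linarith [k.cast_nonneg (α := ℝ)]) z
      _ = _ := by rw [ht]; ring
  have hdensity := abs_le.1 hdensity
  exact abs_le.2 ⟨by linarith, by linarith⟩

lemma abs_integral_killedHeat_aliveLaw_sub_sum_le (z : ℝ) {n m : ℕ} (hmn : 2 * m ≤ n) :
    |∫ w, killedHeat z (√((n : ℝ) - m)) w ∂aliveLaw μ (Measure.dirac 0) m
      - 2 * scaledCdf₁ (√n) z * meanOvershoot μ (Measure.dirac 0) m|
    ≤ 6 * (thirdMoment μ + thirdMoment (gaussianReal 0 1)) / (n * √n)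
        * ∑ k ∈ Finset.range m, survivalProb μ k
      + 4 / (n * √n)
        * ∑ k ∈ Finset.range m, ((k : ℝ) + 1) * ∫ w, |w| ∂exitLaw μ (Measure.dirac 0) k
      + 4 / n * ∑ k ∈ Finset.range m, ∫ w, w ^ 2 ∂exitLaw μ (Measure.dirac 0) k := by
  set H : ℕ → ℝ := fun k => ∫ w, killedHeat z (√((n : ℝ) - k)) w ∂aliveLaw μ (Measure.dirac 0) k
    with hH
  have hH0 : H 0 = 0 := by
    simp only [hH, aliveLaw_zero]
    rw [integral_dirac, killedHeat_zero]
  have htelescope : H m - 2 * scaledCdf₁ (√n) z * meanOvershoot μ (Measure.dirac 0) m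
      = ∑ k ∈ Finset.range m, (H (k + 1) - H k
        - 2 * scaledCdf₁ (√n) z * ∫ w, |w| ∂exitLaw μ (Measure.dirac 0) k) := by
    rw [Finset.sum_sub_distrib, Finset.sum_range_sub, hH0, sub_zero, ← Finset.mul_sum,
      meanOvershoot]
  change |H m - _| ≤ _
  rw [htelescope]
  simp only [Finset.mul_sum, ← Finset.sum_add_distrib]
  refine (Finset.abs_sum_le_sum_abs _ _).trans (Finset.sum_le_sum fun k hk => ?_)
  have hkn : 2 * ((k : ℝ) + 1) ≤ n := by
    exact_mod_cast (by have := Finset.mem_range.1 hk; omega : 2 * (k + 1) ≤ n)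
  simpa only [hH, Nat.cast_succ] using abs_integral_killedHeat_aliveLaw_increment_le μ z hkn

lemma abs_integral_killedHeat_aliveLaw_sub_le (z : ℝ) {n m : ℕ} (hm : 1 ≤ m) (hmn : 2 * m ≤ n) :
    |∫ w, killedHeat z (√((n : ℝ) - m)) w ∂aliveLaw μ (Measure.dirac 0) m
      - 2 * scaledCdf₁ (√n) z * meanOvershoot μ (Measure.dirac 0) m|
    ≤ (130 * beConst * (198 + 6 * thirdMoment (gaussianReal 0 1)) + 80) * thirdMoment μ ^ 3
        * exitMean μ / n := by
  have hK := one_le_beConst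
  set K := beConst
  set L := thirdMoment μ
  have hL : 1 ≤ L := IsStdLaw.one_le_thirdMoment μ
  set G := thirdMoment (gaussianReal 0 1)
  have hG : 1 ≤ G := IsStdLaw.one_le_thirdMoment _
  have hκ : 0 < exitMean μ := exitMean_pos μ
  set κ := exitMean μ
  have hn0 : (0 : ℝ) < n := by exact_mod_cast (by omega : 0 < n)
  have hsum : ∑ k ∈ Finset.range m, survivalProb μ k ≤ 128 * K * L ^ 2 * κ * √n :=
    (sum_survivalProb_le μ m).trans (by gcongr; omega)
  have hL3 : L ≤ L ^ 3 := le_self_pow₀ hL three_ne_zero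
  calc _ ≤ _ := abs_integral_killedHeat_aliveLaw_sub_sum_le μ z hmn
    _ ≤ 6 * (L + G) / (n * √n) * ∑ k ∈ Finset.range m, survivalProb μ k
        + 4 / (n * √n) * (48 * L * ∑ k ∈ Finset.range m, survivalProb μ k)
        + 4 / n * (20 * L * κ) := by
        gcongr
        · exact sum_succ_mul_integral_abs_exitLaw_le μ m
        · exact sum_integral_sq_exitLaw_dirac_le μ m
    _ = (6 * (L + G) + 192 * L) / (n * √n) * ∑ k ∈ Finset.range m, survivalProb μ k
        + 80 * L * κ / n := by ring
    _ ≤ (6 * (L + G) + 192 * L) / (n * √n) * (128 * K * L ^ 2 * κ * √n) + 80 * L * κ / n := by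
        gcongr
    _ = (128 * K * L ^ 2 * (198 * L + 6 * G) + 80 * L) * κ / n := by field_simp; ring
    _ ≤ (130 * K * L ^ 2 * (198 * L + 6 * (G * L)) + 80 * L ^ 3) * κ / n := by
        gcongr
        · norm_num
        · exact le_mul_of_one_le_right (by linarith) hL
    _ = _ := by ring

end KilledAsymptotics

/-- A constant for the error in the asymptotics of the killed walk. -/
noncomputable def killedConst : ℝ :=
  400000000 * beConst ^ 3 + (130 * beConst * (198 + 6 * thirdMoment (gaussianReal 0 1)) + 80)
    + 5000

lemma mul_beConst_pow_le_killedConst : 400000000 * beConst ^ 3 ≤ killedConst := by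
  have hK := one_le_beConst
  have hG := IsStdLaw.one_le_thirdMoment (gaussianReal 0 1)
  have : 0 ≤ 130 * beConst * (198 + 6 * thirdMoment (gaussianReal 0 1)) + 80 := by positivity
  unfold killedConst; linarith

lemma killedConst_pos : 0 < killedConst := by
  have hK := one_le_beConst
  exact lt_of_lt_of_le (by positivity) mul_beConst_pow_le_killedConst

lemma div_three_le_sqrt_mul_sqrt_half {n : ℕ} (hn : 2 ≤ n) :
    (n : ℝ) / 3 ≤ √((n : ℝ) - (n / 2 : ℕ)) * √((n / 2 : ℕ) : ℝ) := by
  have hlow : (n : ℝ) ≤ 3 * (n / 2 : ℕ) := by exact_mod_cast (by omega : n ≤ 3 * (n / 2))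
  have hup : 2 * ((n / 2 : ℕ) : ℝ) ≤ n := by exact_mod_cast (by omega : 2 * (n / 2) ≤ n)
  rw [← Real.sqrt_mul (by linarith)]
  exact Real.le_sqrt_of_sq_le (by nlinarith)

lemma two_mul_stdPdf_eq (x : ℝ) : 2 * stdPdf x = √(2 / Real.pi) * Real.exp (-x ^ 2 / 2) := by
  have h : 2 * (√(2 * Real.pi))⁻¹ = √(2 / Real.pi) := by
    rw [Real.sqrt_mul two_pos.le, Real.sqrt_div two_pos.le]
    have : 0 < √Real.pi := Real.sqrt_pos.2 Real.pi_pos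
    field_simp
    exact (Real.sq_sqrt two_pos.le).symm
  rw [stdPdf, ← mul_assoc, h]

lemma half_le_sqrt_two_div_pi : 1 / 2 ≤ √(2 / Real.pi) := by
  refine Real.le_sqrt_of_sq_le ?_
  rw [div_pow, one_pow, div_le_div_iff₀ (by norm_num) Real.pi_pos]
  linarith [Real.pi_le_four]

lemma sqrt_le_of_sqrt_half_lt {n : ℕ} {a : ℝ} (ha : 1 ≤ a) (hn : √((n / 2 : ℕ) : ℝ) < a) :
    √(n : ℝ) ≤ 2 * a := by
  have hhalf : ((n / 2 : ℕ) : ℝ) < a ^ 2 := (Real.sqrt_lt' (by linarith)).1 hn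
  have hle : (n : ℝ) ≤ 2 * ((n / 2 : ℕ) : ℝ) + 1 := by exact_mod_cast (by omega)
  exact Real.sqrt_le_iff.2 ⟨by linarith, by nlinarith⟩

lemma abs_div_sub_le_four_mul {a p b e η : ℝ} (he0 : 0 ≤ e) (he1 : e ≤ 1) (hη : η ≤ 1 / 2)
    (ha : |a / b - e| ≤ η) (hp : |p / b - 1| ≤ η) : |a / p - e| ≤ 4 * η := by
  have hr : 1 / 2 ≤ p / b := by linarith [(abs_le.1 hp).1]
  have hb : b ≠ 0 := by rintro rfl; norm_num at hr
  have hp0 : p ≠ 0 := by rintro rfl; norm_num at hr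
  have hsplit : a / p - e = ((a / b - e) - e * (p / b - 1)) / (p / b) := by
    field_simp
    ring
  have hη0 : 0 ≤ η := (abs_nonneg _).trans hp
  rw [hsplit, abs_div, abs_of_pos (by linarith : 0 < p / b), div_le_iff₀ (by linarith)]
  calc _ ≤ |a / b - e| + e * |p / b - 1| := by
        simpa only [abs_mul, abs_of_nonneg he0] using abs_sub (a / b - e) (e * (p / b - 1))
    _ ≤ η + 1 * η := by gcongr
    _ = 4 * η * (1 / 2) := by ring
    _ ≤ _ := by gcongr

section SurvivalAsymptotics

variable (μ : Measure ℝ) [IsStdLaw μ] {n : ℕ}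

lemma two_le_of_mul_thirdMoment_le_sqrt_half
    (hn : 8 * beConst * thirdMoment μ ≤ √((n / 2 : ℕ) : ℝ)) : 2 ≤ n := by
  have hK := one_le_beConst
  have hL := IsStdLaw.one_le_thirdMoment μ
  have hpos : 0 < √((n / 2 : ℕ) : ℝ) := lt_of_lt_of_le (by positivity) hn
  have : 0 < n / 2 := by exact_mod_cast Real.sqrt_pos.1 hpos
  omega

lemma survivalProb_half_div_sqrt_le (hn : 8 * beConst * thirdMoment μ ≤ √((n / 2 : ℕ) : ℝ)) :
    survivalProb μ (n / 2) / √((n : ℝ) - (n / 2 : ℕ)) ≤ 96 * exitMean μ / n := by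
  have hκ := exitMean_pos μ
  have h2 := two_le_of_mul_thirdMoment_le_sqrt_half μ hn
  have : (0 : ℝ) < n := by exact_mod_cast (by omega : 0 < n)
  have hsqrt := div_three_le_sqrt_mul_sqrt_half h2
  calc _ ≤ 32 * exitMean μ / √((n / 2 : ℕ) : ℝ) / √((n : ℝ) - (n / 2 : ℕ)) := by
        gcongr; exact survivalProb_le_exitMean_div μ hn
    _ = 32 * exitMean μ / (√((n : ℝ) - (n / 2 : ℕ)) * √((n / 2 : ℕ) : ℝ)) := by
        rw [div_div, mul_comm (√((n / 2 : ℕ) : ℝ))]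
    _ ≤ 32 * exitMean μ / (n / 3) := by gcongr
    _ = 96 * exitMean μ / n := by field_simp; ring

lemma abs_two_mul_scaledCdf₁_mul_exitMean_sub_le
    (hn : 8 * beConst * thirdMoment μ ≤ √((n / 2 : ℕ) : ℝ)) (z : ℝ) :
    |2 * scaledCdf₁ (√n) z * (meanOvershoot μ (Measure.dirac 0) (n / 2) - exitMean μ)|
      ≤ 5000 * thirdMoment μ * exitMean μ / n := by
  have hL := IsStdLaw.one_le_thirdMoment μ
  have hκ := exitMean_pos μ
  have h2 := two_le_of_mul_thirdMoment_le_sqrt_half μ hn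
  have hup : ((n / 2 : ℕ) : ℝ) + 1 ≤ n := by exact_mod_cast (by omega : n / 2 + 1 ≤ n)
  have hs : 0 < √((n : ℝ) - (n / 2 : ℕ)) := Real.sqrt_pos.2 (by linarith)
  have hdens : |2 * scaledCdf₁ (√n) z| ≤ 1 / √((n : ℝ) - (n / 2 : ℕ)) := by
    rw [scaledCdf₁, ← mul_div_assoc, abs_div, abs_of_nonneg (Real.sqrt_nonneg _),
      abs_of_nonneg (by linarith [stdPdf_nonneg (z / √n)])]
    gcongr
    · linarith [stdPdf_le_half (z / √n)]
    · linarith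
  have hmean : |meanOvershoot μ (Measure.dirac 0) (n / 2) - exitMean μ|
      ≤ 48 * thirdMoment μ * survivalProb μ (n / 2) := by
    rw [abs_sub_comm, abs_of_nonneg (sub_nonneg.2 (meanOvershoot_le_exitMean μ _))]
    exact exitMean_sub_le μ _
  rw [abs_mul]
  calc _ ≤ 1 / √((n : ℝ) - (n / 2 : ℕ)) * (48 * thirdMoment μ * survivalProb μ (n / 2)) := by
        gcongr
    _ = 48 * thirdMoment μ * (survivalProb μ (n / 2) / √((n : ℝ) - (n / 2 : ℕ))) := by ring
    _ ≤ 48 * thirdMoment μ * (96 * exitMean μ / n) :=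
        mul_le_mul_of_nonneg_left (survivalProb_half_div_sqrt_le μ hn) (by positivity)
    _ = 4608 * thirdMoment μ * exitMean μ / n := by ring
    _ ≤ _ := by gcongr; norm_num

lemma abs_aliveLaw_dirac_real_Ici_sub_integral_killedHeat_le
    (hn : 8 * beConst * thirdMoment μ ≤ √((n / 2 : ℕ) : ℝ)) {z : ℝ} (hz : 0 ≤ z) :
    |(aliveLaw μ (Measure.dirac 0) n).real (Ici z)
      - ∫ w, killedHeat z (√((n : ℝ) - (n / 2 : ℕ))) w ∂aliveLaw μ (Measure.dirac 0) (n / 2)|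
      ≤ 400000000 * beConst ^ 3 * thirdMoment μ ^ 3 * exitMean μ / n := by
  have hK := one_le_beConst
  have hL := IsStdLaw.one_le_thirdMoment μ
  have hκ := exitMean_pos μ
  have h2 := two_le_of_mul_thirdMoment_le_sqrt_half μ hn
  have hrefl := abs_aliveLaw_real_Ici_sub_le μ
    (integrable_abs_aliveLaw μ (integrable_abs_dirac 0) (n / 2))
    (aliveLaw_Iio μ (dirac_Iio_zero le_rfl) (n / 2)) (by omega : 1 ≤ n - n / 2) hz
  rw [← aliveLaw_add, Nat.add_sub_cancel' (Nat.div_le_self n 2),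
    Nat.cast_sub (Nat.div_le_self n 2)] at hrefl
  calc _ ≤ _ := hrefl
    _ = 4000000 * beConst ^ 3 * thirdMoment μ ^ 3
        * (survivalProb μ (n / 2) / √((n : ℝ) - (n / 2 : ℕ))) := by rw [survivalProb]; ring
    _ ≤ 4000000 * beConst ^ 3 * thirdMoment μ ^ 3 * (96 * exitMean μ / n) :=
        mul_le_mul_of_nonneg_left (survivalProb_half_div_sqrt_le μ hn) (by positivity)
    _ = 384000000 * beConst ^ 3 * thirdMoment μ ^ 3 * exitMean μ / n := by ring
    _ ≤ _ := by gcongr; norm_num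

lemma abs_aliveLaw_dirac_real_Ici_sub_le
    (hn : 8 * beConst * thirdMoment μ ≤ √((n / 2 : ℕ) : ℝ)) {z : ℝ} (hz : 0 ≤ z) :
    |(aliveLaw μ (Measure.dirac 0) n).real (Ici z) - 2 * scaledCdf₁ (√n) z * exitMean μ|
      ≤ killedConst * thirdMoment μ ^ 3 * exitMean μ / n := by
  set L := thirdMoment μ
  have hL : 1 ≤ L := IsStdLaw.one_le_thirdMoment μ
  set G := thirdMoment (gaussianReal 0 1)
  set κ := exitMean μ
  have hκ : 0 < κ := exitMean_pos μ
  have h2 := two_le_of_mul_thirdMoment_le_sqrt_half μ hn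
  have hrefl := abs_aliveLaw_dirac_real_Ici_sub_integral_killedHeat_le μ hn hz
  have hheat := abs_integral_killedHeat_aliveLaw_sub_le μ z (by omega : 1 ≤ n / 2)
    (Nat.mul_div_le n 2)
  have htail : |2 * scaledCdf₁ (√n) z * (meanOvershoot μ (Measure.dirac 0) (n / 2) - κ)|
      ≤ 5000 * L ^ 3 * κ / n :=
    (abs_two_mul_scaledCdf₁_mul_exitMean_sub_le μ hn z).trans
      (by gcongr; exact le_self_pow₀ hL three_ne_zero)
  rw [mul_sub] at htail
  have hconst : killedConst * L ^ 3 * κ / n = 400000000 * beConst ^ 3 * L ^ 3 * κ / n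
      + (130 * beConst * (198 + 6 * G) + 80) * L ^ 3 * κ / n + 5000 * L ^ 3 * κ / n := by
    rw [killedConst]; ring
  rw [hconst]
  exact (abs_sub_le _ _ _).trans (add_le_add ((abs_sub_le _ _ _).trans (add_le_add hrefl hheat))
    htail)

lemma aliveLaw_dirac_real_Ici_zero (μ : Measure ℝ) (n : ℕ) :
    (aliveLaw μ (Measure.dirac 0) n).real (Ici 0) = survivalProb μ n :=
  measureReal_congr ((ae_aliveLaw_nonneg μ (dirac_Iio_zero le_rfl) n).mono fun w hw =>
    eq_true (p := w ∈ Ici 0) hw)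

lemma abs_aliveLaw_dirac_real_Ici_div_sub_le
    (hn : 8 * beConst * thirdMoment μ ≤ √((n / 2 : ℕ) : ℝ)) {x : ℝ} (hx : 0 ≤ x) :
    |(aliveLaw μ (Measure.dirac 0) n).real (Ici (x * √n))
        / (√(2 / Real.pi) * exitMean μ / √n) - Real.exp (-x ^ 2 / 2)|
      ≤ 2 * killedConst * thirdMoment μ ^ 3 / √n := by
  have hL := IsStdLaw.one_le_thirdMoment μ
  have hC := killedConst_pos
  set κ := exitMean μ
  have hκ : 0 < κ := exitMean_pos μ
  set c := √(2 / Real.pi)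
  have hc : 1 / 2 ≤ c := half_le_sqrt_two_div_pi
  have hn0 : (0 : ℝ) < n := by
    exact_mod_cast zero_lt_two.trans_le (two_le_of_mul_thirdMoment_le_sqrt_half μ hn)
  have hB : 0 < c * κ / √n := by positivity
  have hmain := abs_aliveLaw_dirac_real_Ici_sub_le μ hn (z := x * √n) (by positivity)
  rw [scaledCdf₁, mul_div_cancel_right₀ _ (by positivity), ← mul_div_assoc,
    two_mul_stdPdf_eq] at hmain
  rw [div_sub' hB.ne', abs_div, abs_of_pos hB, div_le_iff₀ hB]
  calc _ = _ := by congr 2; ring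
    _ ≤ _ := hmain
    _ ≤ 2 * c * (killedConst * thirdMoment μ ^ 3 * κ / n) :=
        le_mul_of_one_le_left (by positivity) (by linarith)
    _ = _ := by field_simp; rw [Real.sq_sqrt hn0.le]

lemma abs_survivalProb_div_sub_one_le_of_le
    (hn : 8 * beConst * thirdMoment μ ≤ √((n / 2 : ℕ) : ℝ)) :
    |survivalProb μ n / (√(2 / Real.pi) * exitMean μ / √n) - 1|
      ≤ 2 * killedConst * thirdMoment μ ^ 3 / √n := by
  have := abs_aliveLaw_dirac_real_Ici_div_sub_le μ hn le_rfl
  rwa [zero_mul, aliveLaw_dirac_real_Ici_zero, zero_pow two_ne_zero, neg_zero, zero_div,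
    Real.exp_zero] at this

lemma survivalProb_pos (n : ℕ) : 0 < survivalProb μ n := by
  have hL := IsStdLaw.one_le_thirdMoment μ
  have hsqrt : Tendsto (fun N : ℕ => √(N : ℝ)) atTop atTop :=
    Real.tendsto_sqrt_atTop.comp tendsto_natCast_atTop_atTop
  have hhalf := hsqrt.comp (Nat.tendsto_div_const_atTop two_ne_zero)
  obtain ⟨N, hNhalf, hN, hnN⟩ := ((hhalf.eventually_ge_atTop (8 * beConst * thirdMoment μ)).and
    ((hsqrt.eventually_gt_atTop (2 * killedConst * thirdMoment μ ^ 3)).and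
      (eventually_ge_atTop n))).exists
  refine lt_of_lt_of_le ?_ (aliveLaw_real_univ_antitone μ (Measure.dirac 0) hnN)
  have hclose := abs_survivalProb_div_sub_one_le_of_le μ hNhalf
  have hlt : 2 * killedConst * thirdMoment μ ^ 3 / √(N : ℝ) < 1 := by
    have hC := killedConst_pos
    rwa [div_lt_one (lt_trans (by positivity) hN)]
  refine (survivalProb_nonneg μ N).lt_of_ne' fun h0 => ?_
  rw [h0, zero_div, zero_sub, abs_neg, abs_one] at hclose
  exact absurd hclose (not_le.2 hlt)

lemma survivalProb_div_le (hn : 1 ≤ n) :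
    survivalProb μ n / (√(2 / Real.pi) * exitMean μ / √n)
      ≤ 128 * beConst * thirdMoment μ ^ 2 := by
  have hK := one_le_beConst
  have hκ := exitMean_pos μ
  have hc := half_le_sqrt_two_div_pi
  have : (0 : ℝ) < n := by exact_mod_cast hn
  rw [div_le_iff₀ (by positivity)]
  calc _ ≤ _ := survivalProb_le μ n
    _ ≤ 64 * beConst * thirdMoment μ ^ 2 * exitMean μ / √n := by gcongr; linarith
    _ = 128 * beConst * thirdMoment μ ^ 2 * (1 / 2 * exitMean μ / √n) := by ring
    _ ≤ _ := by gcongr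

lemma mul_sq_thirdMoment_le_killedConst_mul_div (hn : 1 ≤ n)
    (hsmall : √((n / 2 : ℕ) : ℝ) < 8 * beConst * thirdMoment μ) :
    128 * beConst * thirdMoment μ ^ 2 ≤ 8 * killedConst * thirdMoment μ ^ 3 / √n := by
  have hK := one_le_beConst
  have hL := IsStdLaw.one_le_thirdMoment μ
  have hC := mul_beConst_pow_le_killedConst
  set K := beConst
  set L := thirdMoment μ
  have hKL : 1 ≤ K * L := one_le_mul_of_one_le_of_one_le hK hL
  have hsqrt := sqrt_le_of_sqrt_half_lt (by linarith) hsmall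
  have : (0 : ℝ) < n := by exact_mod_cast hn
  rw [le_div_iff₀ (by positivity)]
  calc _ ≤ 128 * K * L ^ 2 * (2 * (8 * K * L)) := by gcongr
    _ = 2048 * K ^ 2 * L ^ 3 := by ring
    _ ≤ 2048 * K ^ 3 * L ^ 3 := by gcongr; norm_num
    _ ≤ 8 * killedConst * L ^ 3 := by
      have : 0 ≤ K ^ 3 := by positivity
      gcongr ?_ * L ^ 3
      linarith

lemma abs_survivalProb_div_sub_one_le (hn : 1 ≤ n) :
    |survivalProb μ n / (√(2 / Real.pi) * exitMean μ / √n) - 1|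
      ≤ 8 * killedConst * thirdMoment μ ^ 3 / √n := by
  have hK := one_le_beConst
  have hL := IsStdLaw.one_le_thirdMoment μ
  have hC := killedConst_pos
  by_cases hlarge : 8 * beConst * thirdMoment μ ≤ √((n / 2 : ℕ) : ℝ)
  · refine (abs_survivalProb_div_sub_one_le_of_le μ hlarge).trans ?_
    gcongr
    norm_num
  · refine le_trans ?_ (mul_sq_thirdMoment_le_killedConst_mul_div μ hn (not_le.1 hlarge))
    have hratio0 : 0 ≤ survivalProb μ n / (√(2 / Real.pi) * exitMean μ / √n) := by
      have := exitMean_pos μ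
      have := survivalProb_nonneg μ n
      positivity
    have hbound : 1 ≤ 128 * beConst * thirdMoment μ ^ 2 :=
      one_le_mul_of_one_le_of_one_le (by linarith) (one_le_pow₀ hL)
    exact abs_sub_le_of_nonneg_of_le hratio0 (survivalProb_div_le μ hn) zero_le_one hbound

lemma abs_aliveLaw_dirac_real_Ici_div_survivalProb_sub_le (hn : 1 ≤ n) {x : ℝ} (hx : 0 ≤ x) :
    |(aliveLaw μ (Measure.dirac 0) n).real (Ici (x * √n)) / survivalProb μ n
        - Real.exp (-x ^ 2 / 2)|
      ≤ 8 * killedConst * thirdMoment μ ^ 3 / √n := by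
  have hK := one_le_beConst
  have hL := IsStdLaw.one_le_thirdMoment μ
  have he0 : 0 ≤ Real.exp (-x ^ 2 / 2) := (Real.exp_pos _).le
  have he1 : Real.exp (-x ^ 2 / 2) ≤ 1 := Real.exp_le_one_iff.2 (by linarith [sq_nonneg x])
  have htrivial : |(aliveLaw μ (Measure.dirac 0) n).real (Ici (x * √n)) / survivalProb μ n
      - Real.exp (-x ^ 2 / 2)| ≤ 1 :=
    abs_sub_le_of_nonneg_of_le (div_nonneg measureReal_nonneg (survivalProb_nonneg μ n))
      (div_le_one_of_le₀ (measureReal_mono (subset_univ _)) (survivalProb_nonneg μ n)) he0 he1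
  by_cases hlarge : 8 * beConst * thirdMoment μ ≤ √((n / 2 : ℕ) : ℝ)
  · set η := 2 * killedConst * thirdMoment μ ^ 3 / √n with hη
    have hfour : 8 * killedConst * thirdMoment μ ^ 3 / √n = 4 * η := by rw [hη]; ring
    rw [hfour]
    rcases le_total η (1 / 2) with hηle | hηge
    · exact abs_div_sub_le_four_mul he0 he1 hηle
        (abs_aliveLaw_dirac_real_Ici_div_sub_le μ hlarge hx)
        (abs_survivalProb_div_sub_one_le_of_le μ hlarge)
    · linarith
  · refine htrivial.trans (le_trans ?_
      (mul_sq_thirdMoment_le_killedConst_mul_div μ hn (not_le.1 hlarge)))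
    exact one_le_mul_of_one_le_of_one_le (by linarith) (one_le_pow₀ hL)

lemma tendsto_survivalProb : Tendsto (survivalProb μ) atTop (𝓝 0) := by
  refine squeeze_zero (survivalProb_nonneg μ) (aliveLaw_dirac_real_univ_le μ le_rfl)
    (Tendsto.const_div_atTop ?_ _)
  exact Real.tendsto_sqrt_atTop.comp
    (tendsto_atTop_add_const_right _ _ tendsto_natCast_atTop_atTop)

end SurvivalAsymptotics

/-! ### From the killed laws to random walks -/

section Walk

variable {Ω : Type*} {X : ℕ → Ω → ℝ}

lemma lt_exitTime_iff (n : ℕ) (ω : Ω) :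
    (n : WithTop ℕ) < exitTime X ω ↔ ∀ i, 1 ≤ i → i ≤ n → 0 < walk X i ω := by
  rw [← not_le, exitTime]
  refine (not_congr (hittingAfter_le_iff (i := n))).trans ?_
  simp only [mem_Icc, mem_Iic, not_exists, not_and, not_le, and_imp]

lemma setOf_lt_exitTime_succ (n : ℕ) :
    {ω | ((n + 1 : ℕ) : WithTop ℕ) < exitTime X ω}
      = {ω | (n : WithTop ℕ) < exitTime X ω} ∩ walk X (n + 1) ⁻¹' Ioi 0 := by
  ext ω
  simp only [mem_ofPred_eq, lt_exitTime_iff, mem_inter_iff, mem_preimage, mem_Ioi]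
  grind

lemma setOf_exitTime_eq_succ (k : ℕ) :
    {ω | exitTime X ω = ((k + 1 : ℕ) : WithTop ℕ)}
      = {ω | (k : WithTop ℕ) < exitTime X ω} ∩ walk X (k + 1) ⁻¹' Iic 0 := by
  have heq : ∀ t : WithTop ℕ, t = ((k + 1 : ℕ) : WithTop ℕ)
      ↔ (k : WithTop ℕ) < t ∧ ¬((k + 1 : ℕ) : WithTop ℕ) < t := by
    intro t
    cases t with
    | top =>
      exact iff_of_false (WithTop.natCast_ne_top _).symm fun h => h.2 (WithTop.natCast_lt_top _)
    | coe m =>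
      simp only [← WithTop.coe_natCast, Nat.cast_id, WithTop.coe_inj, WithTop.coe_lt_coe]
      omega
  ext ω
  have hsucc := Set.ext_iff.1 (setOf_lt_exitTime_succ (X := X) k) ω
  simp only [mem_ofPred_eq, mem_inter_iff, mem_preimage, mem_Ioi, mem_Iic] at hsucc ⊢
  rw [heq, hsucc, ← not_lt]
  tauto

lemma iUnion_setOf_exitTime_eq_succ :
    ⋃ k : ℕ, {ω | exitTime X ω = ((k + 1 : ℕ) : WithTop ℕ)} = {ω | exitTime X ω ≠ ⊤} := by
  ext ω
  simp only [mem_iUnion, mem_ofPred_eq]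
  refine ⟨fun ⟨k, hk⟩ => hk ▸ WithTop.coe_ne_top, fun hω => ?_⟩
  obtain ⟨m, hm⟩ := WithTop.ne_top_iff_exists.1 hω
  have hm1 : WithTop.some 1 ≤ exitTime X ω := le_hittingAfter ω
  rw [← hm, WithTop.coe_le_coe] at hm1
  exact ⟨m - 1, by rw [← hm, Nat.sub_add_cancel hm1]; rfl⟩

lemma pairwise_disjoint_setOf_exitTime_eq_succ :
    Pairwise (Function.onFun Disjoint
      fun k : ℕ => {ω | exitTime X ω = ((k + 1 : ℕ) : WithTop ℕ)}) := fun _ _ hij =>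
  Set.disjoint_left.2 fun _ hi hj => hij <|
    Nat.succ_injective (WithTop.coe_injective (hi.symm.trans hj))

lemma exitValue_of_exitTime_eq {n : ℕ} {ω : Ω} (h : exitTime X ω = (n : WithTop ℕ)) :
    exitValue X ω = walk X n ω := by
  rw [exitValue, stoppedValue, h]
  rfl

lemma measurable_walk {_ : MeasurableSpace Ω} {n : ℕ} (h : ∀ i < n, Measurable (X i)) {i : ℕ}
    (hi : i ≤ n) : Measurable (walk X i) :=
  Finset.measurable_fun_sum _ fun j hj => h j ((Finset.mem_range.1 hj).trans_le hi)

lemma measurableSet_lt_exitTime {m : MeasurableSpace Ω} {n : ℕ} (h : ∀ i < n, Measurable (X i)) :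
    MeasurableSet {ω | (n : WithTop ℕ) < exitTime X ω} := by
  have hinter : {ω | (n : WithTop ℕ) < exitTime X ω} = ⋂ i ∈ Icc 1 n, walk X i ⁻¹' Ioi 0 := by
    ext ω
    simp [lt_exitTime_iff]
  rw [hinter]
  exact MeasurableSet.biInter (Set.to_countable _) fun i hi =>
    measurable_walk h hi.2 measurableSet_Ioi

lemma measurableSet_exitTime_eq_succ {m : MeasurableSpace Ω} (h : ∀ i, Measurable (X i)) (k : ℕ) :
    MeasurableSet {ω | exitTime X ω = ((k + 1 : ℕ) : WithTop ℕ)} := by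
  rw [setOf_exitTime_eq_succ]
  exact (measurableSet_lt_exitTime fun i _ => h i).inter
    (measurable_walk (fun i _ => h i) le_rfl measurableSet_Iic)

lemma walk_div (σ : ℝ) (n : ℕ) (ω : Ω) : walk (fun i ω => X i ω / σ) n ω = walk X n ω / σ := by
  simp only [walk, Finset.sum_div]

lemma exitTime_div {σ : ℝ} (hσ : 0 < σ) : exitTime (fun i ω => X i ω / σ) = exitTime X := by
  have hmem : ∀ i ω, walk (fun i ω => X i ω / σ) i ω ∈ Iic (0 : ℝ) ↔ walk X i ω ∈ Iic 0 := by
    intro i ω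
    rw [walk_div, mem_Iic, mem_Iic, div_le_iff₀ hσ, zero_mul]
  funext ω
  simp only [exitTime, hittingAfter]
  by_cases hex : ∃ j, 1 ≤ j ∧ walk X j ω ∈ Iic 0
  · rw [if_pos hex, if_pos (by simpa only [hmem] using hex)]
    simp only [hmem]
  · rw [if_neg hex, if_neg (by simpa only [hmem] using hex)]

lemma exitValue_div {σ : ℝ} (hσ : 0 < σ) (ω : Ω) :
    exitValue (fun i ω => X i ω / σ) ω = exitValue X ω / σ := by
  simp only [exitValue, stoppedValue, exitTime_div hσ, walk_div]

lemma setOf_le_walk_div {σ r : ℝ} (hr : 0 < r) (n : ℕ) (x : ℝ) :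
    {ω | x ≤ walk X n ω / (σ * r)} = walk (fun i ω => X i ω / σ) n ⁻¹' Ici (x * r) := by
  ext ω
  rw [mem_ofPred_eq, mem_preimage, mem_Ici, walk_div, ← div_div, le_div_iff₀ hr]

end Walk

/-- An i.i.d. sequence of real random variables. -/
structure IsIIDSeq {Ω : Type*} [MeasurableSpace Ω] (X : ℕ → Ω → ℝ) (P : Measure Ω) : Prop where
  measurable : ∀ i, Measurable (X i)
  iIndepFun : iIndepFun X P
  identDistrib : ∀ i, IdentDistrib (X i) (X 0) P P

namespace IsIIDSeq

variable {Ω : Type*} [MeasurableSpace Ω] {P : Measure Ω} {X : ℕ → Ω → ℝ}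

lemma div_const (h : IsIIDSeq X P) (σ : ℝ) : IsIIDSeq (fun i ω => X i ω / σ) P where
  measurable i := (h.measurable i).div_const σ
  iIndepFun := h.iIndepFun.comp (fun _ x => x / σ) fun _ => by fun_prop
  identDistrib i := (h.identDistrib i).comp (u := fun x => x / σ) (by fun_prop)

lemma measurable_walk (h : IsIIDSeq X P) (n : ℕ) : Measurable (walk X n) :=
  _root_.measurable_walk (fun i _ => h.measurable i) le_rfl

lemma indep_iSup_comap (h : IsIIDSeq X P) (n : ℕ) :
    Indep (⨆ j ∈ Iio n, MeasurableSpace.comap (X j) inferInstance)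
      (MeasurableSpace.comap (X n) inferInstance) P := by
  have := indep_iSup_of_disjoint (S := Iio n) (T := {n}) (fun i => (h.measurable i).comap_le)
    h.iIndepFun (by simp)
  rwa [iSup_singleton] at this

lemma exitValue_ae_eq_walk (h : IsIIDSeq X P) (k : ℕ) :
    exitValue X =ᵐ[P.restrict {ω | exitTime X ω = ((k + 1 : ℕ) : WithTop ℕ)}] walk X (k + 1) :=
  (ae_restrict_mem (measurableSet_exitTime_eq_succ h.measurable k)).mono fun _ =>
    exitValue_of_exitTime_eq

lemma aemeasurable_exitValue_restrict (h : IsIIDSeq X P) (k : ℕ) :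
    AEMeasurable (exitValue X) (P.restrict {ω | exitTime X ω = ((k + 1 : ℕ) : WithTop ℕ)}) :=
  (h.measurable_walk (k + 1)).aemeasurable.congr (h.exitValue_ae_eq_walk k).symm

variable [IsProbabilityMeasure P]

lemma map_walk_succ_restrict (h : IsIIDSeq X P) (n : ℕ) :
    (P.restrict {ω | (n : WithTop ℕ) < exitTime X ω}).map (walk X (n + 1))
      = (P.restrict {ω | (n : WithTop ℕ) < exitTime X ω}).map (walk X n) ∗ P.map (X 0) := by
  set E := {ω | (n : WithTop ℕ) < exitTime X ω}
  have hw := h.measurable_walk n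
  have hXn := h.measurable n
  have : IsProbabilityMeasure (P.map (X 0)) :=
    Measure.isProbabilityMeasure_map (h.measurable 0).aemeasurable
  have hpast : ∀ i < n, Measurable[⨆ j ∈ Iio n, MeasurableSpace.comap (X j) inferInstance] (X i) :=
    fun i hi => Measurable.of_comap_le (le_iSup₂_of_le (f := fun i (_ : i ∈ Iio n) =>
      MeasurableSpace.comap (X i) inferInstance) i hi le_rfl)
  have hprod : (P.restrict E).map (fun ω => (walk X n ω, X n ω))
      = ((P.restrict E).map (walk X n)).prod (P.map (X 0)) := by
    refine (Measure.prod_eq fun s t hs ht => ?_).symm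
    rw [Measure.map_apply (hw.prodMk hXn) (hs.prod ht), Measure.map_apply hw hs,
      ← (h.identDistrib n).map_eq, Measure.map_apply hXn ht, mk_preimage_prod,
      Measure.restrict_apply ((hw hs).inter (hXn ht)), Measure.restrict_apply (hw hs),
      inter_right_comm]
    exact (Indep_iff _ _ _).1 (h.indep_iSup_comap n) _ _
      ((_root_.measurable_walk hpast le_rfl hs).inter (measurableSet_lt_exitTime hpast))
      ⟨t, ht, rfl⟩
  have hadd : walk X (n + 1) = (fun p : ℝ × ℝ => p.1 + p.2) ∘ fun ω => (walk X n ω, X n ω) := by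
    funext ω
    simp [walk, Finset.sum_range_succ]
  rw [hadd, ← Measure.map_map (by fun_prop) (hw.prodMk hXn), hprod, Measure.conv]

lemma map_walk_restrict_lt_exitTime (h : IsIIDSeq X P) (n : ℕ) :
    (P.restrict {ω | (n : WithTop ℕ) < exitTime X ω}).map (walk X n)
      = aliveLaw (P.map (X 0)) (Measure.dirac 0) n := by
  induction n with
  | zero =>
    have huniv : {ω | ((0 : ℕ) : WithTop ℕ) < exitTime X ω} = univ := by
      ext ω
      simp only [mem_ofPred_eq, lt_exitTime_iff, mem_univ, iff_true]
      omega
    have hzero : walk X 0 = fun _ => 0 := by funext; simp [walk]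
    rw [huniv, Measure.restrict_univ, hzero, Measure.map_const, measure_univ, one_smul,
      aliveLaw_zero]
  | succ n ih =>
    have hw := h.measurable_walk (n + 1)
    rw [setOf_lt_exitTime_succ, inter_comm, ← Measure.restrict_restrict (hw measurableSet_Ioi),
      ← Measure.restrict_map hw measurableSet_Ioi, h.map_walk_succ_restrict, ih, aliveLaw_succ]

lemma real_lt_exitTime_inter (h : IsIIDSeq X P) (n : ℕ) {s : Set ℝ} (hs : MeasurableSet s) :
    P.real ({ω | (n : WithTop ℕ) < exitTime X ω} ∩ walk X n ⁻¹' s)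
      = (aliveLaw (P.map (X 0)) (Measure.dirac 0) n).real s := by
  have hw := h.measurable_walk n
  rw [← h.map_walk_restrict_lt_exitTime, map_measureReal_apply hw hs,
    measureReal_restrict_apply (hw hs), inter_comm]

lemma real_lt_exitTime (h : IsIIDSeq X P) (n : ℕ) :
    P.real {ω | (n : WithTop ℕ) < exitTime X ω} = survivalProb (P.map (X 0)) n := by
  rw [survivalProb, ← h.real_lt_exitTime_inter n .univ, preimage_univ, inter_univ]

lemma cond_real_walk_preimage (h : IsIIDSeq X P) (n : ℕ) {s : Set ℝ} (hs : MeasurableSet s) :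
    (P[|{ω | (n : WithTop ℕ) < exitTime X ω}]).real (walk X n ⁻¹' s)
      = (aliveLaw (P.map (X 0)) (Measure.dirac 0) n).real s / survivalProb (P.map (X 0)) n := by
  rw [Measure.real, cond_apply (measurableSet_lt_exitTime fun i _ => h.measurable i),
    ENNReal.toReal_mul, ENNReal.toReal_inv, ← measureReal_def, ← measureReal_def,
    h.real_lt_exitTime_inter n hs, h.real_lt_exitTime, inv_mul_eq_div]

lemma ae_exitTime_ne_top (h : IsIIDSeq X P) [IsStdLaw (P.map (X 0))] :
    ∀ᵐ ω ∂P, exitTime X ω ≠ ⊤ := by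
  simp only [ae_iff, not_not]
  rw [← measureReal_eq_zero_iff]
  refine le_antisymm (ge_of_tendsto' (tendsto_survivalProb (P.map (X 0))) fun n => ?_)
    measureReal_nonneg
  rw [← h.real_lt_exitTime]
  exact measureReal_mono fun ω (hω : exitTime X ω = ⊤) => by simp [hω]

lemma map_exitValue_restrict_exitTime_eq (h : IsIIDSeq X P) (k : ℕ) :
    (P.restrict {ω | exitTime X ω = ((k + 1 : ℕ) : WithTop ℕ)}).map (exitValue X)
      = exitLaw (P.map (X 0)) (Measure.dirac 0) k := by
  have hw := h.measurable_walk (k + 1)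
  rw [Measure.map_congr (h.exitValue_ae_eq_walk k), setOf_exitTime_eq_succ, inter_comm,
    ← Measure.restrict_restrict (hw measurableSet_Iic), ← Measure.restrict_map hw measurableSet_Iic,
    h.map_walk_succ_restrict, h.map_walk_restrict_lt_exitTime, exitLaw]

lemma setIntegral_comp_exitValue (h : IsIIDSeq X P) (k : ℕ) {f : ℝ → ℝ} (hf : Continuous f) :
    ∫ ω in {ω | exitTime X ω = ((k + 1 : ℕ) : WithTop ℕ)}, f (exitValue X ω) ∂P
      = ∫ w, f w ∂exitLaw (P.map (X 0)) (Measure.dirac 0) k := by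
  rw [← h.map_exitValue_restrict_exitTime_eq, integral_map (h.aemeasurable_exitValue_restrict k)
    hf.aestronglyMeasurable]

variable [IsStdLaw (P.map (X 0))]

lemma integrableOn_exitValue (h : IsIIDSeq X P) :
    IntegrableOn (exitValue X) (⋃ k : ℕ, {ω | exitTime X ω = ((k + 1 : ℕ) : WithTop ℕ)}) P := by
  refine integrableOn_iUnion_of_summable_integral_norm (fun k => ?_) ?_
  · have habs := integrable_abs_exitLaw (P.map (X 0)) (integrable_abs_dirac 0) k
    rw [← h.map_exitValue_restrict_exitTime_eq] at habs
    exact (integrable_map_measure (by fun_prop) (h.aemeasurable_exitValue_restrict k)).1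
      ((integrable_norm_iff (f := fun x : ℝ => x) (by fun_prop)).1 habs)
  · simp only [Real.norm_eq_abs, h.setIntegral_comp_exitValue _ continuous_abs]
    exact summable_integral_abs_exitLaw (P.map (X 0))

lemma restrict_iUnion_exitTime_eq (h : IsIIDSeq X P) :
    P.restrict (⋃ k : ℕ, {ω | exitTime X ω = ((k + 1 : ℕ) : WithTop ℕ)}) = P := by
  rw [iUnion_setOf_exitTime_eq_succ, Measure.restrict_eq_self_of_ae_mem]
  exact h.ae_exitTime_ne_top

lemma integrable_exitValue (h : IsIIDSeq X P) : Integrable (exitValue X) P := by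
  have := h.integrableOn_exitValue
  rwa [IntegrableOn, h.restrict_iUnion_exitTime_eq] at this

lemma integral_exitValue (h : IsIIDSeq X P) :
    ∫ ω, exitValue X ω ∂P = -exitMean (P.map (X 0)) := by
  have hsum := integral_iUnion (measurableSet_exitTime_eq_succ h.measurable)
    pairwise_disjoint_setOf_exitTime_eq_succ h.integrableOn_exitValue
  rw [h.restrict_iUnion_exitTime_eq] at hsum
  simp only [hsum, h.setIntegral_comp_exitValue _ continuous_id', exitMean, integral_abs_exitLaw,
    tsum_neg, neg_neg]

end IsIIDSeq

section Normalisation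

variable {Ω : Type*} [MeasurableSpace Ω] {P : Measure Ω} {Z : Ω → ℝ} {σ : ℝ}

lemma isStdLaw_map_div [IsProbabilityMeasure P] (hZ : Measurable Z) (hσ : 0 < σ)
    (hmean : ∫ ω, Z ω ∂P = 0) (hsq : ∫ ω, |Z ω| ^ 2 ∂P = σ ^ 2)
    (hcube : Integrable (fun ω => |Z ω| ^ 3) P) : IsStdLaw (P.map fun ω => Z ω / σ) := by
  have hm : AEMeasurable (fun ω => Z ω / σ) P := (hZ.div_const σ).aemeasurable
  have : IsProbabilityMeasure (P.map fun ω => Z ω / σ) := Measure.isProbabilityMeasure_map hm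
  refine { integrable_cube := ?_, mean := ?_, sq := ?_ }
  · rw [integrable_map_measure (by fun_prop) hm]
    refine (hcube.div_const (σ ^ 3)).congr (.of_forall fun ω => ?_)
    simp [abs_div, div_pow, abs_of_pos hσ]
  · rw [integral_map hm (by fun_prop), integral_div, hmean, zero_div]
  · simp only [sq_abs] at hsq
    simp only [integral_map hm (by fun_prop : AEStronglyMeasurable (fun x : ℝ => x ^ 2) _), div_pow,
      integral_div, hsq, div_self (pow_ne_zero 2 hσ.ne')]

lemma thirdMoment_map_div (hZ : Measurable Z) (hσ : 0 < σ) :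
    thirdMoment (P.map fun ω => Z ω / σ) = (∫ ω, |Z ω| ^ 3 ∂P) / σ ^ 3 := by
  rw [thirdMoment, integral_map (hZ.div_const σ).aemeasurable (by fun_prop)]
  simp only [abs_div, div_pow, abs_of_pos hσ, integral_div]

end Normalisation

theorem theorem1 :
    ∃ A : ℝ, ∀ (Ω : Type*) [MeasurableSpace Ω] (P : Measure Ω) [IsProbabilityMeasure P]
      (X : ℕ → Ω → ℝ) (σ : ℝ),
      (∀ i, Measurable (X i)) →
      iIndepFun X P →
      (∀ i, IdentDistrib (X i) (X 0) P P) →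
      0 < σ →
      ∫ ω, X 0 ω ∂P = 0 →
      ∫ ω, |X 0 ω| ^ 2 ∂P = σ ^ 2 →
      Integrable (fun ω => |X 0 ω| ^ 3) P →
      -- the exit position is defined almost surely, and its mean exists and does not vanish
      (∀ᵐ ω ∂P, exitTime X ω ≠ ⊤) ∧
      Integrable (exitValue X) P ∧
      ∫ ω, exitValue X ω ∂P ≠ 0 ∧
      ∀ n : ℕ, 1 ≤ n →
        -- the conditioning event has positive probability
        0 < P.real {ω | (n : WithTop ℕ) < exitTime X ω} ∧
        (∀ x : ℝ, 0 ≤ x →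
          |(P[|{ω | (n : WithTop ℕ) < exitTime X ω}]).real
                {ω | x ≤ walk X n ω / (σ * √(n : ℝ))} - Real.exp (-x ^ 2 / 2)|
            ≤ A * (∫ ω, |X 0 ω| ^ 3 ∂P) ^ 3 / (σ ^ 9 * √(n : ℝ))) ∧
        |P.real {ω | (n : WithTop ℕ) < exitTime X ω} /
              (√(2 / Real.pi) * |∫ ω, exitValue X ω ∂P| / (σ * √(n : ℝ))) - 1|
          ≤ A * (∫ ω, |X 0 ω| ^ 3 ∂P) ^ 3 / (σ ^ 9 * √(n : ℝ)) := by
  refine ⟨8 * killedConst, fun Ω _ P _ X σ hX hind hid hσ hmean hsq hcube => ?_⟩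
  set Y : ℕ → Ω → ℝ := fun i ω => X i ω / σ
  have hY : IsIIDSeq Y P := IsIIDSeq.div_const ⟨hX, hind, hid⟩ σ
  have hstd : IsStdLaw (P.map (Y 0)) := isStdLaw_map_div (hX 0) hσ hmean hsq hcube
  have hpos : 0 < σ * exitMean (P.map (Y 0)) := mul_pos hσ (exitMean_pos _)
  have hvalue : exitValue X = fun ω => σ * exitValue Y ω := by
    funext ω; rw [exitValue_div hσ, mul_div_cancel₀ _ hσ.ne']
  have hint : ∫ ω, exitValue X ω ∂P = -(σ * exitMean (P.map (Y 0))) := by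
    rw [hvalue, integral_const_mul, hY.integral_exitValue, mul_neg]
  rw [← exitTime_div hσ, hint]
  refine ⟨hY.ae_exitTime_ne_top, hvalue ▸ hY.integrable_exitValue.const_mul σ,
    (neg_neg_of_pos hpos).ne, fun n hn => ?_⟩
  have hn0 : 0 < √(n : ℝ) := Real.sqrt_pos.2 (Nat.cast_pos.2 hn)
  have hbound : 8 * killedConst * (∫ ω, |X 0 ω| ^ 3 ∂P) ^ 3 / (σ ^ 9 * √(n : ℝ))
      = 8 * killedConst * thirdMoment (P.map (Y 0)) ^ 3 / √n := by
    rw [thirdMoment_map_div (hX 0) hσ]; field_simp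
  rw [hbound, hY.real_lt_exitTime]
  refine ⟨survivalProb_pos _ n, fun x hx => ?_, ?_⟩
  · rw [setOf_le_walk_div hn0, hY.cond_real_walk_preimage n measurableSet_Ici]
    exact abs_aliveLaw_dirac_real_Ici_div_survivalProb_sub_le _ hn hx
  · rw [abs_neg, abs_of_pos hpos, mul_left_comm, mul_div_mul_left _ _ hσ.ne']
    exact abs_survivalProb_div_sub_one_le _ hn
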